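/- **Setting.** Let $f:\mathcal X\to\mathbb R$ attain its maximum at $x^\star$. Let $\mathcal P$ be a hierarchical partitioning of $\mathcal X$: the single cell of depth $0$ is $\mathcal X$, and each cell of depth $h$ is split into at most $K$ nonempty disjoint subcells of depth $h+1$. The function $f$ and the cells are measurable. A pair $(\nu,\rho)$ with $\nu>0$, $\rho\in(0,1)$ satisfies the *local smoothness assumption* if for all $h\ge 0$, every $x$ in the cell of depth $h$ containing $x^\star$ has $f(x)\ge f(x^\star)-\nu\rho^h$. Let $\mathcal N_h(\varepsilon)$ be the number of cells of depth $h$ on which $\sup f\ge f(x^\star)-\varepsilon$, and let $$d(\nu,\rho)=\inf A(\nu,\rho),\qquad A(\nu,\rho)=\{d'\ge 0:\exists C>0\ \forall h\ge 0,\ \mathcal N_h(2\nu\rho^h)\le C\rho^{-d'h}\}.$$ Evaluation $t$ at a point $x_t$ returns $r_t=f(x_t)+\varepsilon_t$, where the noise has conditional mean $0$ given the past and $x_t$, and where the rewards at each given point lie in an interval of length $1$ (for instance, all rewards lie in $[0,1]$). **HOO with parameters $(\nu,\rho)$.** After $t$ evaluations, a node is explored if it has been selected before; a leaf is an unexplored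 node all of whose proper ancestors are explored. For an explored node let $$U_{h,i}(t)=\widehat\mu_{h,i}(t)+\sqrt{2\ln t/N_{h,i}(t)}+\nu\rho^h,$$ where $N_{h,i}(t)$ and $\widehat\mu_{h,i}(t)$ are the number and the average of the evaluations done in the cell. HOO selects a leaf whose path from the root maximizes the minimum of $U$ over the explored nodes of the path (ties broken arbitrarily) and evaluates $f$ at any point of its cell. **POO with parameters $(\nu_{\max},\rho_{\max})$.** Let $D_{\max}=\ln K/\ln(1/\rho_{\max})$. POO runs $N$ instances of HOO, with parameters $(\nu_{\max},\rho_{\max}^{N/i})$, $1\le i\le N$. It starts with $N=1$ and no evaluation. When all instances have done the same number $m$ of evaluations, so that $n=Nm$ evaluations were done in total: if $n\ge2$ and $N<\frac12D_{\max}\ln(n/\ln n)$, then $N$ is doubled and each new instance performs $m$ evaluations; otherwise every instance performs one more evaluation. After $T\ge 1$ evaluations, consider the last moment at which all instances were on par; POO takes an instance with the largest average reward at that moment and outputs one of the points that this instance had evaluated by then, chosen uniformly at random given the past. Let $R_T=\sup_{x}f(x)-f(x(T))$, where $x(T)$ is the output. **Theorem (simple regret of POO).** Let $(\nu,\rho)$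 and $(\nu_\star,\rho_\star)$ satisfy the local smoothness assumption (for example $(\nu_\star,\rho_\star)$ minimizes $d$ among such pairs, or $(\nu_\star,\rho_\star)=(\nu,\rho)$). Let $d=d(\nu,\rho)$ if the infimum defining $d(\nu,\rho)$ is attained, or let $d$ be any number $>d(\nu,\rho)$. Then there is $\alpha>0$, independent of $\nu_{\max}$, $\rho_{\max}$, $T$, the noise and the choices of the algorithm, such that for all $\nu_{\max}\ge\max(\nu,\nu_\star)$, all $\rho_{\max}\in[\rho,1)$ and all $T\ge 2$: POO uses at most $\max(1,D_{\max}\ln T)$ HOO instances during its first $T$ evaluations, and the simple regret of every run of POO is integrable and satisfies $$\mathbb E[R_T]\le\kappa\left(\frac{\ln^2T}{T}\right)^{1/(d+2)},\qquad \kappa=\alpha\,D_{\max}\left(\frac{\nu_{\max}}{\nu_\star}\right)^{D_{\max}}.$$ -/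

import Mathlib

open MeasureTheory

noncomputable section

/-- A hierarchical partitioning of `X` in which every cell is split into at most `K` subcells.
A node of depth `h` is addressed by a list of length `h`, the most recent choice first, so that
`i :: u` is a child of `u` and the ancestors of `u` are the suffixes of `u`. An address whose cell
is empty is not a node of the tree; the nonempty cells of each depth form a partition of `X`. -/
structure HierarchicalPartition (X : Type*) (K : ℕ) where
  cell : List (Fin K) → Set X
  cell_root : cell [] = Set.univ
  cell_split : ∀ u, ⋃ i, cell (i :: u) = cell u
  cell_disjoint : ∀ u i j, i ≠ j → Disjoint (cell (i :: u)) (cell (j :: u))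

namespace HierarchicalPartition

variable {X : Type*} {K : ℕ}

/-- Local smoothness of `f` around `xs` with parameters `(ν, ρ)`: for each depth `h`, on the cell
of depth `h` which contains `xs`, the function is at least `f xs - ν ρ ^ h`. -/
def LocallySmooth (P : HierarchicalPartition X K) (f : X → ℝ) (xs : X) (ν ρ : ℝ) : Prop :=
  0 < ν ∧ 0 < ρ ∧ ρ < 1 ∧
    ∀ u, xs ∈ P.cell u → ∀ x ∈ P.cell u, f xs - ν * ρ ^ u.length ≤ f x

/-- The number of cells of depth `h` on which the supremum of `f` is at least `f xs - ε`. -/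
def numNearOpt (P : HierarchicalPartition X K) (f : X → ℝ) (xs : X) (h : ℕ) (ε : ℝ) : ℕ :=
  Set.ncard {u : List (Fin K) |
    u.length = h ∧ (P.cell u).Nonempty ∧ f xs - ε ≤ sSup (f '' P.cell u)}

/-- The set of `d ≥ 0` for which some `C > 0` satisfies `N_h(2 ν ρ ^ h) ≤ C ρ ^ (-d h)` for
all `h`. -/
def nearOptExponents (P : HierarchicalPartition X K) (f : X → ℝ) (xs : X) (ν ρ : ℝ) : Set ℝ :=
  {d | 0 ≤ d ∧ ∃ C : ℝ, 0 < C ∧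
    ∀ h : ℕ, (P.numNearOpt f xs h (2 * ν * ρ ^ h) : ℝ) ≤ C * ρ ^ (-d * (h : ℝ))}

/-- The near-optimality dimension `d(ν, ρ)`. -/
def nearOptDim (P : HierarchicalPartition X K) (f : X → ℝ) (xs : X) (ν ρ : ℝ) : ℝ :=
  sInf (P.nearOptExponents f xs ν ρ)

/-! ### HOO

One instance of HOO with parameters `(ν, ρ)` is described at the moment when it has performed the
evaluations with labels in the finite set `S`: evaluation `s ∈ S` was made for the node `node s`,
at the point `pt s`, and returned `rew s`. -/

open Classical in
/-- The evaluations of the instance that were done within the cell of `u`. -/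
def evalsIn (P : HierarchicalPartition X K) (S : Finset ℕ) (pt : ℕ → X) (u : List (Fin K)) :
    Finset ℕ :=
  S.filter fun s => pt s ∈ P.cell u

/-- The upper confidence value `U` of the node `u`. It is used for nodes with at least one
evaluation only. -/
def hooU (P : HierarchicalPartition X K) (ν ρ : ℝ) (S : Finset ℕ) (pt : ℕ → X) (rew : ℕ → ℝ)
    (u : List (Fin K)) : ℝ :=
  (∑ s ∈ P.evalsIn S pt u, rew s) / ((P.evalsIn S pt u).card : ℝ)
    + Real.sqrt (2 * Real.log (S.card : ℝ) / ((P.evalsIn S pt u).card : ℝ))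
    + ν * ρ ^ u.length

/-- `u` is a leaf of the explored tree: a yet unexplored node all of whose proper ancestors have
been explored. -/
def IsLeaf (P : HierarchicalPartition X K) (S : Finset ℕ) (node : ℕ → List (Fin K))
    (u : List (Fin K)) : Prop :=
  (P.cell u).Nonempty ∧ (∀ s ∈ S, node s ≠ u) ∧
    ∀ a, a <:+ u → a ≠ u → ∃ s ∈ S, node s = a

/-- The smallest value `U` along the path from the root to the leaf `u` (the leaf itself, which has
no evaluations, counts as `+∞`). -/
def pathValue (P : HierarchicalPartition X K) (ν ρ : ℝ) (S : Finset ℕ) (pt : ℕ → X)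
    (rew : ℕ → ℝ) (u : List (Fin K)) : EReal :=
  ⨅ a ∈ {a : List (Fin K) | a <:+ u ∧ a ≠ u}, ((P.hooU ν ρ S pt rew a : ℝ) : EReal)

/-- HOO may select `u` next: `u` is a leaf, and the path to `u` maximizes, among the paths to all
leaves, the smallest value `U` along the path. Ties may be broken arbitrarily. -/
def HOOSelects (P : HierarchicalPartition X K) (ν ρ : ℝ) (S : Finset ℕ)
    (node : ℕ → List (Fin K)) (pt : ℕ → X) (rew : ℕ → ℝ) (u : List (Fin K)) : Prop :=
  P.IsLeaf S node u ∧
    ∀ w, P.IsLeaf S node w → P.pathValue ν ρ S pt rew w ≤ P.pathValue ν ρ S pt rew u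

end HierarchicalPartition

/-! ### The schedule of POO -/

/-- `D_max = ln K / ln (1 / ρ_max)`. -/
def pooDmax (K : ℕ) (ρmax : ℝ) : ℝ := Real.log (K : ℝ) / Real.log (1 / ρmax)

/-- The successive states `(N, m)` of POO in which all instances are on par: there are `N`
instances and each of them has performed `m` evaluations, so that `n = N * m` evaluations have been
done. If `N < (D / 2) ln (n / ln n)` then the number of instances is doubled, and each new instance
performs `m` evaluations; otherwise each instance performs one more evaluation. -/
def pooState (D : ℝ) : ℕ → ℕ × ℕ
  | 0 => (1, 0)
  | k + 1 =>
    let N := (pooState D k).1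
    let m := (pooState D k).2
    let n : ℝ := ((N * m : ℕ) : ℝ)
    open Classical in
    if 2 ≤ N * m ∧ (N : ℝ) < D / 2 * Real.log (n / Real.log n) then (2 * N, m) else (N, m + 1)

/-- The number of evaluations done when the `k`-th state is reached. -/
def pooTotal (D : ℝ) (k : ℕ) : ℕ := (pooState D k).1 * (pooState D k).2

/-- The index of the last state that has been reached after `t` evaluations (`pooTotal` is strictly
increasing, so it is at most `t`). -/
def pooPhase (D : ℝ) (t : ℕ) : ℕ := Nat.findGreatest (fun k => pooTotal D k ≤ t) t

/-- The number of the instance that performs evaluation `t`, where evaluations are numbered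
`0, 1, 2, …` and instances are numbered `0, 1, 2, …` in the order in which they are launched.
In a phase which does not launch new instances the old ones are served in turn; in a phase which
doubles their number, each of the new instances performs its `m` evaluations in turn. -/
def pooInstance (D : ℝ) (t : ℕ) : ℕ :=
  let k := pooPhase D t
  let N := (pooState D k).1
  let m := (pooState D k).2
  let j := t - pooTotal D k
  if (pooState D (k + 1)).1 = N then j else N + j / m

/-- The parameter `ρ` of instance `i`. Instance `0` uses `ρ_max`; when the number of instances grows
from `N` to `2 N` (`N` a power of two), the new instances `N + j`, `j < N`, use
`ρ_max ^ (2 N / (2 j + 1))`. So the first `N` instances use the grid `ρ_max ^ (N / i)`,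
`1 ≤ i ≤ N`. -/
def pooRho (ρmax : ℝ) (i : ℕ) : ℝ :=
  if i = 0 then ρmax
  else ρmax ^ ((2 * 2 ^ Nat.log 2 i : ℝ) / (2 * ((i - 2 ^ Nat.log 2 i : ℕ) : ℝ) + 1))

/-- The labels of the evaluations performed by instance `i` among the first `t` ones. -/
def pooEvals (D : ℝ) (i t : ℕ) : Finset ℕ :=
  (Finset.range t).filter fun s => pooInstance D s = i

/-- The average reward of instance `i` in the last state reached after `T` evaluations. -/
def pooMean (D : ℝ) (T : ℕ) (rew : ℕ → ℝ) (i : ℕ) : ℝ :=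
  (∑ s ∈ pooEvals D i (pooTotal D (pooPhase D T)), rew s) / ((pooState D (pooPhase D T)).2 : ℝ)

/-! ### Stochastic evaluations and runs of POO -/

/-- Sequential noisy evaluations of `f`. Evaluation `t` is made at the random point `x t` and
returns `r t`; the σ-algebra `F t` holds everything that is known just before the answer `r t`,
including `x t`. Given `F t`, the reward has mean `f (x t)`, and the rewards at each point lie in
an interval of length one. -/
structure IsNoisyEvaluation {X Ω : Type*} [MeasurableSpace X] [mΩ : MeasurableSpace Ω]
    (f : X → ℝ) (μ : Measure Ω) (F : Filtration ℕ mΩ) (x : ℕ → Ω → X) (r : ℕ → Ω → ℝ) : Prop where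
  point_measurable : ∀ t, Measurable[F t] (x t)
  reward_measurable : ∀ t, Measurable[F (t + 1)] (r t)
  reward_integrable : ∀ t, Integrable (r t) μ
  reward_mean : ∀ t, μ[r t | F t] =ᵐ[μ] fun ω => f (x t ω)
  reward_bounded : ∃ b : X → ℝ, Measurable b ∧
    ∀ t, ∀ᵐ ω ∂μ, b (x t ω) ≤ r t ω ∧ r t ω ≤ b (x t ω) + 1

open Classical in
/-- The points `x` and rewards `r` are produced by POO with parameters `ν_max`, `ρ_max`. Evaluation
`t` is made for the node `v t`, selected by the HOO instance whose turn it is from its own previous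
evaluations, at a point of the cell of that node. After `T ≥ 1` evaluations, `best T` is an instance
with the largest average reward (in the last state with all instances on par), and the output of the
algorithm is the point `x (out T)`, where `out T` is, given the past, uniformly distributed on the
evaluations of that instance. -/
structure IsPOORun {X Ω : Type*} {K : ℕ} [MeasurableSpace X] [mΩ : MeasurableSpace Ω]
    (P : HierarchicalPartition X K) (νmax ρmax : ℝ) (μ : Measure Ω) (F : Filtration ℕ mΩ)
    (x : ℕ → Ω → X) (r : ℕ → Ω → ℝ) (v : ℕ → Ω → List (Fin K))
    (best out : ℕ → Ω → ℕ) : Prop where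
  node_measurable : ∀ t u, MeasurableSet[F t] {ω | v t ω = u}
  node_selected : ∀ t ω,
    P.HOOSelects νmax (pooRho ρmax (pooInstance (pooDmax K ρmax) t))
      (pooEvals (pooDmax K ρmax) (pooInstance (pooDmax K ρmax) t) t)
      (fun s => v s ω) (fun s => x s ω) (fun s => r s ω) (v t ω)
  point_mem : ∀ t ω, x t ω ∈ P.cell (v t ω)
  best_measurable : ∀ T i, MeasurableSet[F T] {ω | best T ω = i}
  best_lt : ∀ T ω, best T ω < (pooState (pooDmax K ρmax) (pooPhase (pooDmax K ρmax) T)).1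
  best_max : ∀ T ω, ∀ i < (pooState (pooDmax K ρmax) (pooPhase (pooDmax K ρmax) T)).1,
    pooMean (pooDmax K ρmax) T (fun s => r s ω) i
      ≤ pooMean (pooDmax K ρmax) T (fun s => r s ω) (best T ω)
  out_measurable : ∀ T, Measurable (out T)
  out_uniform : ∀ T, 1 ≤ T → ∀ s,
    μ[Set.indicator {ω | out T ω = s} (fun _ => (1 : ℝ)) | F T] =ᵐ[μ] fun ω =>
      if s ∈ pooEvals (pooDmax K ρmax) (best T ω)
          (pooTotal (pooDmax K ρmax) (pooPhase (pooDmax K ρmax) T))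
      then 1 / ((pooState (pooDmax K ρmax) (pooPhase (pooDmax K ρmax) T)).2 : ℝ) else 0

/-- The simple regret of the output point after `T` evaluations. -/
def simpleRegret {X Ω : Type*} (f : X → ℝ) (x : ℕ → Ω → X) (out : ℕ → Ω → ℕ) (T : ℕ) (ω : Ω) : ℝ :=
  (⨆ y, f y) - f (x (out T ω) ω)

end

/-! ### The schedule -/

/-! Since the output is uniform on the evaluations of the chosen instance, its expected simple
regret is the expected average regret of that instance (`IsPOORun.integral_simpleRegret_eq`).
Choosing by empirical mean costs at most `√(N/m)` compared with any fixed instance, by a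
second-moment bound on the noise (`IsPOORun.integral_simpleRegret_le`). It remains to find one
well-tuned instance and to bound its regret.

Regret of HOO. A selected path has all its values `U` at least as large as the smallest one on the
path towards `xs`, hence at least `f xs` as long as the means along the latter path do not deviate
downwards. A visited cell with `U ≥ f xs` has regret at most its confidence width plus its
smoothness term, so a cell that is not near-optimal receives few evaluations. Cutting the tree at
depth `H` gives a regret of order `m η + M ln T / η`, where `η` is about `νmax ρ' ^ H` and `M`
bounds the number of near-optimal cells at depths up to `H`
(`HierarchicalPartition.IsHOORun.sum_regret_le_of_good`,
`IsNoisyEvaluation.integral_sum_regret_le`). The deviation probabilities come from an exponential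
supermartingale (`IsNoisyEvaluation.integral_exp_noise_le`).

Choice of the instance. The schedule keeps `N` at least of order `D_max ln T`, so some grid
parameter `ρ' ≥ ρ` has `1 - ln(1/ρ') / ln(1/ρ) = O(1 / ln T)` (`exists_grid_index`). As `H = O(ln
T)`, comparing cells of depth `h` for `ρ'` with cells of smaller depth for `ρ` loses only a bounded
factor, while replacing `ν` by `νmax` loses a multiple of `V = (νmax / νs) ^ D_max`
(`HierarchicalPartition.numNearOpt_le`).

Rate. With `t = (ln² T / T) ^ (1/(d+2))` and `η = V D_max t`, both parts of the HOO regret, divided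
by `m`, are multiples of `η` (`rate_balance`), and so is `√(N/m)`. -/

/-- Equivalent to `Real.log a ≤ a / e`, the tangent-line bound for the logarithm at `e`. -/
theorem one_le_log_div_log {a : ℝ} (ha : 1 < a) : 1 ≤ Real.log (a / Real.log a) := by
  have hl : 0 < Real.log a := Real.log_pos ha
  rw [Real.le_log_iff_exp_le (by positivity), le_div_iff₀ hl]
  have h := Real.log_le_sub_one_of_pos (x := a / Real.exp 1) (by positivity)
  rw [Real.log_div (by positivity) (by positivity), Real.log_exp] at h
  have h2 : Real.log a ≤ a / Real.exp 1 := by linarith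
  rw [le_div_iff₀ (Real.exp_pos 1)] at h2
  linarith

/-- The denominator `Real.log b` only helps. When the number of evaluations at most doubles, the
logarithm in the doubling test thus grows by at most one. -/
theorem log_div_log_le {a b : ℝ} (ha : 1 < a) (hab : a ≤ b) :
    Real.log (b / Real.log b) ≤ Real.log (a / Real.log a) + Real.log (b / a) := by
  have hl : 0 < Real.log a := Real.log_pos ha
  have hb : Real.log a ≤ Real.log b := Real.log_le_log (by linarith) hab
  have ha0 : 0 < a := by linarith
  have hb0 : 0 < b := by linarith
  have hlb : 0 < Real.log b := by linarith
  rw [← Real.log_mul (by positivity) (by positivity)]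
  apply Real.log_le_log (by positivity)
  rw [div_mul_div_comm, mul_comm a b, mul_div_mul_right _ _ ha0.ne']
  gcongr

theorem log_le_two_mul_log_div_log {a : ℝ} (ha : 1 < a) :
    Real.log a ≤ 2 * Real.log (a / Real.log a) := by
  have hl : 0 < Real.log a := Real.log_pos ha
  have h1 := one_le_log_div_log ha
  have h2 : Real.log (Real.log a) ≤ Real.log a / 2 := by
    have h := Real.log_le_sub_one_of_pos (x := Real.log a / 2) (by positivity)
    rw [Real.log_div (by positivity) (by positivity)] at h
    have h3 : Real.log 2 ≤ 1 := by
      have := Real.log_le_sub_one_of_pos (x := 2) (by positivity); linarith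
    linarith
  rw [Real.log_div (by positivity) (by positivity)]
  linarith

theorem pooState_succ_cases (D : ℝ) (k : ℕ) :
    (2 ≤ pooTotal D k ∧ ((pooState D k).1 : ℝ)
        < D / 2 * Real.log ((pooTotal D k : ℝ) / Real.log (pooTotal D k : ℝ)) ∧
      pooState D (k + 1) = (2 * (pooState D k).1, (pooState D k).2)) ∨
    (¬ (2 ≤ pooTotal D k ∧ ((pooState D k).1 : ℝ)
        < D / 2 * Real.log ((pooTotal D k : ℝ) / Real.log (pooTotal D k : ℝ))) ∧
      pooState D (k + 1) = ((pooState D k).1, (pooState D k).2 + 1)) := by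
  simp only [pooState, pooTotal]
  split_ifs with h
  · left; exact ⟨h.1, h.2, rfl⟩
  · right; exact ⟨h, rfl⟩

theorem pooState_fst_eq_two_pow (D : ℝ) (k : ℕ) : ∃ p, (pooState D k).1 = 2 ^ p := by
  induction k with
  | zero => exact ⟨0, rfl⟩
  | succ k ih =>
    obtain ⟨p, hp⟩ := ih
    rcases pooState_succ_cases D k with ⟨-, -, h⟩ | ⟨-, h⟩
    · exact ⟨p + 1, by rw [h, hp, pow_succ]; ring⟩
    · exact ⟨p, by rw [h, hp]⟩

theorem pooState_fst_pos (D : ℝ) (k : ℕ) : 0 < (pooState D k).1 := by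
  obtain ⟨p, hp⟩ := pooState_fst_eq_two_pow D k
  rw [hp]; positivity

theorem pooState_snd_pos (D : ℝ) {k : ℕ} (hk : 1 ≤ k) : 0 < (pooState D k).2 := by
  induction k with
  | zero => omega
  | succ k ih =>
    rcases pooState_succ_cases D k with ⟨h2, -, h⟩ | ⟨-, h⟩
    · rw [h]
      rcases Nat.eq_zero_or_pos (pooState D k).2 with h0 | h0
      · simp [pooTotal, h0] at h2
      · exact h0
    · rw [h]; simp

theorem pooState_fst_mono (D : ℝ) : Monotone fun k => (pooState D k).1 := by
  refine monotone_nat_of_le_succ fun k => ?_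
  rcases pooState_succ_cases D k with ⟨-, -, h⟩ | ⟨-, h⟩ <;> rw [h]
  · simp; omega

theorem pooTotal_zero (D : ℝ) : pooTotal D 0 = 0 := by simp [pooTotal, pooState]

theorem pooTotal_strictMono (D : ℝ) : StrictMono (pooTotal D) := by
  refine strictMono_nat_of_lt_succ fun k => ?_
  rcases pooState_succ_cases D k with ⟨h2, -, h⟩ | ⟨-, h⟩
  · have : pooTotal D (k + 1) = 2 * pooTotal D k := by simp [pooTotal, h, mul_assoc]
    omega
  · have : pooTotal D (k + 1) = pooTotal D k + (pooState D k).1 := by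
      simp [pooTotal, h, mul_add]
    have := pooState_fst_pos D k
    omega

theorem pooTotal_phase_le (D : ℝ) (t : ℕ) : pooTotal D (pooPhase D t) ≤ t := by
  have := Nat.findGreatest_spec (P := fun k => pooTotal D k ≤ t) (m := 0) (n := t) (Nat.zero_le _)
    (by simp [pooTotal_zero])
  exact this

theorem le_pooPhase {D : ℝ} {k t : ℕ} (h : pooTotal D k ≤ t) : k ≤ pooPhase D t :=
  Nat.le_findGreatest (((pooTotal_strictMono D).id_le k).trans h) h

theorem lt_pooTotal_phase_succ (D : ℝ) (t : ℕ) : t < pooTotal D (pooPhase D t + 1) := by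
  by_contra h
  have := le_pooPhase (not_lt.mp h)
  omega

theorem pooPhase_eq {D : ℝ} {k t : ℕ} (h : pooTotal D k ≤ t) (h' : t < pooTotal D (k + 1)) :
    pooPhase D t = k := by
  apply le_antisymm _ (le_pooPhase h)
  by_contra hk
  have := (pooTotal_strictMono D).monotone (show k + 1 ≤ pooPhase D t by omega)
  have := pooTotal_phase_le D t
  omega

theorem pooPhase_mono (D : ℝ) : Monotone (pooPhase D) := fun _ _ h =>
  le_pooPhase ((pooTotal_phase_le D _).trans h)

theorem pooInstance_lt_succ (D : ℝ) (t : ℕ) :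
    pooInstance D t < (pooState D (pooPhase D t + 1)).1 := by
  have h1 := pooTotal_phase_le D t
  have h2 := lt_pooTotal_phase_succ D t
  have hN := pooState_fst_pos D (pooPhase D t)
  simp only [pooInstance]
  rcases pooState_succ_cases D (pooPhase D t) with ⟨-, -, h⟩ | ⟨-, h⟩
  · rw [if_neg (by rw [h]; simp; omega), h]
    simp only [pooTotal, h] at h1 h2 ⊢
    have hm : 0 < (pooState D (pooPhase D t)).2 := by
      rcases Nat.eq_zero_or_pos (pooState D (pooPhase D t)).2 with h0 | h0
      · simp [h0] at h2
      · exact h0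
    rw [two_mul, add_mul] at h2
    have := (Nat.div_lt_iff_lt_mul hm).2
      (show t - (pooState D (pooPhase D t)).1 * (pooState D (pooPhase D t)).2
        < (pooState D (pooPhase D t)).1 * (pooState D (pooPhase D t)).2 by omega)
    omega
  · rw [if_pos (by rw [h]), h]
    simp only [pooTotal, h] at h1 h2 ⊢
    rw [mul_add] at h2
    omega

theorem pooInstance_lt {D : ℝ} {k t : ℕ} (h : t < pooTotal D k) :
    pooInstance D t < (pooState D k).1 := by
  refine (pooInstance_lt_succ D t).trans_le (pooState_fst_mono D ?_)
  by_contra hk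
  have h1 := (pooTotal_strictMono D).monotone (show k ≤ pooPhase D t by omega)
  have h2 := pooTotal_phase_le D t
  omega

theorem card_filter_div_eq (N m j : ℕ) (hm : 0 < m) (hj : j < N) :
    ((Finset.range (N * m)).filter fun s => s / m = j).card = m := by
  have : (Finset.range (N * m)).filter (fun s => s / m = j) = Finset.Ico (j * m) ((j + 1) * m) := by
    ext s
    simp only [Finset.mem_filter, Finset.mem_range, Finset.mem_Ico, Nat.div_eq_iff hm]
    have : (j + 1) * m ≤ N * m := Nat.mul_le_mul_right m hj
    rw [add_mul] at *
    omega
  rw [this, Nat.card_Ico, add_mul]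
  omega

theorem pooEvals_add (D : ℝ) (i a b : ℕ) :
    (pooEvals D i (a + b)).card = (pooEvals D i a).card
      + ((Finset.range b).filter fun s => pooInstance D (a + s) = i).card := by
  induction b with
  | zero => simp
  | succ b ih =>
    rw [← add_assoc]
    simp only [pooEvals] at ih ⊢
    rw [Finset.range_add_one, Finset.range_add_one, Finset.filter_insert, Finset.filter_insert]
    split_ifs with h
    · rw [Finset.card_insert_of_notMem (by simp), Finset.card_insert_of_notMem (by simp), ih]
      ring
    · exact ih

/-- By induction on the phase: a doubling phase leaves the old instances alone and gives each new
one a block of exactly `m` labels; any other phase gives one label to each instance. -/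
theorem card_pooEvals (D : ℝ) (k : ℕ) {i : ℕ} (hi : i < (pooState D k).1) :
    (pooEvals D i (pooTotal D k)).card = (pooState D k).2 := by
  induction k with
  | zero => simp [pooTotal_zero, pooEvals, pooState]
  | succ k ih =>
    have hN := pooState_fst_pos D k
    rcases pooState_succ_cases D k with ⟨h2, -, h⟩ | ⟨-, h⟩
    · have hT : pooTotal D (k + 1) = pooTotal D k + pooTotal D k := by
        simp [pooTotal, h, mul_assoc]; ring
      have hm : 0 < (pooState D k).2 := by
        rcases Nat.eq_zero_or_pos (pooState D k).2 with h0 | h0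
        · simp [pooTotal, h0] at h2
        · exact h0
      have key : ∀ s ∈ Finset.range (pooTotal D k), pooInstance D (pooTotal D k + s)
          = (pooState D k).1 + s / (pooState D k).2 := by
        intro s hs
        rw [Finset.mem_range] at hs
        have hp : pooPhase D (pooTotal D k + s) = k := pooPhase_eq (by omega) (by omega)
        simp only [pooInstance, hp]
        rw [if_neg (by rw [h]; simp; omega), Nat.add_sub_cancel_left]
      rw [hT, pooEvals_add, Finset.filter_congr (fun s hs => by rw [key s hs]), h]
      simp only [h] at hi ⊢
      by_cases hiN : i < (pooState D k).1
      · rw [ih hiN, Finset.filter_false_of_mem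
          (fun s _ => by generalize s / (pooState D k).2 = q; omega)]
        simp
      · have h0 : pooEvals D i (pooTotal D k) = ∅ := by
          simp only [pooEvals]
          refine Finset.filter_false_of_mem fun s hs => ?_
          have := pooInstance_lt (Finset.mem_range.1 hs)
          omega
        rw [h0, Finset.card_empty, zero_add]
        refine Eq.trans ?_ (card_filter_div_eq (pooState D k).1 (pooState D k).2
          (i - (pooState D k).1) hm (by omega))
        congr 1
        apply Finset.filter_congr
        intro s _
        generalize s / (pooState D k).2 = q
        omega
    · have hT : pooTotal D (k + 1) = pooTotal D k + (pooState D k).1 := by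
        simp [pooTotal, h, mul_add]
      have key : ∀ s ∈ Finset.range (pooState D k).1, pooInstance D (pooTotal D k + s) = s := by
        intro s hs
        rw [Finset.mem_range] at hs
        have hp : pooPhase D (pooTotal D k + s) = k := pooPhase_eq (by omega) (by omega)
        simp only [pooInstance, hp]
        rw [if_pos (by rw [h]), Nat.add_sub_cancel_left]
      simp only [h] at hi ⊢
      rw [hT, pooEvals_add, Finset.filter_congr (fun s hs => by rw [key s hs]), ih hi,
        Finset.filter_eq' , if_pos (by simpa using hi), Finset.card_singleton]

theorem filter_lt_pooEvals {D : ℝ} {i s t : ℕ} (h : s ≤ t) :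
    (pooEvals D i t).filter (· < s) = pooEvals D i s := by
  ext a
  simp only [pooEvals, Finset.mem_filter, Finset.mem_range]
  constructor
  · rintro ⟨⟨-, h1⟩, h2⟩; exact ⟨h2, h1⟩
  · rintro ⟨h1, h2⟩; exact ⟨⟨by omega, h2⟩, h1⟩

/-- A doubling happens only if `2 N < D ln (n / ln n)`, and `n / ln n ≤ T`. The hypothesis is about
state `k` and the conclusion about state `k + 1`, because new instances start right after state `k`,
before state `k + 1` is reached. -/
theorem pooState_fst_succ_le {D : ℝ} {k T : ℕ} (h : pooTotal D k < T) :
    ((pooState D (k + 1)).1 : ℝ) ≤ max 1 (D * Real.log T) := by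
  induction k with
  | zero =>
    rcases pooState_succ_cases D 0 with ⟨h2, -, -⟩ | ⟨-, h2⟩
    · simp [pooTotal_zero] at h2
    · rw [h2]; simp [pooState]
  | succ k ih =>
    have ih' := ih ((pooTotal_strictMono D (Nat.lt_succ_self k)).trans h)
    rcases pooState_succ_cases D (k + 1) with ⟨h2, h3, h4⟩ | ⟨-, h2⟩
    · apply le_max_of_le_right
      rw [h4]
      push_cast
      set n := pooTotal D (k + 1)
      have hn : (1 : ℝ) < n := by exact_mod_cast h2
      have hg := one_le_log_div_log hn
      have hN : (0 : ℝ) < (pooState D (k + 1)).1 := by exact_mod_cast pooState_fst_pos D (k + 1)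
      have hD : 0 < D := by
        by_contra hD
        have : D / 2 * Real.log (n / Real.log n) ≤ 0 :=
          mul_nonpos_of_nonpos_of_nonneg (by linarith) (by linarith)
        linarith
      have hl := Real.log_pos hn
      have : Real.log (n / Real.log n) ≤ Real.log T := by
        apply Real.log_le_log (by positivity)
        rw [div_le_iff₀ hl]
        -- For `n = 2` one has `ln n < 1`, so `n / ln n` exceeds `n`; it is still below `3`, and the
        -- strict inequality `h` gives `3 ≤ T`.
        rcases h2.eq_or_lt with h5 | h5
        · rw [← h5] at h hl ⊢
          have hT : (3 : ℝ) ≤ T := by exact_mod_cast h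
          have := Real.log_two_gt_d9
          push_cast
          nlinarith
        · have h6 : (n : ℝ) ≤ T := by exact_mod_cast h.le
          have h7 : 1 ≤ Real.log n := by
            rw [Real.le_log_iff_exp_le (by linarith)]
            have h8 := Real.exp_one_lt_d9
            have : (3 : ℝ) ≤ n := by exact_mod_cast h5
            linarith
          nlinarith
      nlinarith
    · rw [h2]; exact ih'

theorem pooState_fst_le {D : ℝ} {k T : ℕ} (h : pooTotal D k ≤ T) :
    ((pooState D k).1 : ℝ) ≤ max 1 (D * Real.log T) := by
  cases k with
  | zero => simp [pooState]
  | succ k => exact pooState_fst_succ_le ((pooTotal_strictMono D (Nat.lt_succ_self k)).trans_le h)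

theorem card_image_pooInstance_le (D : ℝ) {T : ℕ} (hT : 1 ≤ T) :
    (((Finset.range T).image (pooInstance D)).card : ℝ) ≤ max 1 (D * Real.log T) := by
  have h1 : (Finset.range T).image (pooInstance D)
      ⊆ Finset.range (pooState D (pooPhase D (T - 1) + 1)).1 := by
    intro i hi
    obtain ⟨t, ht, rfl⟩ := Finset.mem_image.1 hi
    rw [Finset.mem_range] at ht ⊢
    refine (pooInstance_lt_succ D t).trans_le (pooState_fst_mono D ?_)
    exact Nat.succ_le_succ (pooPhase_mono D (by omega))
  have h2 := Finset.card_le_card h1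
  rw [Finset.card_range] at h2
  have h3 : pooTotal D (pooPhase D (T - 1)) < T := by
    have := pooTotal_phase_le D (T - 1)
    omega
  exact le_trans (by exact_mod_cast h2) (pooState_fst_succ_le h3)

theorem pooTotal_succ_le_two_mul (D : ℝ) {k : ℕ} (hk : 1 ≤ k) :
    pooTotal D (k + 1) ≤ 2 * pooTotal D k := by
  have hm := pooState_snd_pos D hk
  rcases pooState_succ_cases D k with ⟨-, -, h⟩ | ⟨-, h⟩
  · simp [pooTotal, h, mul_assoc]
  · simp only [pooTotal, h]; nlinarith

/-- When the doubling test fails, `N` is at least `D / 2` times the logarithm, which is at least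
one; the next step adds at most one to it, so at most doubles it, whence `D / 4`. In a doubling step
`N` doubles, which compensates the same growth. The condition `3 ≤ m` ensures that a failed test at
the preceding state failed because of the size of `N` and not because of `n < 2`. -/
theorem le_pooState_fst {D : ℝ} (hD : 0 ≤ D) {k : ℕ} (hm : 3 ≤ (pooState D k).2) :
    D / 4 * Real.log ((pooTotal D k : ℝ) / Real.log (pooTotal D k : ℝ)) ≤ (pooState D k).1 := by
  induction k with
  | zero => simp [pooState] at hm
  | succ k ih =>
    have hN := pooState_fst_pos D k
    rcases pooState_succ_cases D k with ⟨h2, -, h⟩ | ⟨h2, h⟩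
    · have hT : pooTotal D (k + 1) = 2 * pooTotal D k := by simp [pooTotal, h, mul_assoc]
      rw [h] at hm
      have ih' := ih hm
      rw [hT, h]
      push_cast
      have hn : (1 : ℝ) < pooTotal D k := by exact_mod_cast h2
      have h3 := log_div_log_le hn (show (pooTotal D k : ℝ) ≤ 2 * pooTotal D k by linarith)
      rw [show (2 * (pooTotal D k : ℝ)) / pooTotal D k = 2 by field_simp] at h3
      have h4 : Real.log 2 ≤ 1 := by
        have := Real.log_le_sub_one_of_pos (x := 2) (by positivity); linarith
      have h5 := one_le_log_div_log hn
      calc _ ≤ D / 4 * (2 * Real.log (pooTotal D k / Real.log (pooTotal D k))) := by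
            gcongr; linarith
        _ ≤ _ := by linarith
    · rw [h] at hm
      simp only at hm
      have hn2 : 2 ≤ pooTotal D k := by simp only [pooTotal]; nlinarith
      have h6 := not_lt.1 (fun h' => h2 ⟨hn2, h'⟩)
      have hn : (1 : ℝ) < pooTotal D k := by exact_mod_cast hn2
      have hT : pooTotal D (k + 1) ≤ 2 * pooTotal D k := by
        simp only [pooTotal, h]; nlinarith
      have hT' : pooTotal D k ≤ pooTotal D (k + 1) := (pooTotal_strictMono D).monotone (by omega)
      have h3 := log_div_log_le hn (show (pooTotal D k : ℝ) ≤ pooTotal D (k + 1) by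
        exact_mod_cast hT')
      have h4 : Real.log ((pooTotal D (k + 1) : ℝ) / pooTotal D k) ≤ 1 := by
        have h7 : (pooTotal D (k + 1) : ℝ) / pooTotal D k ≤ 2 := by
          rw [div_le_iff₀ (by linarith)]; exact_mod_cast hT
        have h8 : (1 : ℝ) ≤ pooTotal D (k + 1) / pooTotal D k := by
          rw [le_div_iff₀ (by linarith), one_mul]; exact_mod_cast hT'
        have := Real.log_le_sub_one_of_pos (x := (pooTotal D (k + 1) : ℝ) / pooTotal D k)
          (by linarith)
        linarith
      have h5 := one_le_log_div_log hn
      rw [h]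
      simp only
      calc _ ≤ D / 4 * (2 * Real.log (pooTotal D k / Real.log (pooTotal D k))) := by
            gcongr; linarith
        _ ≤ _ := by linarith

/-! ### The grid of parameters -/

/-- The grids are nested: an even index `2 c` at level `p + 1` is the index `c` at level `p`, and an
odd index `2 c + 1` is that of the new instance `2 ^ p + c`. -/
theorem exists_pooRho_eq (ρmax : ℝ) (p j : ℕ) (hj : 1 ≤ j) (hj' : j ≤ 2 ^ p) :
    ∃ i < 2 ^ p, pooRho ρmax i = ρmax ^ ((2 ^ p : ℝ) / (j : ℝ)) := by
  induction p generalizing j with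
  | zero =>
    obtain rfl : j = 1 := by simp at hj'; omega
    exact ⟨0, by simp, by simp [pooRho]⟩
  | succ p ih =>
    rcases Nat.even_or_odd' j with ⟨c, rfl | rfl⟩
    · obtain ⟨i, hi, h⟩ := ih c (by omega) (by rw [pow_succ] at hj'; omega)
      refine ⟨i, by rw [pow_succ]; omega, ?_⟩
      rw [h, pow_succ]
      push_cast
      rw [mul_comm (2 : ℝ) (c : ℝ), mul_div_mul_right _ _ two_ne_zero]
    · have hc : c < 2 ^ p := by rw [pow_succ] at hj'; omega
      have hlog : Nat.log 2 (2 ^ p + c) = p := by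
        rw [Nat.log_eq_iff (by right; constructor <;> [norm_num; positivity])]
        rw [pow_succ]; omega
      refine ⟨2 ^ p + c, by rw [pow_succ]; omega, ?_⟩
      rw [pooRho, if_neg (by positivity), hlog, Nat.add_sub_cancel_left]
      push_cast
      rw [pow_succ]
      ring_nf

namespace HierarchicalPartition

/-! ### Cells and near-optimal cells -/

section Tree

variable {X : Type*} {K : ℕ} (P : HierarchicalPartition X K)

theorem cell_cons_subset (i : Fin K) (u : List (Fin K)) : P.cell (i :: u) ⊆ P.cell u := by
  rw [← P.cell_split u]
  exact Set.subset_iUnion (fun i => P.cell (i :: u)) i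

theorem cell_subset_of_suffix {a u : List (Fin K)} (h : a <:+ u) : P.cell u ⊆ P.cell a := by
  obtain ⟨l, rfl⟩ := h
  induction l with
  | nil => exact subset_rfl
  | cons i l ih => exact (P.cell_cons_subset i (l ++ a)).trans ih

theorem eq_of_mem_cell {u w : List (Fin K)} (h : u.length = w.length) {x : X}
    (hu : x ∈ P.cell u) (hw : x ∈ P.cell w) : u = w := by
  induction u generalizing w with
  | nil => exact (List.length_eq_zero_iff.1 h.symm).symm
  | cons i u ih =>
    cases w with
    | nil => simp at h
    | cons j w =>
      obtain rfl := ih (by simpa using h) (P.cell_cons_subset _ _ hu) (P.cell_cons_subset _ _ hw)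
      by_contra hne
      exact Set.disjoint_left.1 (P.cell_disjoint u i j fun hij => hne (by rw [hij])) hu hw

theorem exists_mem_cell (x : X) (h : ℕ) : ∃ u : List (Fin K), u.length = h ∧ x ∈ P.cell u := by
  induction h with
  | zero => exact ⟨[], rfl, by rw [P.cell_root]; trivial⟩
  | succ h ih =>
    obtain ⟨u, hu, hx⟩ := ih
    rw [← P.cell_split u] at hx
    obtain ⟨i, hi⟩ := Set.mem_iUnion.1 hx
    exact ⟨i :: u, by simp [hu], hi⟩

variable {f : X → ℝ} {xs : X} {ν ρ : ℝ}

theorem LocallySmooth.sub_le {P : HierarchicalPartition X K} (h : P.LocallySmooth f xs ν ρ)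
    (x : X) : f xs - ν ≤ f x := by
  have := h.2.2.2 [] (by rw [P.cell_root]; trivial) x (by rw [P.cell_root]; trivial)
  simpa using this

theorem finite_nearOpt (f : X → ℝ) (xs : X) (h : ℕ) (ε : ℝ) :
    {u : List (Fin K) | u.length = h ∧ (P.cell u).Nonempty ∧
      f xs - ε ≤ sSup (f '' P.cell u)}.Finite :=
  (List.finite_length_eq (Fin K) h).subset fun _ hu => hu.1

/-- The addresses of depth `h` of the cells counted by `numNearOpt`. -/
noncomputable def nearOptFinset (f : X → ℝ) (xs : X) (h : ℕ) (ε : ℝ) : Finset (List (Fin K)) :=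
  (P.finite_nearOpt f xs h ε).toFinset

theorem mem_nearOptFinset {h : ℕ} {ε : ℝ} {u : List (Fin K)} :
    u ∈ P.nearOptFinset f xs h ε ↔
      u.length = h ∧ (P.cell u).Nonempty ∧ f xs - ε ≤ sSup (f '' P.cell u) := by
  simp [nearOptFinset]

theorem card_nearOptFinset (f : X → ℝ) (xs : X) (h : ℕ) (ε : ℝ) :
    (P.nearOptFinset f xs h ε).card = P.numNearOpt f xs h ε := by
  rw [nearOptFinset, numNearOpt, Set.ncard_eq_toFinset_card _ (P.finite_nearOpt f xs h ε)]

theorem numNearOpt_zero_le (f : X → ℝ) (xs : X) (ε : ℝ) : P.numNearOpt f xs 0 ε ≤ 1 := by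
  rw [numNearOpt, Set.ncard_le_one_iff (P.finite_nearOpt f xs 0 ε)]
  rintro u w ⟨hu, -⟩ ⟨hw, -⟩
  rw [List.length_eq_zero_iff.1 hu, List.length_eq_zero_iff.1 hw]

theorem bddAbove_image (hxs : ∀ x, f x ≤ f xs) (s : Set X) : BddAbove (f '' s) :=
  ⟨f xs, by rintro _ ⟨x, -, rfl⟩; exact hxs x⟩

/-- The ancestor at depth `h` of a near-optimal cell has a larger supremum, and it has at most `K ^
l` descendants `l` levels below. -/
theorem numNearOpt_add_le (hxs : ∀ x, f x ≤ f xs) (h l : ℕ) {ε ε' : ℝ} (hε : ε ≤ ε') :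
    P.numNearOpt f xs (l + h) ε ≤ K ^ l * P.numNearOpt f xs h ε' := by
  classical
  rw [← card_nearOptFinset, ← card_nearOptFinset]
  have hsub : P.nearOptFinset f xs (l + h) ε ⊆
      ((Finset.univ : Finset (List.Vector (Fin K) l)) ×ˢ P.nearOptFinset f xs h ε').image
        (fun p => p.1.1 ++ p.2) := by
    intro u hu
    obtain ⟨hl, hne, hs⟩ := P.mem_nearOptFinset.1 hu
    refine Finset.mem_image.2 ⟨(⟨u.take l, by simp [hl]⟩, u.drop l), ?_, List.take_append_drop l u⟩
    have hsuf := P.cell_subset_of_suffix (List.drop_suffix l u)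
    refine Finset.mem_product.2 ⟨Finset.mem_univ _, P.mem_nearOptFinset.2
      ⟨by simp [hl], hne.mono hsuf, ?_⟩⟩
    have := csSup_le_csSup (bddAbove_image hxs _) (hne.image f) (Set.image_mono hsuf)
    linarith
  refine (Finset.card_le_card hsub).trans (Finset.card_image_le.trans ?_)
  rw [Finset.card_product, Finset.card_univ, card_vector, Fintype.card_fin]

theorem nearOptExponents_nonneg_mono {d d' : ℝ} (hρ : 0 < ρ) (hρ1 : ρ < 1)
    (h : d ∈ P.nearOptExponents f xs ν ρ) (hd : d ≤ d') :
    d' ∈ P.nearOptExponents f xs ν ρ := by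
  obtain ⟨h0, C, hC, hN⟩ := h
  refine ⟨h0.trans hd, C, hC, fun n => (hN n).trans ?_⟩
  gcongr C * ?_
  apply Real.rpow_le_rpow_of_exponent_ge hρ hρ1.le
  have : (0 : ℝ) ≤ n := Nat.cast_nonneg n
  nlinarith

/-- This is the count of all `K ^ h` addresses. It shows that the set of exponents is nonempty, so
that its infimum is approached by members. -/
theorem log_div_log_mem_nearOptExponents (hxs : ∀ x, f x ≤ f xs) (hK : 1 ≤ K) (hρ : 0 < ρ)
    (hρ1 : ρ < 1) : Real.log K / Real.log (1 / ρ) ∈ P.nearOptExponents f xs ν ρ := by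
  have hl : 0 < Real.log (1 / ρ) := Real.log_pos (by rw [lt_div_iff₀ hρ]; linarith)
  have hK' : (1 : ℝ) ≤ K := by exact_mod_cast hK
  refine ⟨div_nonneg (Real.log_nonneg hK') hl.le, 1, one_pos, fun h => ?_⟩
  have h1 := P.numNearOpt_add_le hxs 0 h (le_refl (2 * ν * ρ ^ h))
  have h2 := P.numNearOpt_zero_le f xs (2 * ν * ρ ^ h)
  have h3 : P.numNearOpt f xs h (2 * ν * ρ ^ h) ≤ K ^ h := by
    simp only [add_zero] at h1
    nlinarith [Nat.zero_le (K ^ h)]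
  calc (P.numNearOpt f xs h (2 * ν * ρ ^ h) : ℝ) ≤ (K : ℝ) ^ h := by exact_mod_cast h3
    _ = 1 * ρ ^ (-(Real.log K / Real.log (1 / ρ)) * (h : ℝ)) := by
      rw [one_mul, Real.rpow_def_of_pos hρ, ← Real.rpow_natCast, Real.rpow_def_of_pos (by linarith)]
      congr 1
      rw [one_div, Real.log_inv] at hl ⊢
      have : Real.log ρ ≠ 0 := by intro h; simp [h] at hl
      field_simp

/-- Near-optimality at depth `h` for `(νm, ρ')` has the scale of a smaller depth for `(ν, ρ)`. Cells
are counted at that smaller depth with the hypothesis `hN`, and each remaining level costs a factor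
`K`; the exponential is the price of these levels. -/
theorem numNearOpt_le (hxs : ∀ x, f x ≤ f xs) (hK : 1 ≤ K) {d C νm ρ' : ℝ} (hν : 0 < ν)
    (hνm : ν ≤ νm) (hρ : 0 < ρ) (hρ' : ρ ≤ ρ') (hρ1 : ρ' < 1) (hd : 0 ≤ d) (hC : 0 < C)
    (hN : ∀ h : ℕ, (P.numNearOpt f xs h (2 * ν * ρ ^ h) : ℝ) ≤ C * ρ ^ (-d * (h : ℝ))) (h : ℕ) :
    (P.numNearOpt f xs h (2 * νm * ρ' ^ h) : ℝ) ≤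
      (C + 1) * Real.exp (Real.log K * (1 + h * (1 - Real.log (1 / ρ') / Real.log (1 / ρ))
          + Real.log (νm / ν) / Real.log (1 / ρ)))
        * max 1 ((ν / (νm * ρ' ^ h)) ^ d) := by
  have hρ'0 : 0 < ρ' := hρ.trans_le hρ'
  have hνm0 : 0 < νm := hν.trans_le hνm
  set q := Real.log (1 / ρ) with hq
  set q' := Real.log (1 / ρ') with hq'
  have hq'0 : 0 < q' := Real.log_pos (by rw [lt_div_iff₀ hρ'0]; linarith)
  have hqq : q' ≤ q := Real.log_le_log (by positivity) (by gcongr)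
  have hq0 : 0 < q := hq'0.trans_le hqq
  have hrat : 0 ≤ Real.log (νm / ν) := Real.log_nonneg (by rw [le_div_iff₀ hν]; linarith)
  have hK' : (1 : ℝ) ≤ K := by exact_mod_cast hK
  -- The real depth at which `ν * ρ ^ y = νm * ρ' ^ h`.
  set y : ℝ := (h * q' - Real.log (νm / ν)) / q with hy
  have hyh : y ≤ h := by
    rw [hy, div_le_iff₀ hq0]
    have : (h : ℝ) * q' ≤ h * q := by gcongr
    linarith
  have hfl : ⌊y⌋₊ ≤ h := by simpa using Nat.floor_le_floor hyh
  obtain ⟨l, hl⟩ := Nat.exists_eq_add_of_le' hfl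
  have hpow : (K : ℝ) ^ l ≤ Real.exp (Real.log K * (1 + h * (1 - q' / q)
      + Real.log (νm / ν) / q)) := by
    rw [← Real.rpow_natCast, Real.rpow_def_of_pos (by linarith)]
    apply Real.exp_le_exp.2
    have hlK := Real.log_nonneg hK'
    gcongr
    have h1 := Nat.lt_floor_add_one y
    have h2 : (h : ℝ) = l + ⌊y⌋₊ := by exact_mod_cast hl
    have h3 : 1 + h * (1 - q' / q) + Real.log (νm / ν) / q = 1 + h - y := by
      rw [hy]; field_simp; ring
    rw [h3]
    linarith
  have hexp_log : νm * ρ' ^ h = ν * Real.exp (-(y * q)) := by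
    rw [hy, div_mul_cancel₀ _ hq0.ne', neg_sub, Real.exp_sub, Real.exp_log (by positivity), hq',
      ← Real.log_pow, Real.exp_log (by positivity)]
    field_simp
    rw [← mul_pow, mul_one_div_cancel hρ'0.ne', one_pow]
  -- For `y < 0` the tolerance exceeds `2 * ν`, so no depth for `(ν, ρ)` matches; then `l = h` and
  -- the trivial count `K ^ h` suffices.
  rcases lt_or_ge y 0 with hy0 | hy0
  · have hf0 : ⌊y⌋₊ = 0 := Nat.floor_of_nonpos hy0.le
    have h1 := P.numNearOpt_add_le hxs 0 h (le_refl (2 * νm * ρ' ^ h))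
    have h2 := P.numNearOpt_zero_le f xs (2 * νm * ρ' ^ h)
    have h3 : P.numNearOpt f xs h (2 * νm * ρ' ^ h) ≤ K ^ h := by
      simp only [add_zero] at h1
      nlinarith [Nat.zero_le (K ^ h)]
    have h4 : h = l := by omega
    rw [← h4] at hpow
    calc (P.numNearOpt f xs h (2 * νm * ρ' ^ h) : ℝ) ≤ (K : ℝ) ^ h := by exact_mod_cast h3
      _ ≤ Real.exp (Real.log K * (1 + h * (1 - q' / q) + Real.log (νm / ν) / q)) := hpow
      _ ≤ _ := by
        rw [mul_assoc, mul_comm (Real.exp _), ← mul_assoc]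
        apply le_mul_of_one_le_left (Real.exp_pos _).le
        exact one_le_mul_of_one_le_of_one_le (by linarith) (le_max_left _ _)
  · have hfly := Nat.floor_le hy0
    have hρq : ∀ z : ℝ, ρ ^ z = Real.exp (-(z * q)) := by
      intro z
      rw [Real.rpow_def_of_pos hρ, hq, one_div, Real.log_inv]; ring_nf
    have hε : 2 * νm * ρ' ^ h ≤ 2 * ν * ρ ^ ⌊y⌋₊ := by
      rw [mul_assoc, hexp_log, ← mul_assoc, ← Real.rpow_natCast, hρq]
      gcongr
    have h1 := P.numNearOpt_add_le hxs ⌊y⌋₊ l hε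
    rw [← hl] at h1
    have h5 : ρ ^ (-d * (⌊y⌋₊ : ℝ)) ≤ (ν / (νm * ρ' ^ h)) ^ d := by
      rw [hexp_log, div_mul_cancel_left₀ hν.ne', ← Real.exp_neg, neg_neg, ← Real.exp_mul, hρq]
      apply Real.exp_le_exp.2
      have : (⌊y⌋₊ : ℝ) * (q * d) ≤ y * (q * d) := by gcongr
      linarith
    calc (P.numNearOpt f xs h (2 * νm * ρ' ^ h) : ℝ)
        ≤ (K : ℝ) ^ l * P.numNearOpt f xs ⌊y⌋₊ (2 * ν * ρ ^ ⌊y⌋₊) := by exact_mod_cast h1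
      _ ≤ Real.exp (Real.log K * (1 + h * (1 - q' / q) + Real.log (νm / ν) / q))
          * (C * ρ ^ (-d * (⌊y⌋₊ : ℝ))) := by
        gcongr
        exact hN _
      _ ≤ Real.exp (Real.log K * (1 + h * (1 - q' / q) + Real.log (νm / ν) / q))
          * ((C + 1) * max 1 ((ν / (νm * ρ' ^ h)) ^ d)) := by
        gcongr
        · linarith
        · exact h5.trans (le_max_right _ _)
      _ = _ := by ring

end Tree

end HierarchicalPartition

/-! ### Concentration of the noise -/

/-- Hoeffding's lemma for the centred law on `{c, c + 1}`, with masses `c + 1` and `-c`. As a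
pointwise inequality in `c`, it can be used when `c` is random but known before the reward. -/
theorem two_point_mgf_le {c : ℝ} (hc : -1 ≤ c) (hc0 : c ≤ 0) (l : ℝ) :
    (c + 1) * Real.exp (l * c) - c * Real.exp (l * (c + 1)) ≤ Real.exp (l ^ 2 / 8) := by
  set μ : Measure ℝ := ENNReal.ofReal (c + 1) • Measure.dirac c
    + ENNReal.ofReal (-c) • Measure.dirac (c + 1) with hμ
  have hprob : IsProbabilityMeasure μ := ⟨by
    simp only [hμ, Measure.add_apply, Measure.smul_apply, measure_univ, smul_eq_mul, mul_one]
    rw [← ENNReal.ofReal_add (by linarith) (by linarith)]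
    simp⟩
  have hint : ∀ g : ℝ → ℝ, Integrable g (ENNReal.ofReal (c + 1) • Measure.dirac c) ∧
      Integrable g (ENNReal.ofReal (-c) • Measure.dirac (c + 1)) := fun g =>
    ⟨(integrable_dirac (by simp)).smul_measure ENNReal.ofReal_ne_top,
      (integrable_dirac (by simp)).smul_measure ENNReal.ofReal_ne_top⟩
  have hval : ∀ g : ℝ → ℝ, ∫ y, g y ∂μ = (c + 1) * g c + (-c) * g (c + 1) := by
    intro g
    rw [hμ, integral_add_measure (hint g).1 (hint g).2, integral_smul_measure,
      integral_smul_measure, integral_dirac, integral_dirac,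
      ENNReal.toReal_ofReal (by linarith), ENNReal.toReal_ofReal (by linarith)]
    simp
  have hae : ∀ᵐ y ∂μ, (fun y : ℝ => y) y ∈ Set.Icc c (c + 1) := by
    rw [hμ, ae_add_measure_iff]
    constructor
    · exact Measure.ae_smul_measure ((ae_dirac_iff measurableSet_Icc).2 (by simp)) _
    · exact Measure.ae_smul_measure ((ae_dirac_iff measurableSet_Icc).2 (by simp)) _
  have h := (ProbabilityTheory.hasSubgaussianMGF_of_mem_Icc_of_integral_eq_zero (μ := μ)
    (X := fun y : ℝ => y) measurable_id.aemeasurable hae (by rw [hval]; ring)).mgf_le l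
  rw [ProbabilityTheory.mgf, hval] at h
  have h2 : (((‖c + 1 - c‖₊ / 2) ^ 2 : NNReal) : ℝ) = 1 / 4 := by
    simp; norm_num
  rw [h2] at h
  calc _ = (c + 1) * Real.exp (l * c) + -c * Real.exp (l * (c + 1)) := by ring
    _ ≤ _ := h
    _ = _ := by congr 1; ring

/-- Convexity. The bound is affine in `y` with coefficients depending on `c` only, so its linear
part averages to zero for noise of conditional mean zero. -/
theorem exp_le_chord {c y : ℝ} (h1 : c ≤ y) (h2 : y ≤ c + 1) (l : ℝ) :
    Real.exp (l * y) ≤ ((c + 1) * Real.exp (l * c) - c * Real.exp (l * (c + 1)))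
      + (Real.exp (l * (c + 1)) - Real.exp (l * c)) * y := by
  have h := convexOn_exp.2 (Set.mem_univ (l * c)) (Set.mem_univ (l * (c + 1)))
    (show 0 ≤ c + 1 - y by linarith) (show 0 ≤ y - c by linarith) (by ring)
  simp only [smul_eq_mul] at h
  calc Real.exp (l * y) = Real.exp ((c + 1 - y) * (l * c) + (y - c) * (l * (c + 1))) := by
        congr 1; ring
    _ ≤ _ := h
    _ = _ := by ring

namespace IsNoisyEvaluation

section

variable {X Ω : Type*} [MeasurableSpace X] [mΩ : MeasurableSpace Ω] {f : X → ℝ} {μ : Measure Ω} {F : Filtration ℕ mΩ} {x : ℕ → Ω → X} {r : ℕ → Ω → ℝ}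

theorem integrable_comp (hE : IsNoisyEvaluation f μ F x r) (t : ℕ) :
    Integrable (fun ω => f (x t ω)) μ :=
  integrable_condExp.congr (hE.reward_mean t)

theorem integrable_noise (hE : IsNoisyEvaluation f μ F x r) (t : ℕ) :
    Integrable (fun ω => r t ω - f (x t ω)) μ :=
  (hE.reward_integrable t).sub (hE.integrable_comp t)

/-- The endpoints of the reward interval are known given `F t`, so conditional expectation places
the mean `f (x t)` in the same interval. -/
theorem exists_lower [IsProbabilityMeasure μ] (hE : IsNoisyEvaluation f μ F x r) :
    ∃ b : X → ℝ, Measurable b ∧ ∀ t, ∀ᵐ ω ∂μ, b (x t ω) ≤ r t ω ∧ r t ω ≤ b (x t ω) + 1 ∧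
      b (x t ω) ≤ f (x t ω) ∧ f (x t ω) ≤ b (x t ω) + 1 := by
  obtain ⟨b, hb, hbd⟩ := hE.reward_bounded
  refine ⟨b, hb, fun t => ?_⟩
  have hm : Measurable[F t] fun ω => b (x t ω) := hb.comp (hE.point_measurable t)
  have hm' : StronglyMeasurable[F t] fun ω => b (x t ω) := hm.stronglyMeasurable
  have hint : Integrable (fun ω => b (x t ω)) μ := by
    refine Integrable.mono' ((hE.reward_integrable t).abs.add (integrable_const 1))
      (hm'.mono (F.le t)).aestronglyMeasurable ?_
    filter_upwards [hbd t] with ω hω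
    simp only [Real.norm_eq_abs, Pi.add_apply]
    rw [abs_le]
    have := neg_abs_le (r t ω)
    have := le_abs_self (r t ω)
    constructor <;> linarith
  have h1 : (fun ω => b (x t ω)) ≤ᵐ[μ] μ[r t | F t] := by
    have := condExp_mono (m := F t) hint (hE.reward_integrable t)
      (by filter_upwards [hbd t] with ω hω using hω.1)
    rwa [condExp_of_stronglyMeasurable (F.le t) hm' hint] at this
  have h2 : μ[r t | F t] ≤ᵐ[μ] (fun ω => b (x t ω) + 1) := by
    have := condExp_mono (m := F t) (hE.reward_integrable t) (hint.add (integrable_const 1))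
      (by filter_upwards [hbd t] with ω hω using hω.2)
    rwa [condExp_of_stronglyMeasurable (F.le t) (hm'.add stronglyMeasurable_const)
      (hint.add (integrable_const 1))] at this
  filter_upwards [hbd t, h1, h2, hE.reward_mean t] with ω a1 a2 a3 a4
  rw [a4] at a2 a3
  exact ⟨a1.1, a1.2, a2, a3⟩

theorem abs_noise_le [IsProbabilityMeasure μ] (hE : IsNoisyEvaluation f μ F x r) (t : ℕ) :
    ∀ᵐ ω ∂μ, |r t ω - f (x t ω)| ≤ 1 := by
  obtain ⟨b, -, hb⟩ := hE.exists_lower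
  filter_upwards [hb t] with ω h
  rw [abs_le]
  constructor <;> linarith [h.1, h.2.1, h.2.2.1, h.2.2.2]

theorem measurable_noise (hE : IsNoisyEvaluation f μ F x r) (hf : Measurable f) {s t : ℕ}
    (h : s < t) : Measurable[F t] fun ω => r s ω - f (x s ω) :=
  ((hE.reward_measurable s).mono (F.mono h) le_rfl).sub
    (hf.comp ((hE.point_measurable s).mono (F.mono h.le) le_rfl))

theorem integral_mul_noise [IsProbabilityMeasure μ] (hE : IsNoisyEvaluation f μ F x r) {t : ℕ} {Z : Ω → ℝ}
    (hZ : Measurable[F t] Z) (C : ℝ) (hC : ∀ᵐ ω ∂μ, |Z ω| ≤ C) :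
    ∫ ω, Z ω * (r t ω - f (x t ω)) ∂μ = 0 := by
  have hZ' : StronglyMeasurable[F t] Z := hZ.stronglyMeasurable
  have hZm : AEStronglyMeasurable Z μ := (hZ'.mono (F.le t)).aestronglyMeasurable
  have hi1 : Integrable (fun ω => Z ω * r t ω) μ := (hE.reward_integrable t).bdd_mul hZm hC
  have hi2 : Integrable (fun ω => Z ω * f (x t ω)) μ := (hE.integrable_comp t).bdd_mul hZm hC
  have h1 := condExp_mul_of_stronglyMeasurable_left hZ' hi1 (hE.reward_integrable t)
  have h2 : ∫ ω, Z ω * r t ω ∂μ = ∫ ω, Z ω * f (x t ω) ∂μ := by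
    rw [← integral_condExp (F.le t)]
    apply integral_congr_ae
    filter_upwards [h1, hE.reward_mean t] with ω a1 a2
    rw [← a2]
    exact a1
  simp only [mul_sub]
  rw [integral_sub hi1 hi2, h2, sub_self]

open Classical in
-- The exponential is a supermartingale: whether the point lies in `A` is known before the reward,
-- and each counted reward contributes a conditional factor at most one. The induction removes the
-- latest label.
theorem integral_exp_noise_le [IsProbabilityMeasure μ] (hE : IsNoisyEvaluation f μ F x r) (hf : Measurable f)
    {A : Set X} (hA : MeasurableSet A) (l : ℝ) (S : Finset ℕ) :
    Integrable (fun ω => Real.exp (∑ s ∈ S.filter (fun s => x s ω ∈ A),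
      (l * (r s ω - f (x s ω)) - l ^ 2 / 8))) μ ∧
    ∫ ω, Real.exp (∑ s ∈ S.filter (fun s => x s ω ∈ A),
      (l * (r s ω - f (x s ω)) - l ^ 2 / 8)) ∂μ ≤ 1 := by
  obtain ⟨b, hb, hbd⟩ := hE.exists_lower
  have hmeas : ∀ S : Finset ℕ, ∀ t, (∀ s ∈ S, s < t) → Measurable[F t] fun ω =>
      Real.exp (∑ s ∈ S.filter (fun s => x s ω ∈ A), (l * (r s ω - f (x s ω)) - l ^ 2 / 8)) := by
    intro S t hS
    simp only [Finset.sum_filter]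
    refine Real.measurable_exp.comp (Finset.measurable_sum _ fun s hs => ?_)
    refine Measurable.ite ?_ (((hE.measurable_noise hf (hS s hs)).const_mul l).sub_const _)
      measurable_const
    exact (hE.point_measurable s).mono (F.mono (hS s hs).le) le_rfl hA
  have hbound : ∀ S : Finset ℕ, ∀ᵐ ω ∂μ, |Real.exp (∑ s ∈ S.filter (fun s => x s ω ∈ A),
      (l * (r s ω - f (x s ω)) - l ^ 2 / 8))| ≤ Real.exp (S.card * |l|) := by
    intro S
    filter_upwards [ae_all_iff.2 hE.abs_noise_le] with ω hω
    rw [abs_of_pos (Real.exp_pos _)]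
    apply Real.exp_le_exp.2
    rw [Finset.sum_filter]
    calc _ ≤ ∑ s ∈ S, |l| := by
          apply Finset.sum_le_sum
          intro s _
          split_ifs
          · have h1 : l * (r s ω - f (x s ω)) ≤ |l| * 1 :=
              (le_abs_self _).trans (by rw [abs_mul]; gcongr; exact hω s)
            nlinarith [sq_nonneg l]
          · exact abs_nonneg l
      _ = _ := by rw [Finset.sum_const, nsmul_eq_mul]
  have hint : ∀ S : Finset ℕ, Integrable (fun ω => Real.exp (∑ s ∈ S.filter (fun s => x s ω ∈ A),
      (l * (r s ω - f (x s ω)) - l ^ 2 / 8))) μ := by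
    intro S
    have h := hmeas S (S.sup id + 1) (fun s hs => Nat.lt_succ_of_le (Finset.le_sup (f := id) hs))
    exact Integrable.of_bound ((h.mono (F.le _) le_rfl).aestronglyMeasurable) _ (hbound S)
  refine ⟨hint S, ?_⟩
  induction S using Finset.induction_on_max with
  | empty => simp
  | insert a S hS ih =>
    refine le_trans ?_ ih
    set W : Ω → ℝ := fun ω => Real.exp (∑ s ∈ S.filter (fun s => x s ω ∈ A),
      (l * (r s ω - f (x s ω)) - l ^ 2 / 8)) with hW
    -- `Z` is the slope of the chord bound for the last factor times the previous product. It is `F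
    -- a`-measurable and bounded, so `Z` times the noise has integral zero.
    set Z : Ω → ℝ := fun ω => W ω * ((x a ⁻¹' A).indicator (fun ω =>
      Real.exp (-(l ^ 2 / 8)) * (Real.exp (l * (b (x a ω) - f (x a ω) + 1))
        - Real.exp (l * (b (x a ω) - f (x a ω))))) ω) with hZ
    have hc : Measurable[F a] fun ω => b (x a ω) - f (x a ω) :=
      (hb.comp (hE.point_measurable a)).sub (hf.comp (hE.point_measurable a))
    have hZm : Measurable[F a] Z := by
      refine (hmeas S a hS).mul (Measurable.indicator ?_ (hE.point_measurable a hA))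
      refine Measurable.const_mul (Measurable.sub ?_ ?_) _
      · exact Real.measurable_exp.comp ((hc.add_const 1).const_mul l)
      · exact Real.measurable_exp.comp (hc.const_mul l)
    have hZb : ∀ᵐ ω ∂μ, |Z ω| ≤ Real.exp (S.card * |l|) * (2 * Real.exp |l|) := by
      filter_upwards [hbound S, hbd a] with ω h1 h2
      rw [hZ, abs_mul]
      gcongr
      rw [Set.indicator_apply]
      split_ifs
      · have hl : ∀ y : ℝ, |y| ≤ 1 → Real.exp (l * y) ≤ Real.exp |l| := by
          intro y hy
          apply Real.exp_le_exp.2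
          calc l * y ≤ |l * y| := le_abs_self _
            _ ≤ |l| * 1 := by rw [abs_mul]; gcongr
            _ = _ := mul_one _
        have e1 := hl (b (x a ω) - f (x a ω) + 1) (by rw [abs_le]; constructor <;> linarith [h2.2.2])
        have e2 := hl (b (x a ω) - f (x a ω)) (by rw [abs_le]; constructor <;> linarith [h2.2.2])
        have p1 := Real.exp_pos (l * (b (x a ω) - f (x a ω) + 1))
        have p2 := Real.exp_pos (l * (b (x a ω) - f (x a ω)))
        have p3 : Real.exp (-(l ^ 2 / 8)) ≤ 1 := Real.exp_le_one_iff.2 (by nlinarith [sq_nonneg l])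
        rw [abs_mul, abs_of_pos (Real.exp_pos _)]
        calc _ ≤ 1 * |Real.exp (l * (b (x a ω) - f (x a ω) + 1))
              - Real.exp (l * (b (x a ω) - f (x a ω)))| := by gcongr
          _ ≤ _ := by rw [one_mul, abs_le]; constructor <;> linarith
      · rw [abs_zero]; positivity
    have h0 := hE.integral_mul_noise hZm _ hZb
    have hZi : Integrable (fun ω => Z ω * (r a ω - f (x a ω))) μ :=
      (hE.integrable_noise a).bdd_mul ((hZm.mono (F.le a) le_rfl).aestronglyMeasurable) hZb
    have hle : (fun ω => Real.exp (∑ s ∈ (insert a S).filter (fun s => x s ω ∈ A),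
        (l * (r s ω - f (x s ω)) - l ^ 2 / 8)))
        ≤ᵐ[μ] fun ω => W ω + Z ω * (r a ω - f (x a ω)) := by
      filter_upwards [hbd a] with ω h2
      have haS : a ∉ S := fun h => (hS a h).false
      simp only [hW, hZ, Finset.filter_insert, Set.indicator_apply, Set.mem_preimage]
      split_ifs with hxa
      · rw [Finset.sum_insert (by simp [haS]), Real.exp_add, mul_comm (Real.exp _), mul_assoc,
          ← mul_one_add (Real.exp (∑ s ∈ S.filter (fun s => x s ω ∈ A),
            (l * (r s ω - f (x s ω)) - l ^ 2 / 8)))]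
        gcongr
        have e1 := exp_le_chord (c := b (x a ω) - f (x a ω)) (y := r a ω - f (x a ω))
          (by linarith [h2.1]) (by linarith [h2.2.1]) l
        have e2 := two_point_mgf_le (c := b (x a ω) - f (x a ω)) (by linarith [h2.2.2.2])
          (by linarith [h2.2.2.1]) l
        have e3 : Real.exp (-(l ^ 2 / 8)) * Real.exp (l ^ 2 / 8) = 1 := by
          rw [← Real.exp_add]; simp
        rw [sub_eq_add_neg, Real.exp_add, mul_comm (Real.exp (l * _))]
        calc _ ≤ Real.exp (-(l ^ 2 / 8)) * (Real.exp (l ^ 2 / 8)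
              + (Real.exp (l * (b (x a ω) - f (x a ω) + 1))
                - Real.exp (l * (b (x a ω) - f (x a ω)))) * (r a ω - f (x a ω))) := by
              gcongr; linarith
          _ = _ := by rw [mul_add, e3]; ring
      · simp
    calc _ ≤ ∫ ω, (W ω + Z ω * (r a ω - f (x a ω))) ∂μ :=
          integral_mono_ae (hint _) ((hint S).add hZi) hle
      _ = ∫ ω, W ω ∂μ := by rw [integral_add (hint S) hZi, h0, add_zero]

end

end IsNoisyEvaluation

namespace IsNoisyEvaluation

section

variable {X Ω : Type*} [MeasurableSpace X] [mΩ : MeasurableSpace Ω] {f : X → ℝ} {μ : Measure Ω}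
  {F : Filtration ℕ mΩ} {x : ℕ → Ω → X} {r : ℕ → Ω → ℝ}

open Classical in
-- The number of evaluations in `A` is random, so the parameter of the exponential is tuned
-- separately for each possible value `j` and a union bound is taken; this is the factor `S.card`.
-- With `l j = 4 σ √(2 L / j)` the exponent is at least `8 L - 4 L`. The value `j = 0` cannot occur,
-- since the inequality is strict.
theorem measureReal_lt_noise_le [IsProbabilityMeasure μ] (hE : IsNoisyEvaluation f μ F x r)
    (hf : Measurable f) {A : Set X} (hA : MeasurableSet A) (S : Finset ℕ) {L : ℝ} (hL : 0 ≤ L)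
    {σ : ℝ} (hσ : σ ^ 2 = 1) :
    μ.real {ω | Real.sqrt (2 * ((S.filter fun s => x s ω ∈ A).card : ℝ) * L) <
      σ * ∑ s ∈ S.filter (fun s => x s ω ∈ A), (r s ω - f (x s ω))}
      ≤ S.card * Real.exp (-(4 * L)) := by
  set l : ℕ → ℝ := fun j => σ * (4 * Real.sqrt (2 * L / j)) with hl
  set W : ℕ → Ω → ℝ := fun j ω => Real.exp (∑ s ∈ S.filter (fun s => x s ω ∈ A),
      (l j * (r s ω - f (x s ω)) - l j ^ 2 / 8)) with hW
  have hsub : {ω | Real.sqrt (2 * ((S.filter fun s => x s ω ∈ A).card : ℝ) * L) <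
      σ * ∑ s ∈ S.filter (fun s => x s ω ∈ A), (r s ω - f (x s ω))} ⊆
      ⋃ j ∈ Finset.Icc 1 S.card, {ω | Real.exp (4 * L) ≤ W j ω} := by
    intro ω hω
    simp only [Set.mem_ofPred_eq] at hω
    have hpos : 0 < (S.filter fun s => x s ω ∈ A).card := by
      rcases Nat.eq_zero_or_pos (S.filter fun s => x s ω ∈ A).card with h | h
      · rw [Finset.card_eq_zero] at h
        simp [h] at hω
      · exact h
    refine Set.mem_biUnion (x := (S.filter fun s => x s ω ∈ A).card)
      (Finset.mem_Icc.2 ⟨hpos, Finset.card_filter_le _ _⟩) ?_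
    simp only [Set.mem_ofPred_eq, hW]
    apply Real.exp_le_exp.2
    rw [Finset.sum_sub_distrib, ← Finset.mul_sum, Finset.sum_const, nsmul_eq_mul]
    set j := (S.filter fun s => x s ω ∈ A).card with hj
    have hj0 : (0 : ℝ) < j := by exact_mod_cast hpos
    have h1 : l j ^ 2 = 16 * (2 * L / j) := by
      simp only [hl]
      rw [mul_pow, mul_pow, hσ, Real.sq_sqrt (by positivity)]; ring
    have h2 : Real.sqrt (2 * L / j) * Real.sqrt (2 * j * L) = 2 * L := by
      rw [← Real.sqrt_mul (by positivity), show 2 * L / j * (2 * j * L) = (2 * L) ^ 2 by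
        field_simp]
      exact Real.sqrt_sq (by positivity)
    have h3 : l j * ∑ s ∈ S.filter (fun s => x s ω ∈ A), (r s ω - f (x s ω))
        = 4 * (Real.sqrt (2 * L / j)
          * (σ * ∑ s ∈ S.filter (fun s => x s ω ∈ A), (r s ω - f (x s ω)))) := by
      simp only [hl]; ring
    have h4 : 2 * L ≤ Real.sqrt (2 * L / j)
          * (σ * ∑ s ∈ S.filter (fun s => x s ω ∈ A), (r s ω - f (x s ω))) := by
      exact h2.symm.le.trans <| mul_le_mul_of_nonneg_left hω.le (Real.sqrt_nonneg _)
    rw [h1, h3]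
    have h5 : (j : ℝ) * (16 * (2 * L / j) / 8) = 4 * L := by field_simp; ring
    linarith
  have hmarkov : ∀ j, μ.real {ω | Real.exp (4 * L) ≤ W j ω} ≤ Real.exp (-(4 * L)) := by
    intro j
    obtain ⟨hi, hle⟩ := hE.integral_exp_noise_le hf hA (l j) S
    have h := mul_meas_ge_le_integral_of_nonneg (μ := μ) (f := W j)
      (Filter.Eventually.of_forall fun ω => (Real.exp_pos _).le) hi (Real.exp (4 * L))
    rw [Real.exp_neg, ← one_div, le_div_iff₀ (Real.exp_pos _), mul_comm]
    exact h.trans hle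
  calc _ ≤ μ.real (⋃ j ∈ Finset.Icc 1 S.card, {ω | Real.exp (4 * L) ≤ W j ω}) :=
        measureReal_mono hsub (measure_ne_top _ _)
    _ ≤ ∑ j ∈ Finset.Icc 1 S.card, μ.real {ω | Real.exp (4 * L) ≤ W j ω} :=
        measureReal_biUnion_finset_le _ _
    _ ≤ ∑ j ∈ Finset.Icc 1 S.card, Real.exp (-(4 * L)) := Finset.sum_le_sum fun j _ => hmarkov j
    _ = _ := by simp

theorem integrable_sum_noise_sq [IsProbabilityMeasure μ] (hE : IsNoisyEvaluation f μ F x r)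
    (S : Finset ℕ) : Integrable (fun ω => (∑ s ∈ S, (r s ω - f (x s ω))) ^ 2) μ := by
  have hm : AEStronglyMeasurable (fun ω => ∑ s ∈ S, (r s ω - f (x s ω))) μ :=
    (integrable_finsetSum S fun s _ => hE.integrable_noise s).aestronglyMeasurable
  refine Integrable.of_bound (hm.pow 2) ((S.card : ℝ) ^ 2) ?_
  filter_upwards [ae_all_iff.2 hE.abs_noise_le] with ω hω
  rw [Real.norm_eq_abs, abs_pow]
  gcongr
  calc _ ≤ ∑ s ∈ S, |r s ω - f (x s ω)| := Finset.abs_sum_le_sum_abs _ _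
    _ ≤ ∑ s ∈ S, (1 : ℝ) := Finset.sum_le_sum fun s _ => hω s
    _ = _ := by simp

/-- Noise terms are orthogonal, being martingale differences, and each is at most one in absolute
value. -/
theorem integral_sum_noise_sq_le [IsProbabilityMeasure μ] (hE : IsNoisyEvaluation f μ F x r)
    (hf : Measurable f) (S : Finset ℕ) :
    ∫ ω, (∑ s ∈ S, (r s ω - f (x s ω))) ^ 2 ∂μ ≤ S.card := by
  induction S using Finset.induction_on_max with
  | empty => simp
  | insert a S hS ih =>
    have haS : a ∉ S := fun h => (hS a h).false
    set Z : Ω → ℝ := fun ω => ∑ s ∈ S, (r s ω - f (x s ω)) with hZ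
    have hZm : Measurable[F a] Z :=
      Finset.measurable_sum _ fun s hs => hE.measurable_noise hf (hS s hs)
    have hZb : ∀ᵐ ω ∂μ, |Z ω| ≤ S.card := by
      filter_upwards [ae_all_iff.2 hE.abs_noise_le] with ω hω
      calc _ ≤ ∑ s ∈ S, |r s ω - f (x s ω)| := Finset.abs_sum_le_sum_abs _ _
        _ ≤ ∑ s ∈ S, (1 : ℝ) := Finset.sum_le_sum fun s _ => hω s
        _ = _ := by simp
    have h0 := hE.integral_mul_noise hZm _ hZb
    have hi1 : Integrable (fun ω => Z ω * (r a ω - f (x a ω))) μ :=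
      (hE.integrable_noise a).bdd_mul ((hZm.mono (F.le a) le_rfl).aestronglyMeasurable) hZb
    have hi2 : Integrable (fun ω => (r a ω - f (x a ω)) ^ 2) μ := by
      simpa using hE.integrable_sum_noise_sq {a}
    have hi3 := hE.integrable_sum_noise_sq S
    have h1 : ∫ ω, (r a ω - f (x a ω)) ^ 2 ∂μ ≤ 1 := by
      calc _ ≤ ∫ ω, (1 : ℝ) ∂μ := by
            apply integral_mono_ae hi2 (integrable_const 1)
            filter_upwards [hE.abs_noise_le a] with ω hω
            rw [← sq_abs]
            exact pow_le_one₀ (abs_nonneg _) hω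
        _ = 1 := by simp
    calc ∫ ω, (∑ s ∈ insert a S, (r s ω - f (x s ω))) ^ 2 ∂μ
        = ∫ ω, (Z ω ^ 2 + (2 * (Z ω * (r a ω - f (x a ω))) + (r a ω - f (x a ω)) ^ 2)) ∂μ := by
          congr 1; ext ω
          rw [Finset.sum_insert haS, hZ]; ring
      _ = ∫ ω, Z ω ^ 2 ∂μ + (2 * 0 + ∫ ω, (r a ω - f (x a ω)) ^ 2 ∂μ) := by
          have hi4 : Integrable (fun ω => 2 * (Z ω * (r a ω - f (x a ω)))
              + (r a ω - f (x a ω)) ^ 2) μ := (hi1.const_mul 2).add hi2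
          rw [integral_add hi3 hi4, integral_add (hi1.const_mul 2) hi2, integral_const_mul, h0]
      _ ≤ S.card + (2 * 0 + 1) := by gcongr
      _ = _ := by rw [Finset.card_insert_of_notMem haS]; push_cast; ring

end

end IsNoisyEvaluation

/-! ### Deterministic analysis of HOO around a single node -/

theorem Finset.sum_biUnion_le_sum {ι α : Type*} [DecidableEq α] (s : Finset ι) (t : ι → Finset α)
    {g : α → ℝ} (hg : ∀ a, 0 ≤ g a) : ∑ a ∈ s.biUnion t, g a ≤ ∑ i ∈ s, ∑ a ∈ t i, g a := by
  classical
  induction s using Finset.induction_on with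
  | empty => simp
  | insert i s hi ih =>
    rw [Finset.biUnion_insert, Finset.sum_insert hi]
    have h := Finset.sum_union_inter (s₁ := t i) (s₂ := s.biUnion t) (f := g)
    have h2 : 0 ≤ ∑ a ∈ t i ∩ s.biUnion t, g a := Finset.sum_nonneg fun a _ => hg a
    linarith

namespace HierarchicalPartition

section Run

variable {X : Type*} {K : ℕ} (P : HierarchicalPartition X K)

/-- The evaluations with labels in `S` are those of one instance of HOO. -/
def IsHOORun (νm ρ' : ℝ) (S : Finset ℕ) (node : ℕ → List (Fin K)) (pt : ℕ → X) (rew : ℕ → ℝ) :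
    Prop :=
  ∀ s ∈ S, P.HOOSelects νm ρ' (S.filter (· < s)) node pt rew (node s) ∧ pt s ∈ P.cell (node s)

variable {P} {νm ρ' : ℝ} {S : Finset ℕ} {node : ℕ → List (Fin K)} {pt : ℕ → X} {rew : ℕ → ℝ}

theorem IsHOORun.node_injOn (h : P.IsHOORun νm ρ' S node pt rew) :
    Set.InjOn node (S : Set ℕ) := by
  intro s hs t ht hst
  by_contra hne
  rcases lt_or_gt_of_ne hne with hlt | hlt
  · exact (h t ht).1.1.2.1 s (Finset.mem_filter.2 ⟨hs, hlt⟩) hst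
  · exact (h s hs).1.1.2.1 t (Finset.mem_filter.2 ⟨ht, hlt⟩) hst.symm

/-- The parent of a selected node was selected earlier by the same instance. Hence after `t`
evaluations only depths below `t` matter on the path to `xs`, which keeps the union bound finite. -/
theorem IsHOORun.length_node_le (h : P.IsHOORun νm ρ' S node pt rew) {s : ℕ} (hs : s ∈ S) :
    (node s).length ≤ (S.filter (· < s)).card := by
  induction s using Nat.strong_induction_on with
  | _ s ih =>
    rcases hn : node s with _ | ⟨i, b⟩
    · simp
    · obtain ⟨s₀, hs₀, hb⟩ := (h s hs).1.1.2.2 b (hn ▸ List.suffix_cons i b)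
        (by rw [hn]; exact fun h => by simpa using congrArg List.length h)
      rw [Finset.mem_filter] at hs₀
      have h1 := ih s₀ hs₀.2 hs₀.1
      have h2 : (S.filter (· < s₀)).card < (S.filter (· < s)).card := by
        apply Finset.card_lt_card
        refine Finset.ssubset_iff_subset_ne.2 ⟨?_, fun heq => ?_⟩
        · intro a ha
          rw [Finset.mem_filter] at ha ⊢
          exact ⟨ha.1, ha.2.trans hs₀.2⟩
        · have : s₀ ∈ S.filter (· < s₀) := heq ▸ Finset.mem_filter.2 hs₀
          simp at this
      rw [hb] at h1
      rw [List.length_cons]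
      omega

/-- The shallowest unselected cell containing `xs`; it is the competitor of the leaf that HOO
selects. -/
theorem exists_isLeaf (P : HierarchicalPartition X K) (S : Finset ℕ) (node : ℕ → List (Fin K))
    (xs : X) : ∃ w, xs ∈ P.cell w ∧ P.IsLeaf S node w := by
  classical
  have hex : ∃ h, ∃ u : List (Fin K), u.length = h ∧ xs ∈ P.cell u ∧ ∀ s ∈ S, node s ≠ u := by
    obtain ⟨u, hu, hx⟩ := P.exists_mem_cell xs (S.sup (fun s => (node s).length) + 1)
    refine ⟨_, u, hu, hx, fun s hs heq => ?_⟩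
    have := Finset.le_sup (f := fun s => (node s).length) hs
    simp only [heq, hu] at this
    omega
  obtain ⟨w, hw, hxw, hnew⟩ := Nat.find_spec hex
  refine ⟨w, hxw, ⟨xs, hxw⟩, hnew, fun a ha hne => ?_⟩
  by_contra hcon
  push Not at hcon
  have hlt : a.length < Nat.find hex := by
    rw [← hw]
    exact lt_of_le_of_ne ha.length_le fun h => hne (ha.eq_of_length h)
  exact Nat.find_min hex hlt ⟨a, rfl, P.cell_subset_of_suffix ha hxw, hcon⟩

/-- The explored nodes above the leaf containing `xs` have value at least `c`, and the selected path
maximizes the minimum, so its values are at least `c` too. -/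
theorem HOOSelects.le_hooU {u : List (Fin K)} {xs : X} {c : ℝ}
    (h : P.HOOSelects νm ρ' S node pt rew u)
    (hopt : ∀ s ∈ S, xs ∈ P.cell (node s) → c ≤ P.hooU νm ρ' S pt rew (node s))
    {a : List (Fin K)} (ha : a <:+ u) (hne : a ≠ u) : c ≤ P.hooU νm ρ' S pt rew a := by
  obtain ⟨w, hxw, hw⟩ := P.exists_isLeaf S node xs
  have h1 : (c : EReal) ≤ P.pathValue νm ρ' S pt rew w := by
    refine le_iInf₂ fun b hb => ?_
    obtain ⟨s, hs, rfl⟩ := hw.2.2 b hb.1 hb.2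
    exact EReal.coe_le_coe_iff.2 (hopt s hs (P.cell_subset_of_suffix hb.1 hxw))
  have h2 : P.pathValue νm ρ' S pt rew u ≤ ((P.hooU νm ρ' S pt rew a : ℝ) : EReal) :=
    iInf₂_le a ⟨ha, hne⟩
  exact EReal.coe_le_coe_iff.1 (h1.trans ((h.2 w hw).trans h2))

variable {f : X → ℝ} {xs : X}

theorem hooU_mul_card (P : HierarchicalPartition X K) (f : X → ℝ) (νm ρ' : ℝ) (S : Finset ℕ)
    (pt : ℕ → X) (rew : ℕ → ℝ) {a : List (Fin K)} (hN : 0 < (P.evalsIn S pt a).card) :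
    ((P.evalsIn S pt a).card : ℝ) * P.hooU νm ρ' S pt rew a
      = ∑ s ∈ P.evalsIn S pt a, f (pt s) + ∑ s ∈ P.evalsIn S pt a, (rew s - f (pt s))
        + Real.sqrt (2 * ((P.evalsIn S pt a).card : ℝ) * Real.log S.card)
        + ((P.evalsIn S pt a).card : ℝ) * (νm * ρ' ^ a.length) := by
  set N : ℝ := ((P.evalsIn S pt a).card : ℝ)
  have hN0 : 0 < N := Nat.cast_pos.2 hN
  have h1 : N * Real.sqrt (2 * Real.log S.card / N) = Real.sqrt (2 * N * Real.log S.card) := by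
    rw [show 2 * N * Real.log S.card = N ^ 2 * (2 * Real.log S.card / N) by field_simp,
      Real.sqrt_mul (by positivity), Real.sqrt_sq hN0.le]
  rw [hooU, mul_add, mul_add, h1, mul_div_cancel₀ _ hN0.ne', ← Finset.sum_add_distrib]
  simp

theorem le_hooU_of_noise {a : List (Fin K)} (hN : 0 < (P.evalsIn S pt a).card)
    (hsm : ∀ x ∈ P.cell a, f xs - νm * ρ' ^ a.length ≤ f x)
    (hnoise : -∑ s ∈ P.evalsIn S pt a, (rew s - f (pt s))
      ≤ Real.sqrt (2 * ((P.evalsIn S pt a).card : ℝ) * Real.log S.card)) :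
    f xs ≤ P.hooU νm ρ' S pt rew a := by
  have hN0 : (0 : ℝ) < (P.evalsIn S pt a).card := by exact_mod_cast hN
  refine le_of_mul_le_mul_left ?_ hN0
  rw [hooU_mul_card P f νm ρ' S pt rew hN]
  have h1 : ((P.evalsIn S pt a).card : ℝ) * (f xs - νm * ρ' ^ a.length)
      ≤ ∑ s ∈ P.evalsIn S pt a, f (pt s) := by
    rw [← nsmul_eq_mul]
    refine Finset.card_nsmul_le_sum _ _ _ fun s hs => hsm _ ?_
    classical
    exact (Finset.mem_filter.1 hs).2
  linarith

theorem sum_regret_le_of_le_hooU {a : List (Fin K)} {L : ℝ} (hN : 0 < (P.evalsIn S pt a).card)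
    (hU : f xs ≤ P.hooU νm ρ' S pt rew a) (hL : Real.log S.card ≤ L)
    (hnoise : ∑ s ∈ P.evalsIn S pt a, (rew s - f (pt s))
      ≤ Real.sqrt (2 * ((P.evalsIn S pt a).card : ℝ) * L)) :
    ∑ s ∈ P.evalsIn S pt a, (f xs - f (pt s))
      ≤ 2 * Real.sqrt (2 * ((P.evalsIn S pt a).card : ℝ) * L)
        + (P.evalsIn S pt a).card * (νm * ρ' ^ a.length) := by
  have hN0 : (0 : ℝ) < (P.evalsIn S pt a).card := by exact_mod_cast hN
  have h := mul_le_mul_of_nonneg_left hU hN0.le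
  rw [hooU_mul_card P f νm ρ' S pt rew hN] at h
  rw [Finset.sum_sub_distrib, Finset.sum_const, nsmul_eq_mul]
  have h2 : Real.sqrt (2 * ((P.evalsIn S pt a).card : ℝ) * Real.log S.card)
      ≤ Real.sqrt (2 * ((P.evalsIn S pt a).card : ℝ) * L) := by gcongr
  linarith

theorem two_mul_sqrt_le {N L e : ℝ} (hN : 0 ≤ N) (hL : 0 ≤ L) (he : 0 < e) :
    2 * Real.sqrt (2 * N * L) ≤ N * e + 2 * L / e := by
  have h1 : Real.sqrt (2 * N * L) = Real.sqrt (N * e) * Real.sqrt (2 * L / e) := by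
    rw [← Real.sqrt_mul (by positivity)]
    congr 1
    field_simp
  have h2 := Real.sq_sqrt (show 0 ≤ N * e by positivity)
  have h3 := Real.sq_sqrt (show 0 ≤ 2 * L / e by positivity)
  rw [h1]
  nlinarith [sq_nonneg (Real.sqrt (N * e) - Real.sqrt (2 * L / e))]

theorem evalsIn_mono (P : HierarchicalPartition X K) {S T : Finset ℕ} (h : S ⊆ T) (pt : ℕ → X)
    (a : List (Fin K)) : P.evalsIn S pt a ⊆ P.evalsIn T pt a := by
  classical exact Finset.filter_subset_filter _ h

theorem mem_evalsIn {a : List (Fin K)} {s : ℕ} :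
    s ∈ P.evalsIn S pt a ↔ s ∈ S ∧ pt s ∈ P.cell a := by
  simp [evalsIn]

/-- The regret of the evaluations below the node `a` that are made while the value of `a` is at
least the maximum of `f`. -/
theorem IsHOORun.sum_below_le (h : P.IsHOORun νm ρ' S node pt rew) {ν L : ℝ}
    (hmax : ∀ x, f x ≤ f xs) (hν : ∀ x, f xs - ν ≤ f x) {a : List (Fin K)}
    (he : 0 < νm * ρ' ^ a.length) (hL : Real.log S.card ≤ L) {B : Finset ℕ} (hB : B ⊆ S)
    (hBa : ∀ s ∈ B, a <:+ node s ∧ a ≠ node s ∧ f xs ≤ P.hooU νm ρ' (S.filter (· < s)) pt rew a)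
    (hconc : ∀ s ∈ S, ∑ s ∈ P.evalsIn (S.filter (· < s)) pt a, (rew s - f (pt s))
      ≤ Real.sqrt (2 * ((P.evalsIn (S.filter (· < s)) pt a).card : ℝ) * L)) :
    ∑ s ∈ B, (f xs - f (pt s)) ≤ 2 * ((P.evalsIn S pt a).card * (νm * ρ' ^ a.length))
        + 2 * L / (νm * ρ' ^ a.length) + ν ∧
    ((P.cell a).Nonempty → sSup (f '' P.cell a) < f xs - 2 * νm * ρ' ^ a.length →
      ∑ s ∈ B, (f xs - f (pt s)) ≤ 18 * L / (νm * ρ' ^ a.length) + ν) := by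
  have hL0 : 0 ≤ L := (Real.log_natCast_nonneg _).trans hL
  have hν0 : 0 ≤ ν := by linarith [hν xs]
  set e := νm * ρ' ^ a.length with he_def
  rcases B.eq_empty_or_nonempty with rfl | hne
  · rw [Finset.sum_empty]
    exact ⟨by positivity, fun _ _ => by positivity⟩
  -- At the last evaluation in `B`, the bound `f xs ≤ U` controls all evaluations made in the cell
  -- until then, including the others in `B`. The last one itself costs at most `ν`.
  set m := B.max' hne with hm
  have hmB : m ∈ B := B.max'_mem hne
  obtain ⟨hsuf, hneq, hU⟩ := hBa m hmB
  set S' := S.filter (· < m) with hS'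
  have hN : 0 < (P.evalsIn S' pt a).card := by
    obtain ⟨s₀, hs₀, rfl⟩ := (h m (hB hmB)).1.1.2.2 a hsuf hneq
    refine Finset.card_pos.2 ⟨s₀, mem_evalsIn.2 ⟨hs₀, (h s₀ (Finset.mem_filter.1 hs₀).1).2⟩⟩
  have hlog : Real.log S'.card ≤ L := by
    refine le_trans ?_ hL
    refine Real.log_le_log ?_ ?_
    · have h1 : (P.evalsIn S' pt a).card ≤ S'.card := by
        classical exact Finset.card_filter_le _ _
      exact_mod_cast hN.trans_le h1
    · exact_mod_cast Finset.card_filter_le _ _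
  have hR := sum_regret_le_of_le_hooU hN hU hlog (hconc m (hB hmB))
  rw [← he_def] at hR
  set N : ℝ := ((P.evalsIn S' pt a).card : ℝ) with hNdef
  have hsum : ∑ s ∈ B, (f xs - f (pt s)) ≤ ∑ s ∈ P.evalsIn S' pt a, (f xs - f (pt s)) + ν := by
    rw [← Finset.sum_erase_add _ _ hmB]
    refine add_le_add ?_ (by linarith [hν (pt m)])
    refine Finset.sum_le_sum_of_subset_of_nonneg (fun s hs => ?_) fun s _ _ => by
      linarith [hmax (pt s)]
    obtain ⟨hsm, hsB⟩ := Finset.mem_erase.1 hs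
    have hlt : s < m := lt_of_le_of_ne (B.le_max' s hsB) hsm
    exact mem_evalsIn.2 ⟨Finset.mem_filter.2 ⟨hB hsB, hlt⟩,
      P.cell_subset_of_suffix (hBa s hsB).1 (h s (hB hsB)).2⟩
  have hN0 : 0 < N := by rw [hNdef]; exact_mod_cast hN
  have hamgm := two_mul_sqrt_le hN0.le hL0 he
  constructor
  · have hNS : N ≤ (P.evalsIn S pt a).card := by
      rw [hNdef]
      exact_mod_cast Finset.card_le_card (P.evalsIn_mono (Finset.filter_subset _ _) pt a)
    have : N * e ≤ (P.evalsIn S pt a).card * e := by gcongr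
    linarith
  · intro _ hsup
    have h1 : N * (2 * e) ≤ ∑ s ∈ P.evalsIn S' pt a, (f xs - f (pt s)) := by
      rw [hNdef, ← nsmul_eq_mul]
      refine Finset.card_nsmul_le_sum _ _ _ fun s hs => ?_
      have := le_csSup (bddAbove_image hmax (P.cell a)) ⟨pt s, (mem_evalsIn.1 hs).2, rfl⟩
      rw [mul_assoc, ← he_def] at hsup
      linarith
    -- Each evaluation in a cell that is not near-optimal costs at least `2 * e`, of which the
    -- smoothness term pays only `e`; the square root has to pay the rest, which bounds `N`.
    have h2 : N * e ≤ 2 * Real.sqrt (2 * N * L) := by linarith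
    have h3 : N * e ≤ 8 * L / e := by
      rw [le_div_iff₀ he]
      have h4 : (N * e) ^ 2 ≤ (2 * Real.sqrt (2 * N * L)) ^ 2 := by gcongr
      rw [mul_pow 2, Real.sq_sqrt (by positivity)] at h4
      nlinarith
    have h5 : 18 * L / e = 2 * (8 * L / e) + 2 * L / e := by ring
    linarith

end Run

end HierarchicalPartition

/-! ### Regret of one HOO instance on the event where the confidence bounds hold -/

namespace HierarchicalPartition

section Total

variable {X : Type*} {K : ℕ} (P : HierarchicalPartition X K)

/-- The children of the near-optimal nodes of depth `h`. -/
noncomputable def nearOptChildren (f : X → ℝ) (xs : X) (h : ℕ) (ε : ℝ) :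
    Finset (List (Fin K)) :=
  ((Finset.univ : Finset (Fin K)) ×ˢ P.nearOptFinset f xs h ε).image fun p => p.1 :: p.2

theorem card_nearOptChildren_le (f : X → ℝ) (xs : X) (h : ℕ) (ε : ℝ) :
    (P.nearOptChildren f xs h ε).card ≤ K * (P.nearOptFinset f xs h ε).card := by
  refine Finset.card_image_le.trans ?_
  rw [Finset.card_product, Finset.card_univ, Fintype.card_fin]

/-- The nodes at which the empirical means have to be controlled in the analysis of HOO, when it is
stopped at depth `H`. -/
noncomputable def criticalNodes (f : X → ℝ) (xs : X) (νm ρ' : ℝ) (H : ℕ) :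
    Finset (List (Fin K)) :=
  P.nearOptFinset f xs H (2 * νm * ρ' ^ H) ∪
    (Finset.range H).biUnion fun h => P.nearOptChildren f xs h (2 * νm * ρ' ^ h)

theorem card_criticalNodes_le (f : X → ℝ) (xs : X) (νm ρ' : ℝ) (H : ℕ) {M : ℝ}
    (hM : ∀ h ≤ H, (P.numNearOpt f xs h (2 * νm * ρ' ^ h) : ℝ) ≤ M) :
    ((P.criticalNodes f xs νm ρ' H).card : ℝ) ≤ M + H * (K * M) := by
  have h1 : (P.criticalNodes f xs νm ρ' H).card ≤ (P.nearOptFinset f xs H (2 * νm * ρ' ^ H)).card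
      + ∑ h ∈ Finset.range H, K * (P.nearOptFinset f xs h (2 * νm * ρ' ^ h)).card := by
    refine (Finset.card_union_le _ _).trans (Nat.add_le_add_left ?_ _)
    refine Finset.card_biUnion_le.trans (Finset.sum_le_sum fun h _ => ?_)
    exact P.card_nearOptChildren_le f xs h _
  calc ((P.criticalNodes f xs νm ρ' H).card : ℝ)
      ≤ (P.nearOptFinset f xs H (2 * νm * ρ' ^ H)).card
      + ∑ h ∈ Finset.range H, (K : ℝ) * (P.nearOptFinset f xs h (2 * νm * ρ' ^ h)).card := by
        exact_mod_cast h1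
    _ ≤ M + ∑ h ∈ Finset.range H, (K : ℝ) * M := by
        simp only [card_nearOptFinset]
        gcongr with h hh
        · exact hM H le_rfl
        · exact hM h (Finset.mem_range.1 hh).le
    _ = _ := by simp

variable {P} {νm ρ' : ℝ} {S : Finset ℕ} {node : ℕ → List (Fin K)} {pt : ℕ → X} {rew : ℕ → ℝ}
  {f : X → ℝ} {xs : X}

open Classical in
-- Evaluations are of three kinds: strictly below a near-optimal node of depth `H` (`A₁`), at a
-- near-optimal node of depth at most `H` (`A₂`), or at or below a node that is not near-optimal but
-- has a near-optimal parent (`A₃`). The first kind pays the discretization error, the second is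
-- limited because each node is selected once, and the third because poor cells are visited rarely.
-- Only the tops of the first and third kinds need control of their means.
theorem IsHOORun.sum_regret_le_of_good (hrun : P.IsHOORun νm ρ' S node pt rew) {ν L M : ℝ}
    (hmax : ∀ x, f x ≤ f xs) (hν : ∀ x, f xs - ν ≤ f x) (hνm : 0 < νm) (hρ' : 0 < ρ')
    (hL : Real.log S.card ≤ L) {H : ℕ}
    (hM : ∀ h ≤ H, (P.numNearOpt f xs h (2 * νm * ρ' ^ h) : ℝ) ≤ M) {G : Finset ℕ} (hG : G ⊆ S)
    (hgood : ∀ s ∈ G, ∀ a, a <:+ node s → a ≠ node s →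
      f xs ≤ P.hooU νm ρ' (S.filter (· < s)) pt rew a)
    (hconc : ∀ a ∈ P.criticalNodes f xs νm ρ' H, ∀ s ∈ S,
      ∑ s ∈ P.evalsIn (S.filter (· < s)) pt a, (rew s - f (pt s))
        ≤ Real.sqrt (2 * ((P.evalsIn (S.filter (· < s)) pt a).card : ℝ) * L)) :
    ∑ s ∈ G, (f xs - f (pt s)) ≤ 2 * (S.card * (νm * ρ' ^ H)) + M * (2 * L / (νm * ρ' ^ H) + ν)
      + (H + 1) * (M * ν)
      + ∑ h ∈ Finset.range H, K * M * (18 * L / (νm * ρ' ^ (h + 1)) + 2 * ν) := by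
  set Q : ℕ → Finset (List (Fin K)) := fun h => P.nearOptFinset f xs h (2 * νm * ρ' ^ h) with hQ
  set C : ℕ → Finset (List (Fin K)) := fun h =>
    (P.nearOptChildren f xs h (2 * νm * ρ' ^ h)).filter fun c =>
      (P.cell c).Nonempty ∧ c ∉ Q c.length with hC
  have hL0 : 0 ≤ L := (Real.log_natCast_nonneg _).trans hL
  have hν0 : 0 ≤ ν := by linarith [hν xs]
  have hg : ∀ s, 0 ≤ f xs - f (pt s) := fun s => by linarith [hmax (pt s)]
  have hQM : ∀ h ≤ H, ((Q h).card : ℝ) ≤ M := fun h hh => by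
    rw [hQ, card_nearOptFinset]; exact hM h hh
  set A₁ := (Q H).biUnion fun a => G.filter fun s => a <:+ node s ∧ a ≠ node s
  set A₂ := (Finset.range (H + 1)).biUnion fun h => G.filter fun s => node s ∈ Q h
  set A₃ := (Finset.range H).biUnion fun h => (C h).biUnion fun c =>
    G.filter fun s => c <:+ node s
  have hcover : G ⊆ A₁ ∪ A₂ ∪ A₃ := by
    intro s hs
    have hcell := (hrun s (hG hs)).2
    have hne : ∀ a, a <:+ node s → (P.cell a).Nonempty := fun a ha =>
      ⟨_, P.cell_subset_of_suffix ha hcell⟩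
    by_cases hall : ∀ a, a <:+ node s → a.length ≤ H → a ∈ Q a.length
    · refine Finset.mem_union_left _ ?_
      rcases le_or_gt (node s).length H with hlen | hlen
      · refine Finset.mem_union_right _ (Finset.mem_biUnion.2 ⟨(node s).length, by simp; omega, ?_⟩)
        exact Finset.mem_filter.2 ⟨hs, hall _ (List.suffix_refl _) hlen⟩
      · refine Finset.mem_union_left _ (Finset.mem_biUnion.2
          ⟨(node s).drop ((node s).length - H), ?_, ?_⟩)
        · have hl : ((node s).drop ((node s).length - H)).length = H := by
            rw [List.length_drop]; omega
          have := hall _ (List.drop_suffix _ _) hl.le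
          rwa [hl] at this
        · refine Finset.mem_filter.2 ⟨hs, List.drop_suffix _ _, fun heq => ?_⟩
          have := congrArg List.length heq
          rw [List.length_drop] at this
          omega
    · push Not at hall
      have hex : ∃ l, ∃ a, a.length = l ∧ a <:+ node s ∧ a.length ≤ H ∧ a ∉ Q a.length := by
        obtain ⟨a, h1, h2, h3⟩ := hall
        exact ⟨_, a, rfl, h1, h2, h3⟩
      -- The shallowest ancestor that is not near-optimal. It is not the root, whose cell contains
      -- `xs`, so it has a near-optimal parent.
      obtain ⟨a, hal, ha, haH, haQ⟩ := Nat.find_spec hex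
      rcases a with _ | ⟨i, b⟩
      · refine absurd (P.mem_nearOptFinset.2 ⟨rfl, hne _ ha, ?_⟩) haQ
        have h1 : f xs ≤ sSup (f '' P.cell []) :=
          le_csSup (bddAbove_image hmax _) ⟨xs, by rw [P.cell_root]; trivial, rfl⟩
        have : 0 < 2 * νm * ρ' ^ ([] : List (Fin K)).length := by positivity
        linarith
      · have hb : b ∈ Q b.length := by
          by_contra hb
          rw [List.length_cons] at haH hal
          exact Nat.find_min hex (m := b.length) (by omega)
            ⟨b, rfl, (List.suffix_cons i b).trans ha, by omega, hb⟩
        rw [List.length_cons] at haH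
        refine Finset.mem_union_right _ (Finset.mem_biUnion.2 ⟨b.length, by simpa using haH, ?_⟩)
        refine Finset.mem_biUnion.2 ⟨i :: b, ?_, Finset.mem_filter.2 ⟨hs, ha⟩⟩
        refine Finset.mem_filter.2 ⟨?_, hne _ ha, haQ⟩
        exact Finset.mem_image.2 ⟨(i, b), by simpa using hb, rfl⟩
  have hcard : ∀ (B : Finset ℕ), B ⊆ G → (∑ s ∈ B, (f xs - f (pt s))) ≤ B.card * ν := by
    intro B _
    rw [← nsmul_eq_mul]
    exact Finset.sum_le_card_nsmul _ _ _ fun s _ => by linarith [hν (pt s)]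
  have hA₁ : ∑ s ∈ A₁, (f xs - f (pt s)) ≤ 2 * (S.card * (νm * ρ' ^ H))
      + M * (2 * L / (νm * ρ' ^ H) + ν) := by
    have h1 : ∀ a ∈ Q H, ∑ s ∈ G.filter (fun s => a <:+ node s ∧ a ≠ node s), (f xs - f (pt s))
        ≤ 2 * ((P.evalsIn S pt a).card * (νm * ρ' ^ H)) + (2 * L / (νm * ρ' ^ H) + ν) := by
      intro a ha
      have hl : a.length = H := (P.mem_nearOptFinset.1 ha).1
      have := (hrun.sum_below_le (a := a)
        (B := G.filter fun s => a <:+ node s ∧ a ≠ node s) hmax hν (by positivity) hL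
        ((Finset.filter_subset _ _).trans hG)
        (fun s hs => by
          obtain ⟨h1, h2, h3⟩ := Finset.mem_filter.1 hs
          exact ⟨h2, h3, hgood s h1 a h2 h3⟩)
        (hconc a (Finset.mem_union_left _ ha))).1
      rw [hl] at this
      linarith
    -- Cells of equal depth are disjoint, so the discretization error is paid once per evaluation
    -- and not once per cell.
    have h2 : ∑ a ∈ Q H, ((P.evalsIn S pt a).card : ℝ) ≤ S.card := by
      rw [← Nat.cast_sum, ← Finset.card_biUnion]
      · have : (Q H).biUnion (fun a => P.evalsIn S pt a) ⊆ S :=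
          Finset.biUnion_subset.2 fun a _ => Finset.filter_subset _ _
        exact_mod_cast Finset.card_le_card this
      · intro a ha b hb hab
        rw [Function.onFun, Finset.disjoint_left]
        intro s h1 h2
        exact hab (P.eq_of_mem_cell
          ((P.mem_nearOptFinset.1 ha).1.trans (P.mem_nearOptFinset.1 hb).1.symm)
          (mem_evalsIn.1 h1).2 (mem_evalsIn.1 h2).2)
    calc _ ≤ ∑ a ∈ Q H, ∑ s ∈ G.filter (fun s => a <:+ node s ∧ a ≠ node s), (f xs - f (pt s)) :=
          Finset.sum_biUnion_le_sum _ _ hg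
      _ ≤ ∑ a ∈ Q H, (2 * ((P.evalsIn S pt a).card * (νm * ρ' ^ H))
          + (2 * L / (νm * ρ' ^ H) + ν)) := Finset.sum_le_sum h1
      _ = 2 * ((∑ a ∈ Q H, ((P.evalsIn S pt a).card : ℝ)) * (νm * ρ' ^ H))
          + (Q H).card * (2 * L / (νm * ρ' ^ H) + ν) := by
          rw [Finset.sum_add_distrib, Finset.sum_const, nsmul_eq_mul, ← Finset.mul_sum,
            ← Finset.sum_mul]
      _ ≤ _ := by
          gcongr
          exact hQM H le_rfl
  have hA₂ : ∑ s ∈ A₂, (f xs - f (pt s)) ≤ (H + 1) * (M * ν) := by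
    calc _ ≤ ∑ h ∈ Finset.range (H + 1), ∑ s ∈ G.filter (fun s => node s ∈ Q h),
            (f xs - f (pt s)) := Finset.sum_biUnion_le_sum _ _ hg
      _ ≤ ∑ h ∈ Finset.range (H + 1), M * ν := by
          refine Finset.sum_le_sum fun h hh => (hcard _ (Finset.filter_subset _ _)).trans ?_
          gcongr
          refine le_trans ?_ (hQM h (by rw [Finset.mem_range] at hh; omega))
          have := Finset.card_le_card_of_injOn node (s := G.filter fun s => node s ∈ Q h) (t := Q h)
            (fun s hs => (Finset.mem_filter.1 hs).2)
            (hrun.node_injOn.mono fun s hs => hG (Finset.mem_filter.1 hs).1)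
          exact_mod_cast this
      _ = _ := by simp
  have hA₃ : ∑ s ∈ A₃, (f xs - f (pt s))
      ≤ ∑ h ∈ Finset.range H, K * M * (18 * L / (νm * ρ' ^ (h + 1)) + 2 * ν) := by
    refine (Finset.sum_biUnion_le_sum _ _ hg).trans (Finset.sum_le_sum fun h hh => ?_)
    have hCM : ((C h).card : ℝ) ≤ K * M := by
      have h1 : (C h).card ≤ K * (Q h).card :=
        (Finset.card_filter_le _ _).trans (P.card_nearOptChildren_le f xs h _)
      calc ((C h).card : ℝ) ≤ K * (Q h).card := by exact_mod_cast h1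
        _ ≤ _ := by
          gcongr
          exact hQM h (Finset.mem_range.1 hh).le
    have h1 : ∀ c ∈ C h, ∑ s ∈ G.filter (fun s => c <:+ node s), (f xs - f (pt s))
        ≤ 18 * L / (νm * ρ' ^ (h + 1)) + 2 * ν := by
      intro c hc
      obtain ⟨hc1, hcne, hcQ⟩ := Finset.mem_filter.1 hc
      have hl : c.length = h + 1 := by
        obtain ⟨⟨i, b⟩, hb, rfl⟩ := Finset.mem_image.1 hc1
        rw [List.length_cons, (P.mem_nearOptFinset.1 (Finset.mem_product.1 hb).2).1]
      have hsup : sSup (f '' P.cell c) < f xs - 2 * νm * ρ' ^ c.length := by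
        by_contra hcon
        exact hcQ (P.mem_nearOptFinset.2 ⟨rfl, hcne, not_lt.1 hcon⟩)
      have h2 := (hrun.sum_below_le (a := c) (B := G.filter fun s => c <:+ node s ∧ c ≠ node s)
        hmax hν (by positivity) hL ((Finset.filter_subset _ _).trans hG)
        (fun s hs => by
          obtain ⟨h1, h2, h3⟩ := Finset.mem_filter.1 hs
          exact ⟨h2, h3, hgood s h1 c h2 h3⟩)
        (hconc c (Finset.mem_union_right _ (Finset.mem_biUnion.2 ⟨h, hh, hc1⟩)))).2 hcne hsup
      rw [hl] at h2
      have h3 : G.filter (fun s => c <:+ node s) ⊆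
          G.filter (fun s => c <:+ node s ∧ c ≠ node s) ∪ G.filter (fun s => node s = c) := by
        intro s hs
        obtain ⟨hs1, hs2⟩ := Finset.mem_filter.1 hs
        by_cases heq : node s = c
        · exact Finset.mem_union_right _ (Finset.mem_filter.2 ⟨hs1, heq⟩)
        · exact Finset.mem_union_left _ (Finset.mem_filter.2 ⟨hs1, hs2, Ne.symm heq⟩)
      have h4 : ∑ s ∈ G.filter (fun s => node s = c), (f xs - f (pt s)) ≤ ν := by
        refine (hcard _ (Finset.filter_subset _ _)).trans ?_
        have : (G.filter fun s => node s = c).card ≤ 1 := by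
          refine Finset.card_le_one.2 fun s hs t ht => ?_
          obtain ⟨hs1, hs2⟩ := Finset.mem_filter.1 hs
          obtain ⟨ht1, ht2⟩ := Finset.mem_filter.1 ht
          exact hrun.node_injOn (hG hs1) (hG ht1) (hs2.trans ht2.symm)
        have : ((G.filter fun s => node s = c).card : ℝ) ≤ 1 := by exact_mod_cast this
        nlinarith
      have h5 := Finset.sum_union_inter (s₁ := G.filter fun s => c <:+ node s ∧ c ≠ node s)
        (s₂ := G.filter fun s => node s = c) (f := fun s => f xs - f (pt s))
      have h6 : 0 ≤ ∑ s ∈ G.filter (fun s => c <:+ node s ∧ c ≠ node s) ∩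
          G.filter (fun s => node s = c), (f xs - f (pt s)) := Finset.sum_nonneg fun s _ => hg s
      have h7 := Finset.sum_le_sum_of_subset_of_nonneg h3 (f := fun s => f xs - f (pt s))
        fun s _ _ => hg s
      linarith
    calc _ ≤ ∑ c ∈ C h, ∑ s ∈ G.filter (fun s => c <:+ node s), (f xs - f (pt s)) :=
          Finset.sum_biUnion_le_sum _ _ hg
      _ ≤ ∑ c ∈ C h, (18 * L / (νm * ρ' ^ (h + 1)) + 2 * ν) := Finset.sum_le_sum h1
      _ = (C h).card * (18 * L / (νm * ρ' ^ (h + 1)) + 2 * ν) := by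
          rw [Finset.sum_const, nsmul_eq_mul]
      _ ≤ _ := by gcongr
  have hU : ∀ A B : Finset ℕ, ∑ s ∈ A ∪ B, (f xs - f (pt s))
      ≤ ∑ s ∈ A, (f xs - f (pt s)) + ∑ s ∈ B, (f xs - f (pt s)) := by
    intro A B
    have h5 := Finset.sum_union_inter (s₁ := A) (s₂ := B) (f := fun s => f xs - f (pt s))
    have h6 : 0 ≤ ∑ s ∈ A ∩ B, (f xs - f (pt s)) := Finset.sum_nonneg fun s _ => hg s
    linarith
  have h8 := Finset.sum_le_sum_of_subset_of_nonneg hcover (f := fun s => f xs - f (pt s))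
    fun s _ _ => hg s
  linarith [hU (A₁ ∪ A₂) A₃, hU A₁ A₂]

end Total

end HierarchicalPartition

/-! ### Expected regret of one HOO instance -/

theorem sum_card_filter_lt {M : Type*} [AddCommMonoid M] (S : Finset ℕ) (φ : ℕ → M) :
    ∑ s ∈ S, φ (S.filter (· < s)).card = ∑ t ∈ Finset.range S.card, φ t := by
  induction S using Finset.induction_on_max with
  | empty => simp
  | insert a S hS ih =>
    have haS : a ∉ S := fun h => (hS a h).false
    rw [Finset.sum_insert haS, Finset.card_insert_of_notMem haS, Finset.sum_range_succ, ← ih,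
      add_comm]
    congr 1
    · refine Finset.sum_congr rfl fun s hs => ?_
      rw [Finset.filter_insert, if_neg (not_lt.2 (hS s hs).le)]
    · rw [Finset.filter_insert, if_neg (lt_irrefl a), Finset.filter_true_of_mem hS]

theorem exp_neg_four_mul_log {t : ℝ} (ht : 0 < t) : Real.exp (-(4 * Real.log t)) = (t ^ 4)⁻¹ := by
  rw [Real.exp_neg, mul_comm, Real.exp_mul, Real.exp_log ht]
  norm_cast

/-- The terms are `1 / t ^ 2`, compared with a telescoping series; the term `t = 0` vanishes because
of the factor `t`. -/
theorem sum_sq_mul_exp_le (m : ℕ) :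
    ∑ t ∈ Finset.range m, (t : ℝ) * (t * Real.exp (-(4 * Real.log t))) ≤ 2 := by
  have key : ∀ m : ℕ, 1 ≤ m →
      ∑ t ∈ Finset.range (m + 1), (t : ℝ) * (t * Real.exp (-(4 * Real.log t))) ≤ 2 - 1 / m := by
    intro m hm
    induction m, hm using Nat.le_induction with
    | base => norm_num [Finset.sum_range_succ]
    | succ m hm ih =>
      rw [Finset.sum_range_succ]
      have hm0 : (1 : ℝ) ≤ m := by exact_mod_cast hm
      push_cast
      have h1 : ((m : ℝ) + 1) * ((m + 1) * Real.exp (-(4 * Real.log (m + 1)))) = 1 / (m + 1) ^ 2 := by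
        rw [exp_neg_four_mul_log (by linarith)]; field_simp
      rw [h1]
      have h2 : (1 : ℝ) / (m + 1) ^ 2 ≤ 1 / (m * (m + 1)) := by
        apply one_div_le_one_div_of_le <;> nlinarith
      have h3 : (1 : ℝ) / (m * (m + 1)) = 1 / m - 1 / (m + 1) := by field_simp; ring
      linarith
  rcases m with _ | _ | m
  · simp
  · simp
  · have := key (m + 1) (by omega)
    have h : (0 : ℝ) ≤ 1 / ((m + 1 : ℕ) : ℝ) := by positivity
    linarith

namespace IsNoisyEvaluation

section

variable {X Ω : Type*} [MeasurableSpace X] [mΩ : MeasurableSpace Ω] {f : X → ℝ} {μ : Measure Ω}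
  {F : Filtration ℕ mΩ} {x : ℕ → Ω → X} {r : ℕ → Ω → ℝ}

open Classical in
theorem measurableSet_lt_noise (hE : IsNoisyEvaluation f μ F x r) (hf : Measurable f) {A : Set X}
    (hA : MeasurableSet A) (S : Finset ℕ) (L σ : ℝ) :
    MeasurableSet {ω | Real.sqrt (2 * ((S.filter fun s => x s ω ∈ A).card : ℝ) * L) <
      σ * ∑ s ∈ S.filter (fun s => x s ω ∈ A), (r s ω - f (x s ω))} := by
  have hx : ∀ s, MeasurableSet {ω | x s ω ∈ A} := fun s =>
    (hE.point_measurable s).mono (F.le s) le_rfl hA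
  simp only [Finset.card_filter, Finset.sum_filter, Nat.cast_sum]
  refine measurableSet_lt ?_ ?_
  · refine Real.continuous_sqrt.measurable.comp (((Finset.measurable_sum _ fun s _ => ?_).const_mul
      2).mul_const L)
    have : Measurable fun ω => if x s ω ∈ A then (1 : ℕ) else 0 :=
      Measurable.ite (hx s) measurable_const measurable_const
    exact measurable_from_top.comp this
  · refine (Finset.measurable_sum _ fun s _ => Measurable.ite (hx s) ?_ measurable_const).const_mul
      σ
    exact (hE.measurable_noise hf (Nat.lt_succ_self s)).mono (F.le _) le_rfl

/-- The expected regret of an instance of HOO. -/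
theorem integral_sum_regret_le [IsProbabilityMeasure μ] {K : ℕ} {P : HierarchicalPartition X K}
    (hE : IsNoisyEvaluation f μ F x r) (hf : Measurable f) (hP : ∀ u, MeasurableSet (P.cell u))
    {νm ρ' ν M : ℝ} {xs : X} (hmax : ∀ x, f x ≤ f xs) (hν : ∀ x, f xs - ν ≤ f x)
    (hνm : 0 < νm) (hρ' : 0 < ρ') {S : Finset ℕ} (hS : 0 < S.card) {v : ℕ → Ω → List (Fin K)}
    (hrun : ∀ ω, P.IsHOORun νm ρ' S (fun s => v s ω) (fun s => x s ω) (fun s => r s ω))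
    (hsm : ∀ u, xs ∈ P.cell u → ∀ x ∈ P.cell u, f xs - νm * ρ' ^ u.length ≤ f x) {H : ℕ}
    (hM : ∀ h ≤ H, (P.numNearOpt f xs h (2 * νm * ρ' ^ h) : ℝ) ≤ M) :
    ∫ ω, ∑ s ∈ S, (f xs - f (x s ω)) ∂μ ≤
      2 * (S.card * (νm * ρ' ^ H)) + M * (2 * Real.log S.card / (νm * ρ' ^ H) + ν)
      + (H + 1) * (M * ν)
      + ∑ h ∈ Finset.range H, K * M * (18 * Real.log S.card / (νm * ρ' ^ (h + 1)) + 2 * ν)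
      + ν * 2 + ν * (M + H * (K * M)) := by
  classical
  set L := Real.log S.card with hL
  set B := 2 * (S.card * (νm * ρ' ^ H)) + M * (2 * L / (νm * ρ' ^ H) + ν)
      + (H + 1) * (M * ν)
      + ∑ h ∈ Finset.range H, K * M * (18 * L / (νm * ρ' ^ (h + 1)) + 2 * ν) with hB
  have hL0 : 0 ≤ L := Real.log_natCast_nonneg _
  have hM0 : 0 ≤ M := le_trans (Nat.cast_nonneg _) (hM 0 (Nat.zero_le _))
  have hν0 : 0 ≤ ν := by linarith [hν xs]
  have hB0 : 0 ≤ B := by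
    have : 0 ≤ ∑ h ∈ Finset.range H, K * M * (18 * L / (νm * ρ' ^ (h + 1)) + 2 * ν) :=
      Finset.sum_nonneg fun h _ => by positivity
    positivity
  choose o ho hxo using P.exists_mem_cell xs
  set E : Finset ℕ → List (Fin K) → ℝ → ℝ → Set Ω := fun S a L σ =>
    {ω | Real.sqrt (2 * ((P.evalsIn S (fun s => x s ω) a).card : ℝ) * L) <
      σ * ∑ s ∈ P.evalsIn S (fun s => x s ω) a, (r s ω - f (x s ω))} with hEdef
  have hEm : ∀ S a L σ, MeasurableSet (E S a L σ) := fun S a L σ =>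
    hE.measurableSet_lt_noise hf (hP a) S L σ
  have hEp : ∀ S a L σ, 0 ≤ L → σ ^ 2 = 1 → μ.real (E S a L σ) ≤ S.card * Real.exp (-(4 * L)) :=
    fun S a L σ h1 h2 => hE.measureReal_lt_noise_le hf (hP a) S h1 h2
  set T : ℕ → Finset ℕ := fun s => S.filter (· < s) with hT
  have hTS : ∀ s, (T s).card ≤ S.card := fun s => Finset.card_filter_le _ _
  set I : Set Ω → Ω → ℝ := fun A => A.indicator fun _ => 1 with hI
  have hI0 : ∀ A ω, 0 ≤ I A ω := fun A ω => Set.indicator_nonneg (fun _ _ => zero_le_one) ω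
  -- `bad` counts downward deviations on the path to `xs`, with the radius HOO uses at that time;
  -- each failing evaluation costs only its own regret `ν`. `bad'` counts upward deviations at
  -- critical nodes, with the larger radius given by the final `L`; one failure gives up the whole
  -- run, at cost `S.card * ν`.
  set bad : Ω → ℝ := fun ω => ∑ s ∈ S, ∑ h ∈ Finset.range (T s).card,
    I (E (T s) (o h) (Real.log (T s).card) (-1)) ω with hbad
  set bad' : Ω → ℝ := fun ω => ∑ a ∈ P.criticalNodes f xs νm ρ' H, ∑ s ∈ S,
    I (E (T s) a L 1) ω with hbad'
  have hreg : ∀ ω s, 0 ≤ f xs - f (x s ω) ∧ f xs - f (x s ω) ≤ ν := fun ω s =>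
    ⟨by linarith [hmax (x s ω)], by linarith [hν (x s ω)]⟩
  have hpoint : ∀ ω, ∑ s ∈ S, (f xs - f (x s ω)) ≤ B + ν * bad ω + S.card * ν * bad' ω := by
    intro ω
    have hbad0 : 0 ≤ bad ω := Finset.sum_nonneg fun s _ => Finset.sum_nonneg fun h _ => hI0 _ _
    have hbad'0 : 0 ≤ bad' ω := Finset.sum_nonneg fun s _ => Finset.sum_nonneg fun h _ => hI0 _ _
    by_cases hfail : ∃ a ∈ P.criticalNodes f xs νm ρ' H, ∃ s ∈ S, ω ∈ E (T s) a L 1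
    · obtain ⟨a, ha, s, hs, hω⟩ := hfail
      have h1 : 1 ≤ bad' ω := by
        calc (1 : ℝ) = I (E (T s) a L 1) ω := by rw [hI]; simp only [Set.indicator_of_mem hω]
          _ ≤ ∑ s ∈ S, I (E (T s) a L 1) ω :=
            Finset.single_le_sum (f := fun s => I (E (T s) a L 1) ω) (fun s _ => hI0 _ _) hs
          _ ≤ _ := Finset.single_le_sum (f := fun a => ∑ s ∈ S, I (E (T s) a L 1) ω)
            (fun a _ => Finset.sum_nonneg fun s _ => hI0 _ _) ha
      have h2 : ∑ s ∈ S, (f xs - f (x s ω)) ≤ S.card * ν := by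
        rw [← nsmul_eq_mul]
        exact Finset.sum_le_card_nsmul _ _ _ fun s _ => (hreg ω s).2
      have h3 : S.card * ν * 1 ≤ S.card * ν * bad' ω := by gcongr
      have h4 : 0 ≤ ν * bad ω := by positivity
      linarith
    · push Not at hfail
      set G := S.filter fun s => ∀ h < (T s).card, ω ∉ E (T s) (o h) (Real.log (T s).card) (-1)
        with hG
      have h1 : ∑ s ∈ G, (f xs - f (x s ω)) ≤ B := by
        refine (hrun ω).sum_regret_le_of_good hmax hν hνm hρ' le_rfl hM (Finset.filter_subset _ _)
          (fun s hs a ha hne => ?_) (fun a ha s hs => ?_)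
        · obtain ⟨hsS, hsG⟩ := Finset.mem_filter.1 hs
          refine ((hrun ω) s hsS).1.le_hooU (xs := xs) (fun s₀ hs₀ hxs₀ => ?_) ha hne
          obtain ⟨hs₀S, hlt⟩ := Finset.mem_filter.1 hs₀
          have hs₀s : (T s₀).card < (T s).card := by
            apply Finset.card_lt_card
            refine Finset.ssubset_iff_subset_ne.2 ⟨fun b hb => ?_, fun heq => ?_⟩
            · rw [Finset.mem_filter] at hb ⊢
              exact ⟨hb.1, hb.2.trans hlt⟩
            · have : s₀ ∈ T s₀ := by rw [heq]; exact hs₀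
              simp [hT] at this
          have hlen := ((hrun ω).length_node_le hs₀S).trans_lt hs₀s
          have heq : o (v s₀ ω).length = v s₀ ω := P.eq_of_mem_cell (ho _) (hxo _) hxs₀
          have hns := hsG _ hlen
          rw [heq, hEdef, Set.notMem_ofPred_iff] at hns
          refine HierarchicalPartition.le_hooU_of_noise ?_ (hsm _ hxs₀) ?_
          · exact Finset.card_pos.2 ⟨s₀, HierarchicalPartition.mem_evalsIn.2
              ⟨hs₀, ((hrun ω) s₀ hs₀S).2⟩⟩
          · have := not_lt.1 hns
            rwa [neg_one_mul] at this
        · have h2 := hfail a ha s hs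
          rw [hEdef, Set.notMem_ofPred_iff] at h2
          have := not_lt.1 h2
          rwa [one_mul] at this
      have h2 : ∑ s ∈ S.filter (fun s => ¬ ∀ h < (T s).card,
          ω ∉ E (T s) (o h) (Real.log (T s).card) (-1)), (f xs - f (x s ω)) ≤ ν * bad ω := by
        rw [hbad, Finset.mul_sum]
        refine le_trans (Finset.sum_le_sum fun s hs => ?_) (Finset.sum_le_sum_of_subset_of_nonneg
          (Finset.filter_subset _ _) fun s _ _ =>
            mul_nonneg hν0 (Finset.sum_nonneg fun h _ => hI0 _ _))
        obtain ⟨hsS, hsb⟩ := Finset.mem_filter.1 hs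
        push Not at hsb
        obtain ⟨h, hh, hω⟩ := hsb
        have h3 : 1 ≤ ∑ h ∈ Finset.range (T s).card,
            I (E (T s) (o h) (Real.log (T s).card) (-1)) ω := by
          calc (1 : ℝ) = I (E (T s) (o h) (Real.log (T s).card) (-1)) ω := by
                rw [hI]; simp only [Set.indicator_of_mem hω]
            _ ≤ _ := Finset.single_le_sum
              (f := fun h => I (E (T s) (o h) (Real.log (T s).card) (-1)) ω)
              (fun s _ => hI0 _ _) (Finset.mem_range.2 hh)
        calc _ ≤ ν * 1 := by rw [mul_one]; exact (hreg ω s).2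
          _ ≤ _ := by gcongr
      have h3 := Finset.sum_filter_add_sum_filter_not S (fun s => ∀ h < (T s).card,
          ω ∉ E (T s) (o h) (Real.log (T s).card) (-1)) (fun s => f xs - f (x s ω))
      have h4 : 0 ≤ S.card * ν * bad' ω := by positivity
      linarith
  have hIint : ∀ S a L σ, Integrable (I (E S a L σ)) μ := fun S a L σ =>
    (integrable_const 1).indicator (hEm S a L σ)
  have hIval : ∀ S a L σ, ∫ ω, I (E S a L σ) ω ∂μ = μ.real (E S a L σ) := fun S a L σ =>
    integral_indicator_one (hEm S a L σ)
  have hbi : Integrable bad μ := integrable_finsetSum _ fun s _ => integrable_finsetSum _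
    fun h _ => hIint _ _ _ _
  have hbi' : Integrable bad' μ := integrable_finsetSum _ fun s _ => integrable_finsetSum _
    fun h _ => hIint _ _ _ _
  have hbv : ∫ ω, bad ω ∂μ ≤ 2 := by
    rw [hbad, integral_finsetSum _ fun s _ => integrable_finsetSum _ fun h _ => hIint _ _ _ _]
    calc _ ≤ ∑ s ∈ S, ((T s).card : ℝ) * ((T s).card * Real.exp (-(4 * Real.log (T s).card))) := by
          refine Finset.sum_le_sum fun s _ => ?_
          rw [integral_finsetSum _ fun h _ => hIint _ _ _ _]
          calc _ ≤ ∑ h ∈ Finset.range (T s).card,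
                ((T s).card * Real.exp (-(4 * Real.log (T s).card))) := by
                refine Finset.sum_le_sum fun h _ => ?_
                rw [hIval]
                exact hEp _ _ _ _ (Real.log_natCast_nonneg _) (by norm_num)
            _ = _ := by simp
      _ = ∑ t ∈ Finset.range S.card, (t : ℝ) * (t * Real.exp (-(4 * Real.log t))) :=
          sum_card_filter_lt S fun t => (t : ℝ) * (t * Real.exp (-(4 * Real.log t)))
      _ ≤ 2 := sum_sq_mul_exp_le _
  -- Run length, number of times, and possible counts give the factor `S.card ^ 3`, against the
  -- probability `S.card ^ (-4)`.
  have hbv' : S.card * ∫ ω, bad' ω ∂μ ≤ M + H * (K * M) := by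
    refine le_trans ?_ (P.card_criticalNodes_le f xs νm ρ' H hM)
    have hS1 : (1 : ℝ) ≤ S.card := by exact_mod_cast hS
    rw [hbad', integral_finsetSum _ fun s _ => integrable_finsetSum _ fun h _ => hIint _ _ _ _]
    calc _ ≤ S.card * ∑ a ∈ P.criticalNodes f xs νm ρ' H, ((S.card : ℝ) *
          (S.card * Real.exp (-(4 * L)))) := by
          gcongr with a ha
          rw [integral_finsetSum _ fun h _ => hIint _ _ _ _]
          calc _ ≤ ∑ s ∈ S, (S.card * Real.exp (-(4 * L))) := by
                refine Finset.sum_le_sum fun s _ => ?_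
                rw [hIval]
                refine (hEp _ _ _ _ hL0 (by norm_num)).trans ?_
                gcongr
                exact Finset.filter_subset _ _
            _ = _ := by simp
      _ = (P.criticalNodes f xs νm ρ' H).card * (1 / S.card) := by
          rw [hL, exp_neg_four_mul_log (by linarith)]
          simp only [Finset.sum_const, nsmul_eq_mul]
          field_simp
      _ ≤ (P.criticalNodes f xs νm ρ' H).card * 1 := by
          gcongr
          rw [div_le_one (by linarith)]
          exact hS1
      _ = _ := mul_one _
  calc ∫ ω, ∑ s ∈ S, (f xs - f (x s ω)) ∂μ
      ≤ ∫ ω, (B + ν * bad ω + S.card * ν * bad' ω) ∂μ := by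
        refine integral_mono (integrable_finsetSum _ fun s _ =>
          (integrable_const _).sub (hE.integrable_comp s)) ?_ hpoint
        exact ((integrable_const _).add (hbi.const_mul _)).add (hbi'.const_mul _)
    _ = B + ν * ∫ ω, bad ω ∂μ + ν * (S.card * ∫ ω, bad' ω ∂μ) := by
        have h1 : Integrable (fun ω => B + ν * bad ω) μ :=
          (integrable_const _).add (hbi.const_mul _)
        rw [integral_add h1 (hbi'.const_mul _), integral_add (integrable_const _) (hbi.const_mul _),
          integral_const_mul, integral_const_mul]
        simp
        ring
    _ ≤ _ := by gcongr

end

end IsNoisyEvaluation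

/-! ### From the regret of the instances to the regret of the output -/

namespace IsPOORun

section

variable {X Ω : Type*} {K : ℕ} [MeasurableSpace X] [mΩ : MeasurableSpace Ω]
  {P : HierarchicalPartition X K} {νmax ρmax : ℝ} {μ : Measure Ω} {F : Filtration ℕ mΩ}
  {x : ℕ → Ω → X} {r : ℕ → Ω → ℝ} {v : ℕ → Ω → List (Fin K)} {best out : ℕ → Ω → ℕ}
  {f : X → ℝ} {xs : X}

theorem isHOORun (hR : IsPOORun P νmax ρmax μ F x r v best out) (i t : ℕ) (ω : Ω) :
    P.IsHOORun νmax (pooRho ρmax i) (pooEvals (pooDmax K ρmax) i t) (fun s => v s ω)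
      (fun s => x s ω) (fun s => r s ω) := by
  intro s hs
  obtain ⟨hst, rfl⟩ := Finset.mem_filter.1 hs
  rw [filter_lt_pooEvals (Finset.mem_range.1 hst).le]
  exact ⟨hR.node_selected s ω, hR.point_mem s ω⟩

/-- The output point does as well on average as the points evaluated by the best instance. -/
theorem integral_simpleRegret_eq [IsProbabilityMeasure μ]
    (hR : IsPOORun P νmax ρmax μ F x r v best out) (hE : IsNoisyEvaluation f μ F x r)
    (hf : Measurable f) {ν : ℝ} (hmax : ∀ x, f x ≤ f xs) (hν : ∀ x, f xs - ν ≤ f x) {T : ℕ}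
    (hT : 1 ≤ T) :
    Integrable (simpleRegret f x out T) μ ∧
    Integrable (fun ω => (∑ s ∈ pooEvals (pooDmax K ρmax) (best T ω)
      (pooTotal (pooDmax K ρmax) (pooPhase (pooDmax K ρmax) T)), (f xs - f (x s ω)))
        / ((pooState (pooDmax K ρmax) (pooPhase (pooDmax K ρmax) T)).2 : ℝ)) μ ∧
    ∫ ω, simpleRegret f x out T ω ∂μ = ∫ ω, (∑ s ∈ pooEvals (pooDmax K ρmax) (best T ω)
      (pooTotal (pooDmax K ρmax) (pooPhase (pooDmax K ρmax) T)), (f xs - f (x s ω)))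
        / ((pooState (pooDmax K ρmax) (pooPhase (pooDmax K ρmax) T)).2 : ℝ) ∂μ := by
  classical
  set D := pooDmax K ρmax
  set k := pooPhase D T with hk
  set m := (pooState D k).2 with hm
  have hm0 : 0 < m := by
    refine pooState_snd_pos D (le_pooPhase ?_)
    rw [show pooTotal D 1 = 1 by simp [pooTotal, pooState]]
    exact hT
  have hkT : pooTotal D k ≤ T := pooTotal_phase_le D T
  set I : ℕ → Ω → ℝ := fun s => Set.indicator {ω | out T ω = s} (fun _ => (1 : ℝ)) with hI
  set J : ℕ → Ω → ℝ := fun s ω =>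
    if s ∈ pooEvals D (best T ω) (pooTotal D k) then 1 / (m : ℝ) else 0 with hJ
  have hIJ : ∀ s, μ[I s | F T] =ᵐ[μ] J s := fun s => hR.out_uniform T hT s
  have hIm : ∀ s, MeasurableSet {ω | out T ω = s} := fun s =>
    hR.out_measurable T (measurableSet_singleton s)
  have hIi : ∀ s, Integrable (I s) μ := fun s => (integrable_const 1).indicator (hIm s)
  have hJi : ∀ s, Integrable (J s) μ := fun s => integrable_condExp.congr (hIJ s)
  have hIJint : ∀ s, ∫ ω, I s ω ∂μ = ∫ ω, J s ω ∂μ := fun s => by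
    rw [← integral_condExp (F.le T), integral_congr_ae (hIJ s)]
  have hsubT : ∀ i, pooEvals D i (pooTotal D k) ⊆ Finset.range T := fun i s hs =>
    Finset.mem_range.2 ((Finset.mem_range.1 (Finset.mem_filter.1 hs).1).trans_le hkT)
  have hJsum : ∀ (g : ℕ → ℝ) ω, ∑ s ∈ Finset.range T, g s * J s ω
      = (∑ s ∈ pooEvals D (best T ω) (pooTotal D k), g s) / m := by
    intro g ω
    rw [Finset.sum_div, ← Finset.sum_subset (hsubT (best T ω))]
    · exact Finset.sum_congr rfl fun s hs => by simp [hJ, hs]; ring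
    · intro s _ hs
      simp [hJ, hs]
  have hcard : ∀ ω, (pooEvals D (best T ω) (pooTotal D k)).card = m := fun ω =>
    card_pooEvals D k (hR.best_lt T ω)
  -- The conditional law of `out T` has `m` atoms of mass `1 / m`, all below `T`, hence total mass
  -- one there. Points with labels below `T` are known given `F T`, so indicators can be replaced by
  -- their conditional expectations.
  have hout : ∀ᵐ ω ∂μ, out T ω ∈ Finset.range T := by
    have h1 : ∫ ω, (1 - ∑ s ∈ Finset.range T, I s ω) ∂μ = 0 := by
      rw [integral_sub (integrable_const 1) (integrable_finsetSum _ fun s _ => hIi s),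
        integral_finsetSum _ fun s _ => hIi s, Finset.sum_congr rfl fun s _ => hIJint s,
        ← integral_finsetSum _ fun s _ => hJi s]
      have h2 : ∀ ω, ∑ s ∈ Finset.range T, J s ω = 1 := by
        intro ω
        have := hJsum (fun _ => 1) ω
        simp only [one_mul, Finset.sum_const, nsmul_eq_mul, mul_one, hcard] at this
        rw [this, div_self (by positivity)]
      simp [h2]
    have h3 : ∀ ω, 0 ≤ 1 - ∑ s ∈ Finset.range T, I s ω ∧
        (out T ω ∉ Finset.range T → 1 - ∑ s ∈ Finset.range T, I s ω = 1) := by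
      intro ω
      have h4 : ∑ s ∈ Finset.range T, I s ω = if out T ω ∈ Finset.range T then 1 else 0 := by
        simp only [hI, Set.indicator_apply, Set.mem_ofPred_eq]
        exact Finset.sum_ite_eq _ _ _
      rw [h4]
      split_ifs <;> simp_all
    have h5 := (integral_eq_zero_iff_of_nonneg (fun ω => (h3 ω).1)
      ((integrable_const 1).sub (integrable_finsetSum _ fun s _ => hIi s))).1 h1
    filter_upwards [h5] with ω hω
    by_contra hcon
    have h6 := (h3 ω).2 hcon
    rw [hω] at h6
    simp at h6
  have hsup : ⨆ y, f y = f xs := by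
    have : Nonempty X := ⟨xs⟩
    exact le_antisymm (ciSup_le hmax) (le_ciSup ⟨f xs, by rintro _ ⟨y, rfl⟩; exact hmax y⟩ xs)
  have hΔm : ∀ s ∈ Finset.range T, StronglyMeasurable[F T] fun ω => f xs - f (x s ω) :=
    fun s hs => (measurable_const.sub (hf.comp ((hE.point_measurable s).mono
      (F.mono (Finset.mem_range.1 hs).le) le_rfl))).stronglyMeasurable
  have hΔb : ∀ s, ∀ᵐ ω ∂μ, ‖f xs - f (x s ω)‖ ≤ ν := fun s => Filter.Eventually.of_forall fun ω => by
    rw [Real.norm_eq_abs, abs_of_nonneg (by linarith [hmax (x s ω)])]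
    linarith [hν (x s ω)]
  have hΔI : ∀ s ∈ Finset.range T, Integrable (fun ω => (f xs - f (x s ω)) * I s ω) μ :=
    fun s hs => (hIi s).bdd_mul ((hΔm s hs).mono (F.le T)).aestronglyMeasurable (hΔb s)
  have hΔJ : ∀ s ∈ Finset.range T, Integrable (fun ω => (f xs - f (x s ω)) * J s ω) μ :=
    fun s hs => (hJi s).bdd_mul ((hΔm s hs).mono (F.le T)).aestronglyMeasurable (hΔb s)
  have hreg : simpleRegret f x out T =ᵐ[μ] fun ω =>
      ∑ s ∈ Finset.range T, (f xs - f (x s ω)) * I s ω := by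
    filter_upwards [hout] with ω hω
    rw [simpleRegret, hsup]
    simp only [hI, Set.indicator_apply, Set.mem_ofPred_eq, mul_ite, mul_one, mul_zero]
    rw [Finset.sum_ite_eq, if_pos hω]
  have hswap : ∀ s ∈ Finset.range T, ∫ ω, (f xs - f (x s ω)) * I s ω ∂μ
      = ∫ ω, (f xs - f (x s ω)) * J s ω ∂μ := by
    intro s hs
    rw [← integral_condExp (F.le T)]
    apply integral_congr_ae
    filter_upwards [condExp_mul_of_stronglyMeasurable_left (hΔm s hs) (hΔI s hs) (hIi s), hIJ s]
      with ω h1 h2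
    rw [← h2]
    exact h1
  refine ⟨(integrable_finsetSum _ hΔI).congr hreg.symm, ?_, ?_⟩
  · refine (integrable_finsetSum _ hΔJ).congr (Filter.Eventually.of_forall fun ω => ?_)
    exact hJsum (fun s => f xs - f (x s ω)) ω
  · rw [integral_congr_ae hreg, integral_finsetSum _ hΔI, Finset.sum_congr rfl hswap,
      ← integral_finsetSum _ hΔJ]
    exact integral_congr_ae (Filter.Eventually.of_forall fun ω =>
      hJsum (fun s => f xs - f (x s ω)) ω)

/-- The simple regret of POO is at most the average regret of any of its instances, up to the error
in the comparison of the instances. -/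
theorem integral_simpleRegret_le [IsProbabilityMeasure μ]
    (hR : IsPOORun P νmax ρmax μ F x r v best out) (hE : IsNoisyEvaluation f μ F x r)
    (hf : Measurable f) {ν : ℝ} (hmax : ∀ x, f x ≤ f xs) (hν : ∀ x, f xs - ν ≤ f x) {T N m : ℕ}
    (hT : 1 ≤ T) (hNm : pooState (pooDmax K ρmax) (pooPhase (pooDmax K ρmax) T) = (N, m)) {i : ℕ}
    (hi : i < N) :
    ∫ ω, simpleRegret f x out T ω ∂μ ≤
      (∫ ω, ∑ s ∈ pooEvals (pooDmax K ρmax) i (N * m), (f xs - f (x s ω)) ∂μ) / m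
        + Real.sqrt (N / m) := by
  obtain ⟨-, hint, heq⟩ := hR.integral_simpleRegret_eq hE hf hmax hν hT
  rw [heq]
  have hbest := hR.best_max T
  have hbl := hR.best_lt T
  set D := pooDmax K ρmax with hD
  set k := pooPhase D T with hk
  have htot : pooTotal D k = N * m := by rw [pooTotal, hNm]
  have hm0 : 0 < m := by
    have := pooState_snd_pos D (k := k) (le_pooPhase (by
      rw [show pooTotal D 1 = 1 by simp [pooTotal, pooState]]
      exact hT))
    rwa [hNm] at this
  have hN0 : 0 < N := by omega
  have hcard : ∀ j < N, (pooEvals D j (N * m)).card = m := by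
    intro j hj
    have := card_pooEvals D k (i := j) (by rw [hNm]; exact hj)
    rwa [htot, hNm] at this
  simp only [pooMean, htot, hNm, ← hk] at hint hbest hbl ⊢
  set A : ℕ → Finset ℕ := fun j => pooEvals D j (N * m) with hA
  set η : ℕ → Ω → ℝ := fun j ω => (∑ s ∈ A j, (r s ω - f (x s ω))) / m with hη
  have hm0' : (0 : ℝ) < m := by exact_mod_cast hm0
  have hN0' : (0 : ℝ) < N := by exact_mod_cast hN0
  -- `best T` depends on the noise, so its error is bounded by `η ≤ c / 2 * η ^ 2 + 1 / (2 * c)` and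
  -- the square by the sum over all instances. This `c` balances the two terms.
  set c : ℝ := Real.sqrt (m / N) with hc
  have hc0 : 0 < c := Real.sqrt_pos.2 (by positivity)
  have hc2 : c ^ 2 = m / N := Real.sq_sqrt (by positivity)
  have hηsq : ∀ j ω, η j ω ^ 2 = (1 / (m : ℝ) ^ 2) * (∑ s ∈ A j, (r s ω - f (x s ω))) ^ 2 := by
    intro j ω; simp only [hη]; ring
  have hηi : ∀ j, Integrable (fun ω => η j ω ^ 2) μ := by
    intro j
    simp only [hηsq]
    exact (hE.integrable_sum_noise_sq (A j)).const_mul _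
  have hηv : ∀ j < N, ∫ ω, η j ω ^ 2 ∂μ ≤ 1 / m := by
    intro j hj
    simp only [hηsq]
    rw [integral_const_mul]
    calc _ ≤ 1 / (m : ℝ) ^ 2 * (A j).card := by
          gcongr
          exact hE.integral_sum_noise_sq_le hf (A j)
      _ = _ := by rw [hA, hcard j hj]; field_simp
  have hη1 : ∀ j, Integrable (η j) μ := fun j =>
    (integrable_finsetSum _ fun s _ => hE.integrable_noise s).div_const _
  have hη0 : ∀ j, ∫ ω, η j ω ∂μ = 0 := by
    intro j
    simp only [hη]
    rw [integral_div, integral_finsetSum _ fun s _ => hE.integrable_noise s,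
      Finset.sum_eq_zero, zero_div]
    intro s _
    have := hE.integral_mul_noise (t := s) (Z := fun _ => 1) measurable_const 1
      (Filter.Eventually.of_forall fun _ => by simp)
    simpa using this
  have hΔi : Integrable (fun ω => (∑ s ∈ A i, (f xs - f (x s ω))) / m) μ :=
    (integrable_finsetSum _ fun s _ => (integrable_const _).sub (hE.integrable_comp s)).div_const _
  have hpoint : ∀ ω, (∑ s ∈ A (best T ω), (f xs - f (x s ω))) / m ≤
      (∑ s ∈ A i, (f xs - f (x s ω))) / m - η i ω
        + (c / 2 * ∑ j ∈ Finset.range N, η j ω ^ 2 + 1 / (2 * c)) := by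
    intro ω
    have hsplit : ∀ j < N, (∑ s ∈ A j, (f xs - f (x s ω))) / m
        = f xs - (∑ s ∈ A j, r s ω) / m + η j ω := by
      intro j hj
      simp only [hη, Finset.sum_sub_distrib, Finset.sum_const, nsmul_eq_mul, hA, hcard j hj]
      field_simp
      ring
    rw [hsplit _ hi, hsplit _ (hbl ω)]
    have h1 := hbest ω i hi
    have h2 : η (best T ω) ω ^ 2 ≤ ∑ j ∈ Finset.range N, η j ω ^ 2 :=
      Finset.single_le_sum (f := fun j => η j ω ^ 2) (fun j _ => sq_nonneg _)
        (Finset.mem_range.2 (hbl ω))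
    have h3 : η (best T ω) ω ≤ c / 2 * η (best T ω) ω ^ 2 + 1 / (2 * c) := by
      have h4 : c / 2 * η (best T ω) ω ^ 2 + 1 / (2 * c) - η (best T ω) ω
          = (c * η (best T ω) ω - 1) ^ 2 / (2 * c) := by field_simp; ring
      have : 0 ≤ (c * η (best T ω) ω - 1) ^ 2 / (2 * c) := by positivity
      linarith
    have h5 : c / 2 * η (best T ω) ω ^ 2 ≤ c / 2 * ∑ j ∈ Finset.range N, η j ω ^ 2 := by gcongr
    have h6 : (∑ s ∈ A i, r s ω) / m ≤ (∑ s ∈ A (best T ω), r s ω) / (m : ℝ) := h1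
    linarith
  have hsi : Integrable (fun ω => ∑ j ∈ Finset.range N, η j ω ^ 2) μ :=
    integrable_finsetSum _ fun j _ => hηi j
  have hi1 : Integrable (fun ω => (∑ s ∈ A i, (f xs - f (x s ω))) / m - η i ω) μ :=
    hΔi.sub (hη1 i)
  have hi2 : Integrable (fun ω => c / 2 * ∑ j ∈ Finset.range N, η j ω ^ 2 + 1 / (2 * c)) μ :=
    (hsi.const_mul _).add (integrable_const _)
  calc _ ≤ ∫ ω, ((∑ s ∈ A i, (f xs - f (x s ω))) / m - η i ω
        + (c / 2 * ∑ j ∈ Finset.range N, η j ω ^ 2 + 1 / (2 * c))) ∂μ :=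
        integral_mono hint (hi1.add hi2) hpoint
    _ = (∫ ω, ∑ s ∈ A i, (f xs - f (x s ω)) ∂μ) / m
        + (c / 2 * ∑ j ∈ Finset.range N, ∫ ω, η j ω ^ 2 ∂μ + 1 / (2 * c)) := by
        rw [integral_add hi1 hi2, integral_sub hΔi (hη1 i), hη0, sub_zero, integral_div,
          integral_add (hsi.const_mul _) (integrable_const _), integral_const_mul,
          integral_finsetSum _ fun j _ => hηi j]
        simp
    _ ≤ (∫ ω, ∑ s ∈ A i, (f xs - f (x s ω)) ∂μ) / m
        + (c / 2 * ∑ j ∈ Finset.range N, 1 / (m : ℝ) + 1 / (2 * c)) := by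
        gcongr with j hj
        exact hηv j (Finset.mem_range.1 hj)
    _ = _ := by
        congr 1
        rw [Finset.sum_const, Finset.card_range, nsmul_eq_mul]
        have h7 : Real.sqrt (N / m) = 1 / c := by
          rw [hc, ← Real.sqrt_one, ← Real.sqrt_div zero_le_one]
          congr 1
          field_simp
        rw [h7]
        have h8 : (N : ℝ) * (1 / m) = 1 / c ^ 2 := by rw [hc2]; field_simp
        rw [h8]
        field_simp
        norm_num

end

end IsPOORun

/-! ### Estimates for the final bound -/

theorem sum_inv_pow_le {ρ' : ℝ} (h0 : 0 < ρ') (h1 : ρ' < 1) (H : ℕ) :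
    ∑ h ∈ Finset.range H, 1 / ρ' ^ (h + 1) ≤ 1 / (ρ' ^ H * (1 - ρ')) := by
  have h2 : 0 < 1 - ρ' := by linarith
  induction H with
  | zero =>
    simp only [Finset.range_zero, Finset.sum_empty]
    positivity
  | succ H ih =>
    rw [Finset.sum_range_succ]
    calc _ ≤ 1 / (ρ' ^ H * (1 - ρ')) + 1 / ρ' ^ (H + 1) := by gcongr
      _ = _ := by field_simp; ring

/-- Everything except the discretization error is absorbed into a multiple of `M * (τ / η)`: since
`η ≤ ν` and `1 / 2 ≤ τ`, even `ν` is a multiple of `τ / η`. The constant involves `ρ₀` and not `ρ'`,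
so it is uniform over the grid. -/
theorem hoo_bound_le {K m : ℝ} (hK : 0 ≤ K) (hm : 0 ≤ m) {νm ρ' ν L M η ρ ρ₀ τ c : ℝ} {H : ℕ}
    (hη : 0 < η) (hην : η ≤ ν) (hρ' : 0 < ρ') (hρ₀ : ρ' ≤ ρ₀) (hρ₁ : ρ₀ < 1)
    (hνm : 0 < νm) (hlow : η ≤ νm * ρ' ^ H) (hup : νm * ρ' ^ H ≤ η / ρ) (hM : 1 ≤ M)
    (hτ : 1 / 2 ≤ τ) (hL : 0 ≤ L) (hLτ : L ≤ τ) (hH : (H : ℝ) ≤ c * τ) :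
    2 * (m * (νm * ρ' ^ H)) + M * (2 * L / (νm * ρ' ^ H) + ν) + (H + 1) * (M * ν)
      + ∑ h ∈ Finset.range H, K * M * (18 * L / (νm * ρ' ^ (h + 1)) + 2 * ν)
      + ν * 2 + ν * (M + H * (K * M))
    ≤ 2 * m * η / ρ
      + (2 + 10 * ν ^ 2 + c * ν ^ 2 + K * (18 / (1 - ρ₀) + 3 * ν ^ 2 * c)) * M * (τ / η) := by
  have hν : 0 < ν := hη.trans_le hην
  set u := τ / η with hu
  have hu0 : 0 < u := by positivity
  have h1 : ν ≤ 2 * ν ^ 2 * u := by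
    rw [hu, mul_div_assoc', le_div_iff₀ hη]
    nlinarith [mul_pos hν hν]
  have h2 : ν * H ≤ c * ν ^ 2 * u := by
    have h3 : ν * H ≤ ν * (c * τ) := by gcongr
    have hcτ : 0 ≤ c * τ := le_trans (Nat.cast_nonneg _) hH
    rw [hu, mul_div_assoc', le_div_iff₀ hη]
    have h4 : ν * H * η ≤ ν * (c * τ) * ν := by gcongr
    linarith
  have h3 : L / (νm * ρ' ^ H) ≤ u := by rw [hu]; gcongr
  have h4 : ∑ h ∈ Finset.range H, K * M * (18 * L / (νm * ρ' ^ (h + 1)) + 2 * ν)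
      = K * M * (18 * (L / νm * ∑ h ∈ Finset.range H, 1 / ρ' ^ (h + 1)) + 2 * (ν * H)) := by
    rw [← Finset.mul_sum, Finset.sum_add_distrib, Finset.sum_const, Finset.card_range,
      nsmul_eq_mul, Finset.mul_sum, Finset.mul_sum]
    congr 2
    · exact Finset.sum_congr rfl fun h _ => by field_simp
    · ring
  have h5 : L / νm * ∑ h ∈ Finset.range H, 1 / ρ' ^ (h + 1) ≤ u / (1 - ρ₀) := by
    have h6 : 0 < 1 - ρ₀ := by linarith
    calc _ ≤ L / νm * (1 / (ρ' ^ H * (1 - ρ'))) := by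
          gcongr
          exact sum_inv_pow_le hρ' (by linarith) H
      _ ≤ L / νm * (1 / (ρ' ^ H * (1 - ρ₀))) := by gcongr
      _ = L / (νm * ρ' ^ H) / (1 - ρ₀) := by field_simp
      _ ≤ _ := by gcongr
  have h7 : m * (νm * ρ' ^ H) ≤ m * (η / ρ) := by gcongr
  have hM0 : 0 < M := by linarith
  rw [h4]
  calc _ = 2 * (m * (νm * ρ' ^ H)) + M * (2 * (L / (νm * ρ' ^ H)) + 3 * ν + ν * H)
        + K * M * (18 * (L / νm * ∑ h ∈ Finset.range H, 1 / ρ' ^ (h + 1)) + 3 * (ν * H))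
        + 2 * ν * 1 := by ring
    _ ≤ 2 * (m * (η / ρ)) + M * (2 * u + 3 * (2 * ν ^ 2 * u) + c * ν ^ 2 * u)
        + K * M * (18 * (u / (1 - ρ₀)) + 3 * (c * ν ^ 2 * u))
        + 2 * (2 * ν ^ 2 * u) * M := by gcongr
    _ = _ := by ring

/-- Some parameter of the grid is at most slightly larger than `ρ`. -/
theorem exists_grid_index {q qm lK : ℝ} {N : ℕ} {l : ℝ} (hqm : 0 < qm) (hq : qm ≤ q)
    (hlK : 0 < lK) (hl : 1 ≤ l) (hN : lK / qm / 4 * l ≤ N) :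
    ∃ j : ℕ, 1 ≤ j ∧ j ≤ N ∧ (N / j : ℝ) * qm ≤ q ∧ 1 - (N / j : ℝ) * qm / q ≤ 4 * q / (lK * l) ∧
      q * (lK / 4) / (lK / 4 + q) ≤ (N / j : ℝ) * qm := by
  have hq0 : 0 < q := hqm.trans_le hq
  have hy : lK / 4 * l ≤ N * qm := by
    have := mul_le_mul_of_nonneg_right hN hqm.le
    calc lK / 4 * l = lK / qm / 4 * l * qm := by field_simp
      _ ≤ _ := this
  have hy0 : 0 < N * qm := lt_of_lt_of_le (by positivity) hy
  have hj1 : 1 ≤ ⌈N * qm / q⌉₊ := Nat.one_le_ceil_iff.2 (by positivity)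
  -- Rounding up makes the grid parameter at least `ρ`, the side on which smoothness persists. The
  -- last bound keeps this parameter away from one uniformly in `ρmax`.
  refine ⟨⌈N * qm / q⌉₊, hj1, ?_, ?_, ?_, ?_⟩
  · apply Nat.ceil_le.2
    rw [div_le_iff₀ hq0]
    gcongr
  all_goals
    have hj0 : (0 : ℝ) < ⌈N * qm / q⌉₊ := by exact_mod_cast hj1
    have hle := Nat.le_ceil (N * qm / q)
    have hlt := Nat.ceil_lt_add_one (show 0 ≤ N * qm / q by positivity)
    set j : ℝ := (⌈N * qm / q⌉₊ : ℝ)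
  · rw [div_mul_eq_mul_div, div_le_iff₀ hj0]
    rw [div_le_iff₀ hq0] at hle
    linarith
  all_goals
    have hge : q * (N * qm) / (N * qm + q) ≤ N / j * qm := by
      rw [div_mul_eq_mul_div, div_le_div_iff₀ (by positivity) hj0]
      have h1 : q * j ≤ N * qm + q := by
        have := mul_le_mul_of_nonneg_left hlt.le hq0.le
        calc q * j ≤ q * (N * qm / q + 1) := this
          _ = _ := by field_simp
      nlinarith
  · have h2 : 1 - q * (N * qm) / (N * qm + q) / q ≤ 4 * q / (lK * l) := by
      calc _ = q / (N * qm + q) := by field_simp; ring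
        _ ≤ q / (lK / 4 * l) := by gcongr; linarith
        _ = _ := by field_simp
    have h3 : q * (N * qm) / (N * qm + q) / q ≤ N / j * qm / q := by gcongr
    linarith
  · refine le_trans ?_ hge
    rw [div_le_div_iff₀ (by positivity) (by positivity)]
    have h3 : lK / 4 ≤ N * qm := le_trans (by nlinarith) hy
    nlinarith [mul_le_mul_of_nonneg_left h3 (sq_nonneg q)]

/-- `ln² T / T ≤ 1` and `1 / (d + 2) ≤ 1 / 2`, so the parametric term `ln T / √T` is never larger
than the rate. -/
theorem rate_bounds {T : ℝ} (hT : 2 ≤ T) {d : ℝ} (hd : 0 ≤ d) :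
    Real.log T / Real.sqrt T ≤ (Real.log T ^ 2 / T) ^ (1 / (d + 2)) ∧
    ((Real.log T ^ 2 / T) ^ (1 / (d + 2))) ^ (d + 2) = Real.log T ^ 2 / T := by
  have hl : 0 < Real.log T := Real.log_pos (by linarith)
  have h1 : Real.log T ≤ Real.sqrt T := by
    have h := Real.log_le_sub_one_of_pos (x := Real.sqrt T / 2) (by positivity)
    rw [Real.log_div (by positivity) (by positivity), Real.log_sqrt (by linarith)] at h
    have : Real.log 2 ≤ 1 := by
      have := Real.log_le_sub_one_of_pos (x := 2) (by positivity); linarith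
    linarith
  have hw1 : Real.log T ^ 2 / T ≤ 1 := by
    rw [div_le_one (by linarith)]
    calc Real.log T ^ 2 ≤ Real.sqrt T ^ 2 := by gcongr
      _ = T := Real.sq_sqrt (by linarith)
  have hw0 : 0 < Real.log T ^ 2 / T := by positivity
  constructor
  · have h2 : Real.log T / Real.sqrt T = (Real.log T ^ 2 / T) ^ (1 / 2 : ℝ) := by
      rw [← Real.sqrt_eq_rpow, Real.sqrt_div (by positivity), Real.sqrt_sq hl.le]
    rw [h2]
    apply Real.rpow_le_rpow_of_exponent_ge hw0 hw1
    apply one_div_le_one_div_of_le <;> linarith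
  · rw [← Real.rpow_mul hw0.le, one_div, inv_mul_cancel₀ (by linarith), Real.rpow_one]

/-- The depth at which the analysis of HOO is stopped is at most a multiple of `ln T`. -/
theorem log_div_le {νm νs ν D₀ Dm x τ T : ℝ} (hνs : 0 < νs) (hνm : νs ≤ νm) (hD₀ : 0 < D₀)
    (hD : D₀ ≤ Dm) (hT : 2 ≤ T) (hτ : τ = Real.log T) (hx : τ / Real.sqrt T ≤ x)
    (hη : (νm / νs) ^ Dm * Dm * x ≤ ν) :
    Real.log (νm / ((νm / νs) ^ Dm * Dm * x)) ≤
      ((|Real.log νs| + |Real.log (2 * ν / D₀)| / D₀ + |Real.log (2 / D₀)|) / Real.log 2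
        + 1 / (2 * D₀) + 1 / 2) * τ := by
  have hl2 : 1 / 2 ≤ Real.log 2 := by linarith [Real.log_two_gt_d9]
  have hτ2 : Real.log 2 ≤ τ := by rw [hτ]; exact Real.log_le_log (by norm_num) hT
  have hτ0 : 0 < τ := by linarith
  have hx0 : 0 < x := lt_of_lt_of_le (by positivity) hx
  have hDm : 0 < Dm := hD₀.trans_le hD
  have hr : 1 ≤ νm / νs := by rw [le_div_iff₀ hνs]; linarith
  set V := (νm / νs) ^ Dm with hV
  have hV1 : 1 ≤ V := Real.one_le_rpow hr hDm.le
  have hν : 0 < ν := lt_of_lt_of_le (by positivity) hη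
  have hxT : 1 / x ≤ 2 * Real.sqrt T := by
    rw [div_le_iff₀ hx0]
    have h1 : 1 / 2 / Real.sqrt T ≤ x := le_trans (by gcongr; linarith) hx
    rw [div_le_iff₀ (by positivity)] at h1
    linarith
  have hlogx : -Real.log x ≤ Real.log 2 + τ / 2 := by
    have h1 := Real.log_le_log (by positivity) hxT
    rw [one_div, Real.log_inv, Real.log_mul (by positivity) (by positivity),
      Real.log_sqrt (by linarith), ← hτ] at h1
    exact h1
  -- The assumption `η ≤ ν` limits `V` to a multiple of `√T`, which in turn limits `νm`; this is why
  -- the depth bound does not involve `νm`.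
  have hlogV : Real.log V ≤ Real.log (2 * ν / D₀) + τ / 2 := by
    have h1 : V * D₀ * x ≤ ν := le_trans (by gcongr) hη
    have h2 := Real.log_le_log (by positivity) h1
    rw [Real.log_mul (by positivity) (by positivity), Real.log_mul (by positivity) (by positivity)]
      at h2
    rw [Real.log_div (by positivity) (by positivity), Real.log_mul (by positivity) (by positivity)]
    linarith
  have hlogr : Real.log (νm / νs) ≤ Real.log V / D₀ := by
    have h1 : Real.log V = Dm * Real.log (νm / νs) := Real.log_rpow (by linarith) _
    rw [le_div_iff₀ hD₀, h1, mul_comm]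
    exact mul_le_mul_of_nonneg_right hD (Real.log_nonneg hr)
  have hlogη : -Real.log (V * Dm * x) ≤ Real.log (2 / D₀) + τ / 2 := by
    have h1 : D₀ * x ≤ V * Dm * x := by
      rw [mul_assoc]
      calc D₀ * x ≤ Dm * x := by gcongr
        _ ≤ _ := le_mul_of_one_le_left (by positivity) hV1
    have h2 := Real.log_le_log (by positivity) h1
    rw [Real.log_mul (by positivity) (by positivity)] at h2
    rw [Real.log_div (by positivity) (by positivity)]
    linarith
  have hsplit : Real.log (νm / (V * Dm * x))
      = Real.log νs + Real.log (νm / νs) + -Real.log (V * Dm * x) := by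
    rw [Real.log_div (by linarith) (by positivity), Real.log_div (by linarith) (by positivity)]
    ring
  have hV' : Real.log V / D₀ ≤ |Real.log (2 * ν / D₀)| / D₀ + 1 / (2 * D₀) * τ := by
    calc Real.log V / D₀ ≤ (|Real.log (2 * ν / D₀)| + τ / 2) / D₀ := by
          gcongr
          linarith [le_abs_self (Real.log (2 * ν / D₀))]
      _ = _ := by field_simp
  set a := |Real.log νs| + |Real.log (2 * ν / D₀)| / D₀ + |Real.log (2 / D₀)| with ha
  have ha0 : 0 ≤ a := by positivity
  have ha' : a ≤ a / Real.log 2 * τ := by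
    rw [div_mul_eq_mul_div, le_div_iff₀ (by linarith)]
    gcongr
  rw [hsplit]
  linarith [le_abs_self (Real.log νs), le_abs_self (Real.log (2 / D₀))]

/-- A lower bound on `ln (1 / ρ')` for the parameter `ρ'` of the instance considered. -/
noncomputable def gridLogConst (K ρ : ℝ) : ℝ :=
  Real.log (1 / ρ) * (Real.log K / 4) / (Real.log K / 4 + Real.log (1 / ρ))

/-- The depth at which the analysis of HOO is stopped is at most this multiple of `ln T`. -/
noncomputable def depthConst (K ν νs ρ : ℝ) : ℝ :=
  ((|Real.log νs| + |Real.log (2 * ν / (Real.log K / Real.log (1 / ρ)))|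
      / (Real.log K / Real.log (1 / ρ)) + |Real.log (2 / (Real.log K / Real.log (1 / ρ)))|)
      / Real.log 2 + 1 / (2 * (Real.log K / Real.log (1 / ρ))) + 1 / 2) / gridLogConst K ρ

/-- The constant in the bound on the number of near-optimal cells. -/
noncomputable def countConst (K ν νs ρ C : ℝ) : ℝ :=
  (C + 1) * Real.exp (Real.log K + 16 * depthConst K ν νs ρ * Real.log (1 / ρ)
    + |Real.log K / Real.log (1 / ρ) * Real.log (νs / ν)|)

/-- The constant in the bound on the regret of HOO. -/
noncomputable def regretConst (K ν νs ρ : ℝ) : ℝ :=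
  2 + 10 * ν ^ 2 + depthConst K ν νs ρ * ν ^ 2
    + K * (18 / (1 - Real.exp (-gridLogConst K ρ)) + 3 * ν ^ 2 * depthConst K ν νs ρ)

theorem gridLogConst_pos {K ρ : ℝ} (hK : 1 < K) (hρ : 0 < ρ) (hρ1 : ρ < 1) :
    0 < gridLogConst K ρ := by
  have h1 : 0 < Real.log K := Real.log_pos hK
  have h2 : 0 < Real.log (1 / ρ) := Real.log_pos (by rw [lt_div_iff₀ hρ]; linarith)
  unfold gridLogConst
  positivity

theorem depthConst_nonneg {K ν νs ρ : ℝ} (hK : 1 < K) (hρ : 0 < ρ) (hρ1 : ρ < 1) :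
    0 ≤ depthConst K ν νs ρ := by
  have h1 : 0 < Real.log K := Real.log_pos hK
  have h2 : 0 < Real.log (1 / ρ) := Real.log_pos (by rw [lt_div_iff₀ hρ]; linarith)
  have h3 := gridLogConst_pos hK hρ hρ1
  have h4 : 0 < Real.log 2 := Real.log_pos (by norm_num)
  unfold depthConst
  positivity

theorem regretConst_nonneg {K ν νs ρ : ℝ} (hK : 1 < K) (hρ : 0 < ρ) (hρ1 : ρ < 1) :
    0 ≤ regretConst K ν νs ρ := by
  have h1 := depthConst_nonneg (ν := ν) (νs := νs) hK hρ hρ1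
  have h3 : 0 < 1 - Real.exp (-gridLogConst K ρ) := by
    have := gridLogConst_pos hK hρ hρ1
    have : Real.exp (-gridLogConst K ρ) < 1 := Real.exp_lt_one_iff.2 (by linarith)
    linarith
  unfold regretConst
  positivity

/-! ### A well-tuned instance among those launched by POO -/

section

variable {X Ω : Type*} {K : ℕ} [MeasurableSpace X] [mΩ : MeasurableSpace Ω]
  {P : HierarchicalPartition X K} {νmax ρmax : ℝ} {μ : Measure Ω} {F : Filtration ℕ mΩ}
  {x : ℕ → Ω → X} {r : ℕ → Ω → ℝ} {v : ℕ → Ω → List (Fin K)} {best out : ℕ → Ω → ℕ}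
  {f : X → ℝ} {xs : X}

theorem pooDmax_pos (hK : 2 ≤ K) (hρ : 0 < ρmax) (hρ1 : ρmax < 1) : 0 < pooDmax K ρmax := by
  have hK1 : (1 : ℝ) < K := by exact_mod_cast hK
  exact div_pos (Real.log_pos hK1) (Real.log_pos (by rw [lt_div_iff₀ hρ]; linarith))

/-- For the number of instances launched by POO, some instance has small expected regret. -/
theorem IsPOORun.exists_instance_regret_le [IsProbabilityMeasure μ]
    (hR : IsPOORun P νmax ρmax μ F x r v best out) (hE : IsNoisyEvaluation f μ F x r)
    (hP : ∀ u, MeasurableSet (P.cell u)) (hf : Measurable f) (hmax : ∀ x, f x ≤ f xs)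
    {ν ρ νs d C η t : ℝ} (hK : 2 ≤ K) (hsm : P.LocallySmooth f xs ν ρ) (hνs : 0 < νs)
    (hν : ν ≤ νmax) (hνsm : νs ≤ νmax) (hρ : ρ ≤ ρmax) (hρ1 : ρmax < 1) (hd : 0 ≤ d) (hC : 0 < C)
    (hN : ∀ h : ℕ, (P.numNearOpt f xs h (2 * ν * ρ ^ h) : ℝ) ≤ C * ρ ^ (-d * (h : ℝ)))
    {T N m : ℕ} (hT : 2 ≤ T)
    (hNm : pooState (pooDmax K ρmax) (pooPhase (pooDmax K ρmax) T) = (N, m)) (hm : 3 ≤ m)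
    (ht : Real.log T / Real.sqrt T ≤ t)
    (hη : η = (νmax / νs) ^ pooDmax K ρmax * pooDmax K ρmax * t) (hην : η ≤ ν) :
    ∃ i < N, ∫ ω, ∑ s ∈ pooEvals (pooDmax K ρmax) i (N * m), (f xs - f (x s ω)) ∂μ ≤
      2 * m * η / ρ + regretConst K ν νs ρ
        * (countConst K ν νs ρ C * ((νmax / νs) ^ pooDmax K ρmax * (ν / η) ^ d))
        * (Real.log T / η) := by
  have hK1 : (1 : ℝ) < K := by exact_mod_cast hK
  obtain ⟨hν0, hρ0, hρ1', hsmooth⟩ := id hsm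
  have hρm0 : 0 < ρmax := hρ0.trans_le hρ
  have hDm0 : 0 < pooDmax K ρmax := pooDmax_pos hK hρm0 hρ1
  set Dm := pooDmax K ρmax with hDm
  set k := pooPhase Dm T with hk
  set V := (νmax / νs) ^ Dm with hV
  set q := Real.log (1 / ρ) with hq
  set qm := Real.log (1 / ρmax) with hqm
  have hqm0 : 0 < qm := Real.log_pos (by rw [lt_div_iff₀ hρm0]; linarith)
  have hqmq : qm ≤ q := Real.log_le_log (by positivity) (by gcongr)
  have hq0 : 0 < q := hqm0.trans_le hqmq
  have hlK : 0 < Real.log K := Real.log_pos hK1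
  have hνm0 : 0 < νmax := hν0.trans_le hν
  have hT1 : (2 : ℝ) ≤ T := by exact_mod_cast hT
  have hτ0 : 1 / 2 ≤ Real.log T := by
    have := Real.log_le_log (by norm_num) hT1
    linarith [Real.log_two_gt_d9]
  have ht0 : 0 < t := lt_of_lt_of_le (by positivity) ht
  have hr : 1 ≤ νmax / νs := by rw [le_div_iff₀ hνs]; linarith
  have hV1 : 1 ≤ V := Real.one_le_rpow hr hDm0.le
  have hη0 : 0 < η := by rw [hη]; positivity
  have hD : Real.log K / q ≤ Dm := by rw [hDm, pooDmax, ← hqm]; gcongr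
  have htot : pooTotal Dm k = N * m := by rw [pooTotal, hNm]
  have hNpos : 0 < N := by have := pooState_fst_pos Dm k; rwa [hNm] at this
  -- the size of `N`
  set n : ℝ := (pooTotal Dm k : ℝ) with hn
  have hn2 : 2 ≤ pooTotal Dm k := by rw [htot]; nlinarith
  have hn1 : 1 < n := by rw [hn]; exact_mod_cast hn2
  set l := Real.log (n / Real.log n) with hl
  have hl1 : 1 ≤ l := one_le_log_div_log hn1
  have hNl : Real.log K / qm / 4 * l ≤ N := by
    have := le_pooState_fst hDm0.le (k := k) (by rw [hNm]; exact hm)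
    rw [hNm] at this
    exact this
  -- Less than one phase separates `n` from `T`, so `T ≤ 2 * n`, and the logarithm in the doubling
  -- test is comparable with `ln T`.
  have hτl : Real.log T ≤ 4 * l := by
    have h1 := log_le_two_mul_log_div_log (show (1 : ℝ) < T by linarith)
    have hnT : n ≤ T := by rw [hn]; exact_mod_cast pooTotal_phase_le Dm T
    have h2 := log_div_log_le hn1 hnT
    have hT2n : (T : ℝ) ≤ 2 * n := by
      have hk1 : 1 ≤ k := by
        by_contra hk0
        rw [show k = 0 by omega, pooTotal_zero] at hn2
        omega
      have h3 := (lt_pooTotal_phase_succ Dm T).le.trans (pooTotal_succ_le_two_mul Dm hk1)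
      rw [hn]
      exact_mod_cast h3
    have h4 : Real.log (T / n) ≤ 1 := by
      have h5 := Real.log_le_sub_one_of_pos (x := T / n) (by positivity)
      have h6 : T / n ≤ 2 := by rw [div_le_iff₀ (by linarith)]; exact hT2n
      linarith
    linarith
  -- the parameter of the instance
  obtain ⟨j, hj1, hjN, hq'q, hq'1, hq'0⟩ := exists_grid_index hqm0 hqmq hlK hl1 hNl
  have hj0 : (0 : ℝ) < j := by exact_mod_cast hj1
  obtain ⟨p, hp⟩ := pooState_fst_eq_two_pow Dm k
  rw [hNm] at hp
  simp only at hp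
  obtain ⟨i, hiN, hi⟩ := exists_pooRho_eq ρmax p j hj1 (hp ▸ hjN)
  rw [← hp] at hiN
  have hpN : (2 : ℝ) ^ p = N := by rw [hp]; norm_cast
  rw [hpN] at hi
  set ρ' := ρmax ^ ((N : ℝ) / (j : ℝ)) with hρ'
  have hρ'0 : 0 < ρ' := Real.rpow_pos_of_pos hρm0 _
  have hlogρ' : Real.log (1 / ρ') = N / j * qm := by
    rw [hρ', hqm, one_div, Real.log_inv, Real.log_rpow hρm0, one_div, Real.log_inv]; ring
  have hρ'exp : ρ' = Real.exp (-(N / j * qm)) := by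
    rw [← hlogρ', one_div, Real.log_inv, neg_neg, Real.exp_log hρ'0]
  have hρρ' : ρ ≤ ρ' := by
    have : ρ = Real.exp (-q) := by rw [hq, one_div, Real.log_inv, neg_neg, Real.exp_log hρ0]
    rw [this, hρ'exp]
    exact Real.exp_le_exp.2 (by linarith)
  have hg0 : 0 < gridLogConst K ρ := gridLogConst_pos hK1 hρ0 hρ1'
  have hρ'₀ : ρ' ≤ Real.exp (-gridLogConst K ρ) := by
    rw [hρ'exp]
    exact Real.exp_le_exp.2 (neg_le_neg hq'0)
  have hρ₀1 : Real.exp (-gridLogConst K ρ) < 1 := Real.exp_lt_one_iff.2 (by linarith)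
  have hρ'1 : ρ' < 1 := hρ'₀.trans_lt hρ₀1
  -- the depth at which the analysis is stopped
  obtain ⟨H, hH1, hH2⟩ := exists_nat_pow_near_of_lt_one (x := η / νmax) (by positivity)
    (by rw [div_le_one hνm0]; linarith) hρ'0 hρ'1
  rw [div_le_iff₀ hνm0, mul_comm] at hH2
  rw [lt_div_iff₀ hνm0, mul_comm] at hH1
  have hup : νmax * ρ' ^ H ≤ η / ρ := by
    rw [le_div_iff₀ hρ0]
    calc νmax * ρ' ^ H * ρ ≤ νmax * ρ' ^ H * ρ' := by gcongr
      _ = νmax * ρ' ^ (H + 1) := by rw [pow_succ]; ring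
      _ ≤ η := hH1.le
  have hc0 := depthConst_nonneg (ν := ν) (νs := νs) hK1 hρ0 hρ1'
  have hHτ : (H : ℝ) ≤ depthConst K ν νs ρ * Real.log T := by
    have h1 : (H : ℝ) * (N / j * qm) ≤ Real.log (νmax / η) := by
      rw [← hlogρ', ← Real.log_pow]
      apply Real.log_le_log (by positivity)
      rw [one_div, inv_pow, inv_eq_one_div, div_le_div_iff₀ (by positivity) hη0]
      linarith
    have h2 := log_div_le (D₀ := Real.log K / q) (Dm := Dm) hνs hνsm (by positivity) hD hT1 rfl ht
      (hη ▸ hην)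
    rw [← hV, ← hη] at h2
    have h3 : (H : ℝ) * gridLogConst K ρ ≤ H * (N / j * qm) := by
      gcongr
      exact hq'0
    rw [depthConst, div_mul_eq_mul_div, le_div_iff₀ hg0]
    exact h3.trans (h1.trans h2)
  -- the number of near-optimal cells
  have hη_rat : 1 ≤ ν / η := by rw [le_div_iff₀ hη0]; linarith
  have hpow1 : 1 ≤ (ν / η) ^ d := Real.one_le_rpow hη_rat hd
  set M := countConst K ν νs ρ C * (V * (ν / η) ^ d) with hM
  -- Using `νmax` instead of `ν` costs `K ^ (ln (νmax / ν) / q)`. Since `Real.log K / q ≤ Dm`, this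
  -- is at most a constant times `V`.
  have hlogV : Real.log K * (Real.log (νmax / ν) / q)
      ≤ Real.log V + |Real.log K / q * Real.log (νs / ν)| := by
    have h1 : Real.log V = Dm * Real.log (νmax / νs) := Real.log_rpow (by linarith) _
    have h2 : Real.log (νmax / ν) = Real.log (νmax / νs) + Real.log (νs / ν) := by
      rw [Real.log_div hνm0.ne' hν0.ne', Real.log_div hνm0.ne' hνs.ne',
        Real.log_div hνs.ne' hν0.ne']
      ring
    have h3 := mul_le_mul_of_nonneg_right hD (Real.log_nonneg hr)
    have h4 := le_abs_self (Real.log K / q * Real.log (νs / ν))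
    calc _ = Real.log K / q * Real.log (νmax / νs) + Real.log K / q * Real.log (νs / ν) := by
          rw [h2]; ring
      _ ≤ _ := by linarith
  have hcount : ∀ h ≤ H, (P.numNearOpt f xs h (2 * νmax * ρ' ^ h) : ℝ) ≤ M := by
    intro h hh
    refine (P.numNearOpt_le hmax (by omega) hν0 hν hρ0 hρρ' hρ'1 hd hC hN h).trans ?_
    rw [hlogρ', ← hq, hM, countConst, mul_assoc, mul_assoc]
    have h1 : Real.log K * (1 + h * (1 - N / j * qm / q) + Real.log (νmax / ν) / q)
        ≤ (Real.log K + 16 * depthConst K ν νs ρ * q + |Real.log K / q * Real.log (νs / ν)|)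
          + Real.log V := by
      -- A depth of order `ln T` times a grid error of order `1 / l`: the factor lost by using `ρ'`
      -- is bounded.
      have h2 : Real.log K * (h * (1 - N / j * qm / q)) ≤ 16 * depthConst K ν νs ρ * q := by
        calc _ ≤ Real.log K * ((depthConst K ν νs ρ * (4 * l)) * (4 * q / (Real.log K * l))) := by
              gcongr
              · rw [sub_nonneg, div_le_one hq0]; exact hq'q
              · have : (h : ℝ) ≤ H := by exact_mod_cast hh
                exact this.trans (hHτ.trans (by gcongr))
          _ = _ := by field_simp; ring
      linarith
    have h3 : max 1 ((ν / (νmax * ρ' ^ h)) ^ d) ≤ (ν / η) ^ d := by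
      apply max_le hpow1
      have : η ≤ νmax * ρ' ^ h := hH2.trans (by
        gcongr νmax * ?_
        exact pow_le_pow_of_le_one hρ'0.le hρ'1.le hh)
      gcongr
    calc _ ≤ (C + 1) * (Real.exp ((Real.log K + 16 * depthConst K ν νs ρ * q
          + |Real.log K / q * Real.log (νs / ν)|) + Real.log V) * (ν / η) ^ d) := by gcongr
      _ = _ := by rw [Real.exp_add, Real.exp_log (by linarith)]; ring
  have hM1 : 1 ≤ M := by
    have h1 : 1 ≤ countConst K ν νs ρ C := by
      rw [countConst]
      exact one_le_mul_of_one_le_of_one_le (by linarith) (Real.one_le_exp (by positivity))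
    exact one_le_mul_of_one_le_of_one_le h1 (one_le_mul_of_one_le_of_one_le hV1 hpow1)
  -- the regret of the instance
  have hcard : (pooEvals Dm i (N * m)).card = m := by
    have := card_pooEvals Dm k (i := i) (by rw [hNm]; exact hiN)
    rwa [htot, hNm] at this
  have hmT : m ≤ T := by
    have h1 : pooTotal Dm k ≤ T := pooTotal_phase_le Dm T
    rw [htot] at h1
    exact (Nat.le_mul_of_pos_left m hNpos).trans h1
  refine ⟨i, hiN, ?_⟩
  have hbound := hE.integral_sum_regret_le hf hP hmax hsm.sub_le hνm0 hρ'0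
    (S := pooEvals Dm i (N * m)) (by omega) (v := v)
    (fun ω => by rw [← hi]; exact hR.isHOORun i (N * m) ω)
    (fun u hu y hy => by
      refine le_trans ?_ (hsmooth u hu y hy)
      gcongr)
    hcount
  refine hbound.trans ?_
  rw [hcard]
  refine hoo_bound_le (by positivity) (by positivity) hη0 hην hρ'0 hρ'₀ hρ₀1 hνm0 hH2 hup hM1
    hτ0 (Real.log_natCast_nonneg _) (Real.log_le_log ?_ ?_) hHτ
  · exact_mod_cast (by omega : 0 < m)
  · exact_mod_cast hmT

end

/-! ### The rate of POO -/

section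

variable {X Ω : Type*} {K : ℕ} [MeasurableSpace X] [mΩ : MeasurableSpace Ω]
  {P : HierarchicalPartition X K} {νmax ρmax : ℝ} {μ : Measure Ω} {F : Filtration ℕ mΩ}
  {x : ℕ → Ω → X} {r : ℕ → Ω → ℝ} {v : ℕ → Ω → List (Fin K)} {best out : ℕ → Ω → ℕ}
  {f : X → ℝ} {xs : X}

theorem IsPOORun.integral_simpleRegret_le_const [IsProbabilityMeasure μ]
    (hR : IsPOORun P νmax ρmax μ F x r v best out) (hE : IsNoisyEvaluation f μ F x r)
    (hf : Measurable f) {ν : ℝ} (hmax : ∀ x, f x ≤ f xs) (hν : ∀ x, f xs - ν ≤ f x) {T : ℕ}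
    (hT : 1 ≤ T) : ∫ ω, simpleRegret f x out T ω ∂μ ≤ ν := by
  have hi := (hR.integral_simpleRegret_eq hE hf hmax hν hT).1
  have : Nonempty X := ⟨xs⟩
  calc _ ≤ ∫ _, ν ∂μ := by
        refine integral_mono hi (integrable_const _) fun ω => ?_
        rw [simpleRegret]
        linarith [ciSup_le hmax, hν (x (out T ω) ω)]
    _ = ν := by simp

/-- With `η = B t`, this turns the exploration term into a multiple of `η`. The leftover power of
`B` is negative, so a lower bound on `B` suffices. -/
theorem rate_balance {B ν t d : ℝ} (hB : 0 < B) (hν : 0 < ν) (ht : 0 < t) :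
    B * ((ν / (B * t)) ^ d / (B * t)) * t ^ (d + 2) = ν ^ d * (B * t) * B ^ (-(d + 1)) := by
  rw [Real.div_rpow hν.le (by positivity), Real.mul_rpow hB.le ht.le, Real.rpow_neg hB.le,
    Real.rpow_add_one hB.ne', show d + 2 = d + (2 : ℕ) by norm_num, Real.rpow_add_natCast ht.ne']
  have h1 : 0 < B ^ d := Real.rpow_pos_of_pos hB _
  have h2 : 0 < t ^ d := Real.rpow_pos_of_pos ht _
  field_simp

/-- The constant in the bound on the simple regret of POO. -/
noncomputable def pooConst (K ν νs ρ C d : ℝ) : ℝ :=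
  1 + 4 * (1 + 1 / (Real.log K / Real.log (1 / ρ) * Real.log 2)) * ν
    + (2 / ρ + 2 * (1 + 1 / (Real.log K / Real.log (1 / ρ) * Real.log 2)) * regretConst K ν νs ρ
        * countConst K ν νs ρ C * (ν ^ d * (Real.log K / Real.log (1 / ρ)) ^ (-(d + 1)))
      + 2 * (1 + 1 / (Real.log K / Real.log (1 / ρ) * Real.log 2)))

theorem pooConst_pos {K ν νs ρ C d : ℝ} (hK : 1 < K) (hν : 0 < ν) (hρ : 0 < ρ) (hρ1 : ρ < 1)
    (hC : 0 < C) : 0 < pooConst K ν νs ρ C d := by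
  have h1 : 0 < Real.log K := Real.log_pos hK
  have h2 : 0 < Real.log (1 / ρ) := Real.log_pos (by rw [lt_div_iff₀ hρ]; linarith)
  have h3 := regretConst_nonneg (ν := ν) (νs := νs) hK hρ hρ1
  have h4 : 0 < Real.log 2 := Real.log_pos (by norm_num)
  unfold pooConst countConst
  positivity

theorem IsPOORun.integral_simpleRegret_le_rate [IsProbabilityMeasure μ]
    (hR : IsPOORun P νmax ρmax μ F x r v best out) (hE : IsNoisyEvaluation f μ F x r)
    (hP : ∀ u, MeasurableSet (P.cell u)) (hf : Measurable f) (hmax : ∀ x, f x ≤ f xs)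
    {ν ρ νs d C : ℝ} (hK : 2 ≤ K) (hsm : P.LocallySmooth f xs ν ρ) (hνs : 0 < νs)
    (hν : ν ≤ νmax) (hνsm : νs ≤ νmax) (hρ : ρ ≤ ρmax) (hρ1 : ρmax < 1) (hd : 0 ≤ d) (hC : 0 < C)
    (hN : ∀ h : ℕ, (P.numNearOpt f xs h (2 * ν * ρ ^ h) : ℝ) ≤ C * ρ ^ (-d * (h : ℝ)))
    {T : ℕ} (hT : 2 ≤ T) :
    ∫ ω, simpleRegret f x out T ω ∂μ ≤ pooConst K ν νs ρ C d *
      ((νmax / νs) ^ pooDmax K ρmax * pooDmax K ρmax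
        * ((Real.log T) ^ 2 / T) ^ (1 / (d + 2))) := by
  have hK1 : (1 : ℝ) < K := by exact_mod_cast hK
  have hν0 := hsm.1
  have hρ0 := hsm.2.1
  have hρ1' := hsm.2.2.1
  have hρm0 : 0 < ρmax := hρ0.trans_le hρ
  have hDm0 : 0 < pooDmax K ρmax := pooDmax_pos hK hρm0 hρ1
  have hT2 : (2 : ℝ) ≤ T := by exact_mod_cast hT
  obtain ⟨ht, htd⟩ := rate_bounds hT2 hd
  set t := ((Real.log T) ^ 2 / T) ^ (1 / (d + 2)) with ht_def
  have hl2 : 0 < Real.log 2 := Real.log_pos (by norm_num)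
  have hτ2 : Real.log 2 ≤ Real.log T := Real.log_le_log (by norm_num) hT2
  set τ := Real.log T with hτ
  have hτ0 : 0 < τ := by linarith
  have ht0 : 0 < t := lt_of_lt_of_le (by positivity) ht
  have hlK : 0 < Real.log K := Real.log_pos hK1
  have hq0 : 0 < Real.log (1 / ρ) := Real.log_pos (by rw [lt_div_iff₀ hρ0]; linarith)
  have hD : Real.log K / Real.log (1 / ρ) ≤ pooDmax K ρmax := by
    have : 0 < Real.log (1 / ρmax) := Real.log_pos (by rw [lt_div_iff₀ hρm0]; linarith)
    rw [pooDmax]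
    gcongr
  have hr : 1 ≤ νmax / νs := by rw [le_div_iff₀ hνs]; linarith
  have hV1 : 1 ≤ (νmax / νs) ^ pooDmax K ρmax := Real.one_le_rpow hr hDm0.le
  have hA₂ := regretConst_nonneg (ν := ν) (νs := νs) hK1 hρ0 hρ1'
  have hA₁ : 0 ≤ countConst K ν νs ρ C := by unfold countConst; positivity
  unfold pooConst
  set D₀ := Real.log K / Real.log (1 / ρ) with hD₀
  have hD₀0 : 0 < D₀ := by positivity
  set c := 1 + 1 / (D₀ * Real.log 2) with hc
  have hc0 : 0 < c := by positivity
  set Dm := pooDmax K ρmax with hDm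
  set V := (νmax / νs) ^ Dm with hV
  set A₂ := regretConst K ν νs ρ
  set A₁ := countConst K ν νs ρ C
  set η := V * Dm * t with hη
  have hη0 : 0 < η := by positivity
  have hDη : Dm * t ≤ η := by
    rw [hη, mul_assoc]; exact le_mul_of_one_le_left (by positivity) hV1
  have hk1 : 1 ≤ pooPhase Dm T := le_pooPhase (by
    rw [show pooTotal Dm 1 = 1 by simp [pooTotal, pooState]]; omega)
  set k := pooPhase Dm T with hk
  obtain ⟨N, m, hNm⟩ : ∃ N m, pooState Dm k = (N, m) := ⟨_, _, rfl⟩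
  have htot : pooTotal Dm k = N * m := by rw [pooTotal, hNm]
  have hNT : (N : ℝ) ≤ c * Dm * τ := by
    have h1 := pooState_fst_le (D := Dm) (k := k) (T := T) (pooTotal_phase_le Dm T)
    rw [hNm] at h1
    have h2 : D₀ * Real.log 2 ≤ Dm * τ := by gcongr
    refine h1.trans (max_le ?_ ?_)
    · have h3 : 1 ≤ 1 / (D₀ * Real.log 2) * (Dm * τ) := by
        rw [one_div, ← div_eq_inv_mul, le_div_iff₀ (by positivity)]; linarith
      have : 0 ≤ Dm * τ := by positivity
      calc (1 : ℝ) ≤ 1 / (D₀ * Real.log 2) * (Dm * τ) := h3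
        _ ≤ _ := by rw [hc]; linarith
    · rw [hc, mul_assoc]
      exact le_mul_of_one_le_left (by positivity) (by
        have : 0 < 1 / (D₀ * Real.log 2) := by positivity
        linarith)
  have hTNm : (T : ℝ) ≤ 2 * (N * m) := by
    have h3 := (lt_pooTotal_phase_succ Dm T).le.trans (pooTotal_succ_le_two_mul Dm hk1)
    rw [← hk, htot] at h3
    exact_mod_cast h3
  have hsqrtT : 0 < Real.sqrt T := Real.sqrt_pos.2 (by linarith)
  have hconst := hR.integral_simpleRegret_le_const hE hf hmax hsm.sub_le (show 1 ≤ T by omega)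
  set Y := 2 / ρ + 2 * c * A₂ * A₁ * (ν ^ d * D₀ ^ (-(d + 1))) + 2 * c with hY
  have hY0 : 0 ≤ Y := by positivity
  -- The regret never exceeds `ν`, so the bound is trivial if `ν < η`. It is also trivial if `m <
  -- 3`: then `T ≤ 4 * N`, and `N = O(Dm ln T)` makes `η` bounded below.
  rcases lt_or_ge ν η with hνη | hην
  · calc _ ≤ 1 * η := by linarith
      _ ≤ _ := by
        gcongr
        have : 0 ≤ 4 * c * ν := by positivity
        linarith
  rcases lt_or_ge m 3 with hm | hm
  · have hm2 : (m : ℝ) ≤ 2 := by exact_mod_cast (by omega : m ≤ 2)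
    have h1 : (T : ℝ) ≤ 4 * c * (Dm * τ) := by
      have : (N : ℝ) * m ≤ (c * Dm * τ) * 2 := by gcongr
      linarith
    have h2 : 1 ≤ 4 * c * η := by
      have h3 : Real.sqrt T ≤ 4 * c * (Dm * (τ / Real.sqrt T)) := by
        rw [mul_div_assoc', mul_div_assoc', le_div_iff₀ hsqrtT, Real.mul_self_sqrt (by linarith)]
        exact h1
      have h4 : 1 ≤ Real.sqrt T := Real.one_le_sqrt.2 (by linarith)
      calc 1 ≤ 4 * c * (Dm * (τ / Real.sqrt T)) := h4.trans h3
        _ ≤ 4 * c * (Dm * t) := by gcongr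
        _ ≤ _ := by gcongr
    calc _ ≤ ν * 1 := by linarith
      _ ≤ ν * (4 * c * η) := by gcongr
      _ = 4 * c * ν * η := by ring
      _ ≤ _ := by
        gcongr
        linarith
  obtain ⟨i, hiN, hi⟩ := hR.exists_instance_regret_le hE hP hf hmax hK hsm hνs hν hνsm hρ hρ1 hd hC
    hN hT hNm hm ht hη hην
  have hle := hR.integral_simpleRegret_le hE hf hmax hsm.sub_le (show 1 ≤ T by omega) hNm hiN
  have hm0 : (0 : ℝ) < m := by exact_mod_cast (by omega : 0 < m)
  have hsq : Real.sqrt (N / m) ≤ 2 * c * η := by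
    have h1 : Real.sqrt (N / m) ≤ 2 * N / Real.sqrt T := by
      rw [Real.sqrt_le_left (by positivity), div_pow, Real.sq_sqrt (by linarith),
        div_le_div_iff₀ hm0 (by linarith)]
      have : (N : ℝ) * T ≤ N * (2 * (N * m)) := by gcongr
      have h0 : 0 ≤ (N : ℝ) * (2 * (N * m)) := by positivity
      have h2 : (2 * (N : ℝ)) ^ 2 * m = 2 * (N * (2 * (N * m))) := by ring
      linarith
    calc _ ≤ 2 * N / Real.sqrt T := h1
      _ ≤ 2 * (c * Dm * τ) / Real.sqrt T := by gcongr
      _ = 2 * c * (Dm * (τ / Real.sqrt T)) := by ring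
      _ ≤ 2 * c * (Dm * t) := by gcongr
      _ ≤ _ := by gcongr
  have hmT : 1 / (m : ℝ) ≤ 2 * (c * Dm * τ) / T := by
    rw [div_le_div_iff₀ hm0 (by linarith)]
    have : (N : ℝ) * m ≤ (c * Dm * τ) * m := by gcongr
    linarith
  have hB : D₀ ≤ V * Dm := hD.trans (le_mul_of_one_le_left hDm0.le hV1)
  have hB0 : 0 < V * Dm := by positivity
  have hbal := rate_balance (d := d) hB0 hν0 ht0
  rw [htd, ← hη] at hbal
  -- `V * Dm ≥ D₀` removes the last dependence of the constant on `νmax` and `ρmax`.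
  have hmono : (V * Dm) ^ (-(d + 1)) ≤ D₀ ^ (-(d + 1)) :=
    Real.rpow_le_rpow_of_nonpos hD₀0 hB (by linarith)
  have hi' : (∫ ω, ∑ s ∈ pooEvals Dm i (N * m), (f xs - f (x s ω)) ∂μ) / m ≤
      (2 / ρ + 2 * c * A₂ * A₁ * (ν ^ d * D₀ ^ (-(d + 1)))) * η := by
    calc _ ≤ (2 * m * η / ρ + A₂ * (A₁ * (V * (ν / η) ^ d)) * (τ / η)) / m := by gcongr
      _ = 2 / ρ * η + A₂ * A₁ * V * ((ν / η) ^ d / η) * τ * (1 / m) := by field_simp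
      _ ≤ 2 / ρ * η + A₂ * A₁ * V * ((ν / η) ^ d / η) * τ * (2 * (c * Dm * τ) / T) := by gcongr
      _ = 2 / ρ * η + 2 * c * A₂ * A₁ * (V * Dm * ((ν / η) ^ d / η) * (τ ^ 2 / T)) := by ring
      _ = 2 / ρ * η + 2 * c * A₂ * A₁ * (ν ^ d * η * (V * Dm) ^ (-(d + 1))) := by rw [hbal]
      _ ≤ 2 / ρ * η + 2 * c * A₂ * A₁ * (ν ^ d * η * D₀ ^ (-(d + 1))) := by gcongr
      _ = _ := by ring
  calc _ ≤ (2 / ρ + 2 * c * A₂ * A₁ * (ν ^ d * D₀ ^ (-(d + 1)))) * η + 2 * c * η :=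
        hle.trans (add_le_add hi' hsq)
    _ = Y * η := by rw [hY]; ring
    _ ≤ _ := by
      gcongr
      have : 0 ≤ 4 * c * ν := by positivity
      linarith

end

/-- With a single child per node every cell is the whole space, and smoothness at all depths forces
`f` to be constant. -/
theorem HierarchicalPartition.LocallySmooth.le_of_card_eq_one {X : Type*} {f : X → ℝ}
    {xs : X} {ν ρ : ℝ} {P : HierarchicalPartition X 1} (h : P.LocallySmooth f xs ν ρ) (y : X) : f xs ≤ f y := by
  obtain ⟨hν, hρ, hρ1, hsm⟩ := h
  have huniv : ∀ u, P.cell u = Set.univ := by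
    intro u
    induction u with
    | nil => exact P.cell_root
    | cons i u ih =>
      rw [← ih, ← P.cell_split u]
      refine (Set.eq_of_subset_of_subset (Set.iUnion_subset fun j => ?_)
        (Set.subset_iUnion (fun i => P.cell (i :: u)) i)).symm
      rw [Subsingleton.elim j i]
  have hlim : Filter.Tendsto (fun n : ℕ => f xs - ν * ρ ^ n) Filter.atTop (nhds (f xs - ν * 0)) :=
    ((tendsto_pow_atTop_nhds_zero_of_lt_one hρ.le hρ1).const_mul ν).const_sub _
  rw [mul_zero, sub_zero] at hlim
  refine le_of_tendsto' hlim fun n => ?_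
  have := hsm (List.replicate n 0) (by rw [huniv]; trivial) y (by rw [huniv]; trivial)
  simpa using this

theorem mainTheorem8 {X : Type*} [MeasurableSpace X] {K : ℕ}
    (P : HierarchicalPartition X K) (hP : ∀ u, MeasurableSet (P.cell u))
    (f : X → ℝ) (hf : Measurable f) (xs : X) (hxs : ∀ x, f x ≤ f xs)
    (ν ρ νs ρs : ℝ) (hνρ : P.LocallySmooth f xs ν ρ) (hs : P.LocallySmooth f xs νs ρs)
    (d : ℝ)
    (hd : P.nearOptDim f xs ν ρ < d ∨
      (d = P.nearOptDim f xs ν ρ ∧ P.nearOptDim f xs ν ρ ∈ P.nearOptExponents f xs ν ρ)) :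
    ∃ α : ℝ, 0 < α ∧
      ∀ νmax ρmax : ℝ, ν ≤ νmax → νs ≤ νmax → ρ ≤ ρmax → ρmax < 1 →
      ∀ T : ℕ, 2 ≤ T →
        (((Finset.range T).image (pooInstance (pooDmax K ρmax))).card : ℝ)
            ≤ max 1 (pooDmax K ρmax * Real.log T) ∧
        ∀ (Ω : Type*) [mΩ : MeasurableSpace Ω] (μ : MeasureTheory.Measure Ω)
          [MeasureTheory.IsProbabilityMeasure μ] (F : MeasureTheory.Filtration ℕ mΩ)
          (x : ℕ → Ω → X) (r : ℕ → Ω → ℝ) (v : ℕ → Ω → List (Fin K)) (best out : ℕ → Ω → ℕ),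
          IsNoisyEvaluation f μ F x r →
          IsPOORun P νmax ρmax μ F x r v best out →
          MeasureTheory.Integrable (simpleRegret f x out T) μ ∧
          ∫ ω, simpleRegret f x out T ω ∂μ
            ≤ (α * pooDmax K ρmax * (νmax / νs) ^ pooDmax K ρmax)
                * ((Real.log T) ^ 2 / T) ^ (1 / (d + 2)) := by
  obtain ⟨C, hd0, hC, hN⟩ : ∃ C : ℝ, 0 ≤ d ∧ 0 < C ∧
      ∀ h : ℕ, (P.numNearOpt f xs h (2 * ν * ρ ^ h) : ℝ) ≤ C * ρ ^ (-d * (h : ℝ)) := by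
    have hmem : d ∈ P.nearOptExponents f xs ν ρ := by
      have hK : 1 ≤ K := by
        rcases Nat.eq_zero_or_pos K with rfl | hK
        · have h := P.cell_split []
          rw [Set.iUnion_of_empty, P.cell_root] at h
          exact absurd (Set.mem_univ xs) (h ▸ Set.notMem_empty xs)
        · exact hK
      rcases hd with hd | ⟨rfl, hd⟩
      -- Above the infimum there is a smaller admissible exponent, and admissibility is inherited
      -- upwards.
      · obtain ⟨d', hd', hlt⟩ := exists_lt_of_csInf_lt
          ⟨_, P.log_div_log_mem_nearOptExponents hxs hK hνρ.2.1 hνρ.2.2.1⟩ hd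
        exact P.nearOptExponents_nonneg_mono hνρ.2.1 hνρ.2.2.1 hd' hlt.le
      · exact hd
    obtain ⟨h0, C, hC, hN⟩ := hmem
    exact ⟨C, h0, hC, hN⟩
  -- For `K = 1` one has `D_max = 0`, so the claimed bound is zero and the regret must vanish; it
  -- does because `f` is constant. `K = 0` is impossible, as the root cell contains `xs`.
  rcases Nat.lt_or_ge K 2 with hK | hK
  · refine ⟨1, one_pos, fun νmax ρmax hν hνs hρ hρ1 T hT =>
      ⟨card_image_pooInstance_le _ (by omega), ?_⟩⟩
    intro Ω mΩ μ hμ F x r v best out hE hR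
    have hconst : ∀ y, f xs - 0 ≤ f y := by
      intro y
      rw [sub_zero]
      interval_cases K
      · have h := P.cell_split []
        rw [Set.iUnion_of_empty, P.cell_root] at h
        exact absurd (Set.mem_univ xs) (h ▸ Set.notMem_empty xs)
      · exact hνρ.le_of_card_eq_one y
    refine ⟨(hR.integral_simpleRegret_eq hE hf hxs hconst (by omega)).1, ?_⟩
    refine (hR.integral_simpleRegret_le_const hE hf hxs hconst (by omega)).trans (le_of_eq ?_)
    have : pooDmax K ρmax = 0 := by interval_cases K <;> simp [pooDmax]
    rw [this]
    ring
  · refine ⟨pooConst K ν νs ρ C d,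
      pooConst_pos (by exact_mod_cast hK) hνρ.1 hνρ.2.1 hνρ.2.2.1 hC,
      fun νmax ρmax hν hνs hρ hρ1 T hT => ⟨card_image_pooInstance_le _ (by omega), ?_⟩⟩
    intro Ω mΩ μ hμ F x r v best out hE hR
    refine ⟨(hR.integral_simpleRegret_eq hE hf hxs hνρ.sub_le (by omega)).1, ?_⟩
    refine (hR.integral_simpleRegret_le_rate hE hP hf hxs hK hνρ hs.1 hν hνs hρ hρ1 hd0 hC hN
      hT).trans (le_of_eq ?_)
    ring
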